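/- **Conventions.** $\mathbb{R}^4_1$ is $\mathbb{R}^4$ with the Lorentz metric $\langle x,y\rangle=-x_0y_0+x_1y_1+x_2y_2+x_3y_3$, identified with the Hermitian $2\times2$ matrices by $x\leftrightarrow\begin{pmatrix}x_0+x_3&x_1+ix_2\\x_1-ix_2&x_0-x_3\end{pmatrix}$. De Sitter space is $\mathbb{S}^3_1=\{\langle x,x\rangle=1\}$, oriented so that $(e_0,e_1,e_2)$ is a positive basis of $T_{e_3}\mathbb{S}^3_1$, where $e_0,\dots,e_3$ is the standard basis of $\mathbb{R}^4_1$; as matrices, $e_0$ is the identity and $e_3=\mathrm{diag}(1,-1)$. A Riemann surface carries the orientation of its complex structure. Let $S$ be a Riemann surface and $f:S\to\mathbb{S}^3_1$ a smooth map with induced (possibly degenerate) metric $ds^2$. A point is *singular* if $ds^2$ is degenerate there. Where $ds^2$ is positive definite, the *oriented unit normal* $N$ is the timelike unit normal such that $(N,f_x,f_y)$ is positive for every holomorphic coordinate $x+iy$; the second fundamental form is $h=-\langle dN,df\rangle$, and the mean curvature is half its trace with respect to $ds^2$. The hyperbolic Gauss map $G$ assigns to a nonsingular point the end point at infinity of the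 geodesic ray $\cosh(t)f+\sinh(t)N$, i.e. the null line spanned by $f+N$, the line spanned by $\xi\xi^*$ being identified with $\xi_1/\xi_2\in\mathbb{C}\cup\{\infty\}$. The map $f$ is a *CMC 1 face* if there is an open dense set $W\subset S$ on which $f$ is a spacelike immersion of mean curvature $1$, and every singular point $p$ is *admissible*: (1) there are a neighbourhood $U$ of $p$ and a positive $C^1$ function $\beta$ on $U\cap W$ such that $\beta\,ds^2$ extends to a $C^1$ Riemannian metric on $U$; (2) $df(p)\neq0$. **Theorem.** Let $M$ be a Riemann surface with base point $z_0$ and let $\varrho:\widetilde M\to M$ be its universal cover, with a base point $\tilde z_0$ over $z_0$. (a) Let $g$ be a meromorphic function and $\omega$ a holomorphic $1$-form on $\widetilde M$ such that $d\hat s^2=(1+|g|^2)^2\omega\bar\omega$ is (extends over the poles of $g$ to) a Riemannian metric on $\widetilde M$ and $|g|$ is not identically $1$. Then there is a unique holomorphic immersion $F=(F_{jk}):\widetilde M\to SL(2,\mathbb{C})$ with $F(\tilde z_0)=e_0$ and $$F^{-1}dF=\begin{pmatrix}g&-g^2\\1&-g\end{pmatrix}\omega ,\qquad(*)$$ and $f=Fe_3F^*:\widetilde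 M\to\mathbb{S}^3_1$ is a CMC 1 face which is conformal away from its singular points. Its induced metric is $ds^2=(1-|g|^2)^2\omega\bar\omega$, and at its nonsingular points its second fundamental form and hyperbolic Gauss map are $$h=Q+\overline Q+ds^2\quad\text{with } Q=\omega\,dg,\qquad G=\frac{dF_{11}}{dF_{21}}=\frac{dF_{12}}{dF_{22}}$$ (identities between tensors involving $g$ are understood away from the poles of $g$, and each quotient wherever its numerator and denominator are not both zero). A point of $\widetilde M$ is a singular point of $f$ if and only if $|g|=1$ there. (b) Conversely, let $f:M\to\mathbb{S}^3_1$ be a CMC 1 face that is conformal away from its singular points. Then there are a meromorphic function $g$ and a holomorphic $1$-form $\omega$ on $\widetilde M$ such that $|g|$ is not identically $1$ and $(1+|g|^2)^2\omega\bar\omega$ is a Riemannian metric on $\widetilde M$, and a holomorphic immersion $F:\widetilde M\to SL(2,\mathbb{C})$ satisfying $(*)$, such that $f\circ\varrho=Fe_3F^*$. -/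

import Mathlib

open scoped Manifold ContDiff Topology Matrix ComplexConjugate

noncomputable section

namespace DeSitter

/-! ## Lorentz space, Hermitian matrices and de Sitter space -/

/-- The underlying vector space of Lorentz 4-space, with coordinates `(x₀, x₁, x₂, x₃)`. -/
abbrev L4 : Type := Fin 4 → ℝ

/-- The Lorentz metric `- x₀ y₀ + x₁ y₁ + x₂ y₂ + x₃ y₃`. -/
def lorentz (x y : L4) : ℝ := - x 0 * y 0 + x 1 * y 1 + x 2 * y 2 + x 3 * y 3

/-- De Sitter 3-space, the unit pseudosphere of Lorentz 4-space. -/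
def deSitter : Set L4 := {x | lorentz x x = 1}

/-- The identification of Lorentz 4-space with the Hermitian `2 × 2` matrices,
`(x₀, x₁, x₂, x₃) ↔ [[x₀ + x₃, x₁ + i x₂], [x₁ - i x₂, x₀ - x₃]]`. -/
def hermEquiv : L4 ≃ {X : Matrix (Fin 2) (Fin 2) ℂ // X.IsHermitian} where
  toFun x := ⟨!![(x 0 + x 3 : ℂ), x 1 + Complex.I * x 2; x 1 - Complex.I * x 2, x 0 - x 3], by
    ext i j
    fin_cases i <;> fin_cases j <;> simp [sub_eq_add_neg]⟩
  invFun X := ![((X.1 0 0).re + (X.1 1 1).re) / 2, (X.1 0 1).re, (X.1 0 1).im,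
    ((X.1 0 0).re - (X.1 1 1).re) / 2]
  left_inv x := by
    ext i
    fin_cases i <;> simp
  right_inv X := by
    obtain ⟨X, hX⟩ := X
    have h00 := congrArg Complex.im (hX.apply 0 0)
    have h11 := congrArg Complex.im (hX.apply 1 1)
    have h01 := hX.apply 1 0
    simp only [RCLike.star_def, Complex.conj_im] at h00 h11
    apply Subtype.ext
    ext i j
    fin_cases i <;> fin_cases j <;> apply Complex.ext <;> simp [← h01] <;> linarith

/-- The matrix `e₃ = diag(1, -1)`. -/
def e3 : Matrix (Fin 2) (Fin 2) ℂ := !![1, 0; 0, -1]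

lemma isHermitian_mul_e3_mul (A : Matrix (Fin 2) (Fin 2) ℂ) : (A * e3 * Aᴴ).IsHermitian := by
  have h : e3.IsHermitian := by
    ext i j
    fin_cases i <;> fin_cases j <;> simp [e3]
  exact Matrix.isHermitian_mul_mul_conjTranspose A h

/-! ## Tensors on a Riemann surface

A Riemann surface carries the model `𝓘(ℂ)`, and, as a real surface, the model `𝓘(ℝ, ℂ)` on the
same charts.  Tangent spaces for the two models coincide, and their real basis `1, i` is positively
oriented. -/

section Surface

variable {S : Type*} [TopologicalSpace S] [ChartedSpace ℂ S]

/-- `ρ` restricts to a Riemannian metric of class `C^n` on the open set `U`: it is positive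
definite on `U`, and near every point of `U` it is `E dx² + 2 F dx dy + G dy²` with `C^n`
coefficients, where `x + i y` is the preferred local coordinate. -/
def IsRiemannianMetricOn (n : WithTop ℕ∞) (U : Set S)
    (ρ : ∀ p : S, TangentSpace 𝓘(ℝ, ℂ) p → TangentSpace 𝓘(ℝ, ℂ) p → ℝ) : Prop :=
  (∀ p ∈ U, ∀ v : TangentSpace 𝓘(ℝ, ℂ) p, v ≠ 0 → 0 < ρ p v v) ∧
  ∀ p ∈ U, ∃ E F G : S → ℝ,
    ContMDiffAt 𝓘(ℝ, ℂ) 𝓘(ℝ) n E p ∧ ContMDiffAt 𝓘(ℝ, ℂ) 𝓘(ℝ) n F p ∧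
    ContMDiffAt 𝓘(ℝ, ℂ) 𝓘(ℝ) n G p ∧
    ∀ᶠ q in 𝓝 p, ∀ v w : TangentSpace 𝓘(ℝ, ℂ) q,
      let a : ℂ := mfderiv 𝓘(ℝ, ℂ) 𝓘(ℝ, ℂ) (chartAt ℂ p) q v
      let b : ℂ := mfderiv 𝓘(ℝ, ℂ) 𝓘(ℝ, ℂ) (chartAt ℂ p) q w
      ρ q v w = E q * (a.re * b.re) + F q * (a.re * b.im + a.im * b.re) + G q * (a.im * b.im)

/-- The differential of a complex-valued function on a Riemann surface. -/
def complexDiff (h : S → ℂ) (p : S) (v : TangentSpace 𝓘(ℂ) p) : ℂ := mfderiv 𝓘(ℂ) 𝓘(ℂ) h p v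

/-- A field of complex covectors is a holomorphic 1-form if near every point it is `a dz` with `a`
holomorphic, where `z` is the preferred local coordinate. -/
def IsHolomorphicForm (η : ∀ p : S, TangentSpace 𝓘(ℂ) p →L[ℂ] ℂ) : Prop :=
  ∀ p : S, ∃ a : S → ℂ, (∀ᶠ q in 𝓝 p, MDifferentiableAt 𝓘(ℂ) 𝓘(ℂ) a q) ∧
    ∀ᶠ q in 𝓝 p, ∀ v : TangentSpace 𝓘(ℂ) q,
      η q v = a q * complexDiff (chartAt ℂ p) q v

/-- The point `a / b` of the Riemann sphere `ℂ ∪ {∞}` (meaningful unless `a = b = 0`). -/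
def ratio (a b : ℂ) : OnePoint ℂ := if b = 0 then OnePoint.infty else ((a / b : ℂ) : OnePoint ℂ)

/-- A function with values in the Riemann sphere is meromorphic if near every point either `g` or
`1 / g` is a holomorphic function, which in the second case does not vanish identically near the
point. -/
def IsMeromorphicFunction (g : S → OnePoint ℂ) : Prop :=
  ∀ p : S, ∃ h : S → ℂ, (∀ᶠ q in 𝓝 p, MDifferentiableAt 𝓘(ℂ) 𝓘(ℂ) h q) ∧
    ((∀ᶠ q in 𝓝 p, g q = (h q : OnePoint ℂ)) ∨
      ((∃ᶠ q in 𝓝 p, h q ≠ 0) ∧ ∀ᶠ q in 𝓝 p, g q = ratio 1 (h q)))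

/-- The value of a sphere-valued function as a complex number (with value `0` at a pole). -/
def finiteValue (x : OnePoint ℂ) : ℂ := x.elim 0 id

/-- `|g| = 1` at a point. -/
def UnitModulus (x : OnePoint ℂ) : Prop := ∃ c : ℂ, x = (c : OnePoint ℂ) ∧ ‖c‖ = 1

/-- `(1 + |g|²)² |η|²`, which is defined away from the poles of `g`, is a Riemannian metric: it
extends (necessarily uniquely) over the poles to a smooth Riemannian metric on the surface. -/
def HatMetricIsRiemannian (g : S → OnePoint ℂ) (η : ∀ p : S, TangentSpace 𝓘(ℂ) p →L[ℂ] ℂ) : Prop :=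
  ∃ ρ : ∀ p : S, TangentSpace 𝓘(ℝ, ℂ) p → TangentSpace 𝓘(ℝ, ℂ) p → ℝ,
    IsRiemannianMetricOn ∞ Set.univ ρ ∧
    ∀ p : S, ∀ c : ℂ, g p = (c : OnePoint ℂ) → ∀ v w : TangentSpace 𝓘(ℝ, ℂ) p,
      ρ p v w = (1 + ‖c‖ ^ 2) ^ 2 * (η p v * conj (η p w)).re

/-! ## Surfaces in de Sitter space -/

/-- The differential of a map of a surface into Lorentz space. -/
def diff (f : S → L4) (p : S) (v : TangentSpace 𝓘(ℝ, ℂ) p) : L4 :=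
  mfderiv 𝓘(ℝ, ℂ) 𝓘(ℝ, L4) f p v

/-- The induced metric `ds²`. -/
def inducedMetric (f : S → L4) (p : S) (v w : TangentSpace 𝓘(ℝ, ℂ) p) : ℝ :=
  lorentz (diff f p v) (diff f p w)

/-- `p` is a singular point of `f` if the induced metric is degenerate at `p`. -/
def IsSingularPoint (f : S → L4) (p : S) : Prop :=
  ∃ v : TangentSpace 𝓘(ℝ, ℂ) p, v ≠ 0 ∧ ∀ w : TangentSpace 𝓘(ℝ, ℂ) p, inducedMetric f p v w = 0

/-- The coordinate `dz(v)` of a tangent vector in the preferred coordinate `z` at its base point. -/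
def tangentCoord {p : S} (v : TangentSpace 𝓘(ℝ, ℂ) p) : ℂ := v

/-- The induced metric at `p` is a positive multiple of `|dz|²`. -/
def IsConformalAt (f : S → L4) (p : S) : Prop :=
  ∃ r : ℝ, 0 < r ∧ ∀ v w : TangentSpace 𝓘(ℝ, ℂ) p,
    inducedMetric f p v w = r * (tangentCoord v * conj (tangentCoord w)).re

/-- `n` is the oriented unit normal of the spacelike surface `f` at `p`: it is a timelike unit
vector, tangent to de Sitter space at `f p`, orthogonal to the surface, and `(n, f_x, f_y)` is a
positive basis of the tangent space of de Sitter space (the one where `(e₀, e₁, e₂)` is positive at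
the point `e₃`) for every positive coordinate system `x + i y`. -/
def IsOrientedUnitNormal (f : S → L4) (p : S) (n : L4) : Prop :=
  lorentz n n = -1 ∧ lorentz n (f p) = 0 ∧
  (∀ v : TangentSpace 𝓘(ℝ, ℂ) p, lorentz n (diff f p v) = 0) ∧
  0 < (Matrix.of ![n, diff f p (1 : ℂ), diff f p Complex.I, f p]).det

/-- The second fundamental form `- ⟨dN, df⟩` with respect to a unit normal field `N`. -/
def secondForm (f N : S → L4) (p : S) (v w : TangentSpace 𝓘(ℝ, ℂ) p) : ℝ :=
  - lorentz (diff N p v) (diff f p w)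

/-- The mean curvature with respect to `N`: half the trace of the second fundamental form with
respect to the induced metric. -/
def meanCurvature (f N : S → L4) (p : S) : ℝ :=
  (inducedMetric f p Complex.I Complex.I * secondForm f N p (1 : ℂ) (1 : ℂ)
    - 2 * inducedMetric f p (1 : ℂ) Complex.I * secondForm f N p (1 : ℂ) Complex.I
    + inducedMetric f p (1 : ℂ) (1 : ℂ) * secondForm f N p Complex.I Complex.I) /
  (2 * (inducedMetric f p (1 : ℂ) (1 : ℂ) * inducedMetric f p Complex.I Complex.I
    - inducedMetric f p (1 : ℂ) Complex.I ^ 2))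

/-- On the open set `W` the map `f` is a spacelike immersion whose mean curvature with respect to
the oriented unit normal field is `1`. -/
def IsSpacelikeCMC1On (f : S → L4) (W : Set S) : Prop :=
  (∀ p ∈ W, ∀ v : TangentSpace 𝓘(ℝ, ℂ) p, v ≠ 0 → 0 < inducedMetric f p v v) ∧
  ∃ N : S → L4, ∀ p ∈ W, IsOrientedUnitNormal f p (N p) ∧ meanCurvature f N p = 1

/-- A singular point `p` is admissible (`W` being an open dense set of regular points): on some
neighbourhood `U` of `p` a positive multiple `β ds²`, with `β` of class `C¹` on `U ∩ W`, extends to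
a `C¹` Riemannian metric on `U`, and `df` does not vanish at `p`. -/
def IsAdmissible (f : S → L4) (W : Set S) (p : S) : Prop :=
  (∃ U : Set S, IsOpen U ∧ p ∈ U ∧ ∃ β : S → ℝ,
    (∀ q ∈ U ∩ W, 0 < β q) ∧ ContMDiffOn 𝓘(ℝ, ℂ) 𝓘(ℝ) 1 β (U ∩ W) ∧
    ∃ ρ : ∀ q : S, TangentSpace 𝓘(ℝ, ℂ) q → TangentSpace 𝓘(ℝ, ℂ) q → ℝ,
      IsRiemannianMetricOn 1 U ρ ∧
      ∀ q ∈ U ∩ W, ∀ v w : TangentSpace 𝓘(ℝ, ℂ) q, ρ q v w = β q * inducedMetric f q v w) ∧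
  ∃ v : TangentSpace 𝓘(ℝ, ℂ) p, diff f p v ≠ 0

/-- CMC 1 faces: smooth maps into de Sitter space that are spacelike CMC 1 immersions on an open
dense set and all of whose singular points are admissible. -/
def IsCMC1Face (f : S → L4) : Prop :=
  ContMDiff 𝓘(ℝ, ℂ) 𝓘(ℝ, L4) ∞ f ∧ (∀ p, f p ∈ deSitter) ∧
  ∃ W : Set S, IsOpen W ∧ Dense W ∧ IsSpacelikeCMC1On f W ∧
    ∀ p, IsSingularPoint f p → IsAdmissible f W p

/-- The hyperbolic Gauss map: the end point on the ideal boundary of the geodesic ray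
`t ↦ (cosh t) f + (sinh t) N`, that is, the null line spanned by `f + N`.  A null line is spanned
by a matrix `ξ ξ^*` and is identified with the point `ξ₁ / ξ₂` of the Riemann sphere. -/
def hyperbolicGaussMap (f N : S → L4) (p : S) : OnePoint ℂ :=
  let X : Matrix (Fin 2) (Fin 2) ℂ := (hermEquiv (f p + N p)).1
  ratio (X 0 1) (X 1 1)

/-! ## The representation formula -/

/-- The matrix of the holomorphic differentials of the entries of `F`. -/
def matDiff (F : S → Matrix.SpecialLinearGroup (Fin 2) ℂ) (p : S) (v : TangentSpace 𝓘(ℂ) p) :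
    Matrix (Fin 2) (Fin 2) ℂ :=
  Matrix.of fun i j => complexDiff (fun q => F q i j) p v

/-- Holomorphic immersions into `SL(2, ℂ)`. -/
def IsHolomorphicImmersion (F : S → Matrix.SpecialLinearGroup (Fin 2) ℂ) : Prop :=
  (∀ i j, MDifferentiable 𝓘(ℂ) 𝓘(ℂ) (fun q => F q i j)) ∧
  ∀ p, ∀ v : TangentSpace 𝓘(ℂ) p, v ≠ 0 → matDiff F p v ≠ 0

/-- `F⁻¹ dF = [[g, -g²], [1, -g]] η`, an identity between meromorphic forms (that is, one that
holds away from the poles of `g`). -/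
def SolvesWeierstrass (g : S → OnePoint ℂ) (η : ∀ p : S, TangentSpace 𝓘(ℂ) p →L[ℂ] ℂ)
    (F : S → Matrix.SpecialLinearGroup (Fin 2) ℂ) : Prop :=
  ∀ p : S, ∀ c : ℂ, g p = (c : OnePoint ℂ) → ∀ v : TangentSpace 𝓘(ℂ) p,
    ((F p)⁻¹ : Matrix.SpecialLinearGroup (Fin 2) ℂ).1 * matDiff F p v
      = η p v • !![c, -c ^ 2; 1, -c]

/-- The map `f = F e₃ F^*`. -/
def faceOf (F : S → Matrix.SpecialLinearGroup (Fin 2) ℂ) (p : S) : L4 :=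
  hermEquiv.symm ⟨(F p).1 * e3 * (F p).1ᴴ, isHermitian_mul_e3_mul (F p).1⟩

/-- Weierstrass data: a meromorphic `g`, with `|g|` not identically `1`, and a holomorphic 1-form
`η` such that `(1 + |g|²)² |η|²` is a Riemannian metric. -/
def IsWeierstrassData (g : S → OnePoint ℂ) (η : ∀ p : S, TangentSpace 𝓘(ℂ) p →L[ℂ] ℂ) : Prop :=
  IsMeromorphicFunction g ∧ IsHolomorphicForm η ∧ HatMetricIsRiemannian g η ∧
    ¬ ∀ p, UnitModulus (g p)

end Surface

end DeSitter

end

open DeSitter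

/-! Part (a). The metric hypothesis forces, near every point, g = P/Q and ω = Q²θ dz with P, Q
holomorphic without common zero and θ holomorphic without zero (`exists_localForm`). At a pole of g
this is a removable singularity argument (`exists_factor_sq`). In these terms (*) reads F⁻¹F' = θ
(P,Q)ᵗ(Q,-P), a holomorphic traceless linear equation without poles. It has local solutions in
SL(2,ℂ), any two of which differ by a constant left factor, so over a simply connected surface they
glue to a global one (`exists_glued_function`, `existsUnique_solvesWeierstrass`).

The geometry of f = F e₃ F^* then reduces to algebra with the two vectors u = F(P,Q) and w =
F(Q̄,P̄), whose determinant is δ = |P|² - |Q|². One finds δ f = uu^* - ww^*, δ N = uu^* + ww^* and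
df = θ dz uw^* + its adjoint. The Lorentz product of such matrices is expressed by 2×2 determinants
(`lorentz_hermProd`), so ds² = δ²|θ dz|² and the singular points are the zeros of δ. The null vector
f + N is a multiple of uu^*, and the columns of dF are multiples of u; hence the formula for G.
Finally F' annihilates the direction (g,1), so that differentiating f + N only sees dg
(`secondForm_faceOf`). The part 2 Re(ω dg) of h is trace free, which gives H = 1. On |g| = 1 the
vector w is a multiple of u, and df is still nonzero there (`isAdmissible_faceOf`).

Part (b). On the dense set of regular points a conformal CMC 1 surface satisfies Δf = -2l(f + N),
where l is the conformal factor. The frame identities for Hermitian matrices eliminate l and N and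
turn this into Δf adj(f) + (f_x - i f_y) adj(f_x + i f_y) = 0 (`IsConformalFrame.herm_identity`).
This equation is polynomial in f and its derivatives, so by continuity it also holds at the singular
points (`isFaceEquation_of_isCMC1Face`). It says precisely that A = f_z f⁻¹ is holomorphic. If G' =
-GA, then G f G^* is constant, and F = G⁻¹K, with a constant K supplied by the transitivity of
SL(2,ℂ) on de Sitter space, is a holomorphic lift of f (`exists_local_lift`). Conformality gives det
A = 0, and df ≠ 0 gives A ≠ 0.

Two lifts differ by a holomorphic map into SU(1,1), whose entries are conjugate to one another in
pairs and hence constant; so local lifts glue (`exists_forall_isLiftAt`). For the global lift F⁻¹dF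
is holomorphic, nilpotent and nowhere zero: its lower left entry is ω, the ratio of the entries of
its first column is g, and its norm is the metric of the data. A constant change of F within SU(1,1)
excludes the case ω = 0 identically. -/

noncomputable section

namespace DeSitter

/-! ### Calculus on a Riemann surface in preferred coordinates -/

section LocalCoordinates

variable {S : Type*} [TopologicalSpace S] [ChartedSpace ℂ S]

/-- A Riemann surface is a smooth real surface. -/
lemma isManifold_real [IsManifold 𝓘(ℂ) ω S] (n : WithTop ℕ∞) : IsManifold 𝓘(ℝ, ℂ) n S := by
  have h : IsManifold 𝓘(ℝ, ℂ) ω S := by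
    refine isManifold_of_contDiffOn _ _ _ fun e e' he he' => ?_
    have h := (mem_groupoid_of_pregroupoid.1
      (HasGroupoid.compatible (G := contDiffGroupoid ω 𝓘(ℂ)) he he')).1
    exact ContDiffOn.restrict_scalars ℝ h
  exact IsManifold.of_le (n := ω) le_top

section Generic

variable {𝕜 : Type*} [NontriviallyNormedField 𝕜] [NormedSpace 𝕜 ℂ]
  {E : Type*} [NormedAddCommGroup E] [NormedSpace 𝕜 E]

lemma mdifferentiableAt_iff_chart [IsManifold 𝓘(𝕜, ℂ) 1 S] {f : S → E} {p q : S}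
    (hq : q ∈ (chartAt ℂ p).source) :
    MDifferentiableAt 𝓘(𝕜, ℂ) 𝓘(𝕜, E) f q ↔
      DifferentiableAt 𝕜 (f ∘ (chartAt ℂ p).symm) (chartAt ℂ p q) := by
  have h1 : MDifferentiableAt 𝓘(𝕜, ℂ) 𝓘(𝕜, ℂ) (chartAt ℂ p) q :=
    mdifferentiableAt_atlas (chart_mem_atlas ℂ p) hq
  have h2 : MDifferentiableAt 𝓘(𝕜, ℂ) 𝓘(𝕜, ℂ) (chartAt ℂ p).symm (chartAt ℂ p q) :=
    mdifferentiableAt_atlas_symm (chart_mem_atlas ℂ p) ((chartAt ℂ p).map_source hq)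
  constructor
  · intro h
    rw [← mdifferentiableAt_iff_differentiableAt]
    have h' : MDifferentiableAt 𝓘(𝕜, ℂ) 𝓘(𝕜, E) f ((chartAt ℂ p).symm (chartAt ℂ p q)) := by
      rwa [(chartAt ℂ p).left_inv hq]
    exact h'.comp _ h2
  · intro h
    rw [← mdifferentiableAt_iff_differentiableAt] at h
    refine (h.comp q h1).congr_of_eventuallyEq ?_
    filter_upwards [(chartAt ℂ p).open_source.mem_nhds hq] with y hy
    simp [(chartAt ℂ p).left_inv hy]

/-- The derivative of `f` at `p`, as a linear map on the coordinate plane: the tangent space at `p`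
is identified with the plane by the preferred coordinate at `p`. -/
def tderiv (𝕜 : Type*) [NontriviallyNormedField 𝕜] [NormedSpace 𝕜 ℂ]
    {E : Type*} [NormedAddCommGroup E] [NormedSpace 𝕜 E] (f : S → E) (p : S) : ℂ →L[𝕜] E :=
  mfderiv 𝓘(𝕜, ℂ) 𝓘(𝕜, E) f p

lemma tderiv_eq_comp [IsManifold 𝓘(𝕜, ℂ) 1 S] {f : S → E} {p q : S}
    (hq : q ∈ (chartAt ℂ p).source) (hf : MDifferentiableAt 𝓘(𝕜, ℂ) 𝓘(𝕜, E) f q) :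
    tderiv 𝕜 f q =
      (fderiv 𝕜 (f ∘ (chartAt ℂ p).symm) (chartAt ℂ p q)).comp (tderiv 𝕜 (chartAt ℂ p) q) := by
  have h1 : MDifferentiableAt 𝓘(𝕜, ℂ) 𝓘(𝕜, ℂ) (chartAt ℂ p) q :=
    mdifferentiableAt_atlas (chart_mem_atlas ℂ p) hq
  have h2 := (mdifferentiableAt_iff_chart hq).1 hf
  have h3 : f =ᶠ[𝓝 q] (f ∘ (chartAt ℂ p).symm) ∘ chartAt ℂ p := by
    filter_upwards [(chartAt ℂ p).open_source.mem_nhds hq] with y hy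
    simp [(chartAt ℂ p).left_inv hy]
  have h4 := (h2.hasFDerivAt.hasMFDerivAt.comp q h1.hasMFDerivAt).congr_of_eventuallyEq h3
  exact h4.mfderiv

/-- The tangent space at `p` is identified with the plane through the preferred chart at `p`, and
that chart written in itself is the identity. With this normalisation, derivatives at a point are
plain derivatives in the plane. -/
lemma tderiv_chart_self [IsManifold 𝓘(𝕜, ℂ) 1 S] (p : S) :
    tderiv 𝕜 (chartAt ℂ p) p = ContinuousLinearMap.id 𝕜 ℂ := by
  have h1 : MDifferentiableAt 𝓘(𝕜, ℂ) 𝓘(𝕜, ℂ) (chartAt ℂ p) p :=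
    mdifferentiableAt_atlas (chart_mem_atlas ℂ p) (mem_chart_source ℂ p)
  have h2 := h1.mfderiv
  have h4 : (writtenInExtChartAt 𝓘(𝕜, ℂ) 𝓘(𝕜, ℂ) p (chartAt ℂ p)) =ᶠ[𝓝 (chartAt ℂ p p)] id := by
    filter_upwards [(chartAt ℂ p).open_target.mem_nhds (mem_chart_target ℂ p)] with y hy
    simp only [writtenInExtChartAt, extChartAt_coe_symm, Function.comp_apply, id,
      extChartAt_model_space_eq_id, modelWithCornersSelf_coe_symm, PartialEquiv.refl_coe]
    exact (chartAt ℂ p).right_inv hy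
  have h5 : fderivWithin 𝕜 (writtenInExtChartAt 𝓘(𝕜, ℂ) 𝓘(𝕜, ℂ) p (chartAt ℂ p))
      (Set.range 𝓘(𝕜, ℂ)) (chartAt ℂ p p) = ContinuousLinearMap.id 𝕜 ℂ := by
    simp only [modelWithCornersSelf_coe, Set.range_id, fderivWithin_univ]
    rw [h4.fderiv_eq]
    exact fderiv_id
  exact h2.trans h5

end Generic

variable [IsManifold 𝓘(ℂ) ω S]

instance : IsManifold 𝓘(ℂ) 1 S := IsManifold.of_le (n := ω) le_top

instance : IsManifold 𝓘(ℝ, ℂ) 1 S := isManifold_real 1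

instance : IsManifold 𝓘(ℝ, ℂ) ∞ S := isManifold_real ∞

/-- The derivative at `q`, in the preferred coordinate at `q`, of the preferred coordinate at `p`. -/
def chartDeriv (p q : S) : ℂ := tderiv ℂ (chartAt ℂ p) q 1

lemma clm_apply_eq_mul (L : ℂ →L[ℂ] ℂ) (v : ℂ) : L v = L 1 * v := by
  have := L.map_smul v 1
  simp only [smul_eq_mul, mul_one] at this
  rw [this, mul_comm]

omit [IsManifold 𝓘(ℂ) ω S] in
lemma complexDiff_chart (p q : S) (v : ℂ) :
    complexDiff (chartAt ℂ p) q v = chartDeriv p q * v := clm_apply_eq_mul _ _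

lemma chartDeriv_self (p : S) : chartDeriv p p = 1 := by
  rw [chartDeriv, tderiv_chart_self]; rfl

/-- The real derivative of a holomorphic map is its complex derivative. -/
lemma tderiv_restrictScalars {E : Type*} [NormedAddCommGroup E] [NormedSpace ℂ E]
    {f : S → E} {p : S} (hf : MDifferentiableAt 𝓘(ℂ) 𝓘(ℂ, E) f p) :
    MDifferentiableAt 𝓘(ℝ, ℂ) 𝓘(ℝ, E) f p ∧ ∀ v : ℂ, tderiv ℝ f p v = tderiv ℂ f p v := by
  have hp := mem_chart_source ℂ p
  have h1 := (mdifferentiableAt_iff_chart hp).1 hf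
  have h2 : MDifferentiableAt 𝓘(ℝ, ℂ) 𝓘(ℝ, E) f p :=
    (mdifferentiableAt_iff_chart hp).2 (h1.restrictScalars ℝ)
  refine ⟨h2, fun v => ?_⟩
  rw [tderiv_eq_comp hp h2, tderiv_eq_comp hp hf, tderiv_chart_self, tderiv_chart_self,
    h1.fderiv_restrictScalars ℝ]
  rfl

lemma mdifferentiableAt_chart {p q : S} (hq : q ∈ (chartAt ℂ p).source) :
    MDifferentiableAt 𝓘(ℂ) 𝓘(ℂ) (chartAt ℂ p) q :=
  mdifferentiableAt_atlas (chart_mem_atlas ℂ p) hq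

lemma tderiv_real_chart {p q : S} (hq : q ∈ (chartAt ℂ p).source) (v : ℂ) :
    tderiv ℝ (chartAt ℂ p) q v = chartDeriv p q * v := by
  rw [(tderiv_restrictScalars (mdifferentiableAt_chart hq)).2]
  exact clm_apply_eq_mul _ _

/-- The chart at `q` has identity derivative at `q` and factors through the chart at `p`, whose
derivative therefore cannot vanish. -/
lemma chartDeriv_ne_zero {p q : S} (hq : q ∈ (chartAt ℂ p).source) : chartDeriv p q ≠ 0 := by
  intro h0
  have h1 : MDifferentiableAt 𝓘(ℂ) 𝓘(ℂ) (chartAt ℂ q) q :=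
    mdifferentiableAt_chart (mem_chart_source ℂ q)
  have h2 := congrArg (fun L : ℂ →L[ℂ] ℂ => L 1) (tderiv_eq_comp hq h1)
  simp only [tderiv_chart_self, ContinuousLinearMap.comp_apply] at h2
  rw [show tderiv ℂ (chartAt ℂ p) q 1 = chartDeriv p q from rfl, h0, map_zero] at h2
  simp at h2

lemma complexDiff_eq_deriv {h : S → ℂ} {p q : S} (hq : q ∈ (chartAt ℂ p).source)
    (hh : MDifferentiableAt 𝓘(ℂ) 𝓘(ℂ) h q) (v : ℂ) :
    complexDiff h q v = deriv (h ∘ (chartAt ℂ p).symm) (chartAt ℂ p q) * (chartDeriv p q * v) := by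
  have h2 := congrArg (fun L : ℂ →L[ℂ] ℂ => L v) (tderiv_eq_comp hq hh)
  refine h2.trans ?_
  rw [ContinuousLinearMap.comp_apply, clm_apply_eq_mul, fderiv_apply_one_eq_deriv]
  congr 1
  exact clm_apply_eq_mul _ _

lemma complexDiff_eq_deriv_self {h : S → ℂ} {p : S}
    (hh : MDifferentiableAt 𝓘(ℂ) 𝓘(ℂ) h p) (v : ℂ) :
    complexDiff h p v = deriv (h ∘ (chartAt ℂ p).symm) (chartAt ℂ p p) * v := by
  rw [complexDiff_eq_deriv (mem_chart_source ℂ p) hh, chartDeriv_self, one_mul]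

omit [IsManifold 𝓘(ℂ) ω S] in
lemma eventually_nhds_iff_chart {P : S → Prop} {p q : S} (hq : q ∈ (chartAt ℂ p).source) :
    (∀ᶠ x in 𝓝 q, P x) ↔ ∀ᶠ z in 𝓝 (chartAt ℂ p q), P ((chartAt ℂ p).symm z) := by
  have h : 𝓝 q = Filter.map (chartAt ℂ p).symm (𝓝 (chartAt ℂ p q)) := by
    exact ((chartAt ℂ p).symm_map_nhds_eq hq).symm
  rw [h, Filter.eventually_map]

/-- `h` is holomorphic near `p`. -/
def HolAt (h : S → ℂ) (p : S) : Prop := ∀ᶠ q in 𝓝 p, MDifferentiableAt 𝓘(ℂ) 𝓘(ℂ) h q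

lemma holAt_iff_analyticAt {h : S → ℂ} {p q : S} (hq : q ∈ (chartAt ℂ p).source) :
    HolAt h q ↔ AnalyticAt ℂ (h ∘ (chartAt ℂ p).symm) (chartAt ℂ p q) := by
  rw [HolAt, eventually_nhds_iff_chart hq, Complex.analyticAt_iff_eventually_differentiableAt]
  have h1 := (chartAt ℂ p).open_target.mem_nhds ((chartAt ℂ p).map_source hq)
  have key : ∀ z ∈ (chartAt ℂ p).target,
      (MDifferentiableAt 𝓘(ℂ) 𝓘(ℂ) h ((chartAt ℂ p).symm z) ↔
        DifferentiableAt ℂ (h ∘ (chartAt ℂ p).symm) z) := by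
    intro z hz
    rw [mdifferentiableAt_iff_chart ((chartAt ℂ p).map_target hz), (chartAt ℂ p).right_inv hz]
  constructor
  · intro h2
    filter_upwards [h1, h2] with z hz hz2 using (key z hz).1 hz2
  · intro h2
    filter_upwards [h1, h2] with z hz hz2 using (key z hz).2 hz2

omit [IsManifold 𝓘(ℂ) ω S] in
lemma HolAt.mdifferentiableAt {h : S → ℂ} {p : S} (hh : HolAt h p) :
    MDifferentiableAt 𝓘(ℂ) 𝓘(ℂ) h p := hh.self_of_nhds

omit [IsManifold 𝓘(ℂ) ω S] in
lemma HolAt.eventually {h : S → ℂ} {p : S} (hh : HolAt h p) : ∀ᶠ q in 𝓝 p, HolAt h q :=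
  eventually_eventually_nhds.2 hh

/-- A function which is holomorphic in the coordinate at `p` is holomorphic. -/
lemma holAt_comp_chart {k : ℂ → ℂ} {p q : S} (hq : q ∈ (chartAt ℂ p).source)
    (hk : AnalyticAt ℂ k (chartAt ℂ p q)) : HolAt (k ∘ chartAt ℂ p) q := by
  rw [holAt_iff_analyticAt hq]
  refine hk.congr ?_
  filter_upwards [(chartAt ℂ p).open_target.mem_nhds ((chartAt ℂ p).map_source hq)] with z hz
  simp [(chartAt ℂ p).right_inv hz]

lemma HolAt.contMDiffAt {h : S → ℂ} {p : S} (hh : HolAt h p) (n : WithTop ℕ∞) :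
    ContMDiffAt 𝓘(ℝ, ℂ) 𝓘(ℝ, ℂ) n h p := by
  have h1 := ((holAt_iff_analyticAt (mem_chart_source ℂ p)).1 hh)
  have h2 : ContDiffAt ℝ n (h ∘ (chartAt ℂ p).symm) (chartAt ℂ p p) :=
    (h1.contDiffAt (n := n)).restrict_scalars ℝ
  rw [contMDiffAt_iff]
  refine ⟨hh.mdifferentiableAt.continuousAt, ?_⟩
  exact h2.contDiffWithinAt

end LocalCoordinates

/-! ### Gluing over a simply connected space, and linear differential equations -/

/-- Local functions with values in a group that differ by locally constant left factors can be
glued, over a simply connected space, to a global function. -/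
theorem exists_glued_function {S : Type*} [TopologicalSpace S] [SimplyConnectedSpace S]
    [LocallyPathConnectedSpace S] {G : Type*} [Group G] (U : S → Set S) (hU : ∀ p, IsOpen (U p))
    (hmem : ∀ p, p ∈ U p) (φ : S → S → G)
    (hφ : ∀ p p' q, q ∈ U p → q ∈ U p' →
      ∀ᶠ x in 𝓝 q, φ p x * (φ p' x)⁻¹ = φ p q * (φ p' q)⁻¹) (w₀ : S) (g₀ : G) :
    ∃ F : S → G, F w₀ = g₀ ∧
      ∀ p q, q ∈ U p → ∀ᶠ x in 𝓝 q, F x * (φ p x)⁻¹ = F q * (φ p q)⁻¹ := by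
  let : TopologicalSpace G := ⊥
  have : DiscreteTopology G := ⟨rfl⟩
  let Z : FiberBundleCore S S G :=
    { baseSet := U
      isOpen_baseSet := hU
      indexAt := id
      mem_baseSet_at := hmem
      -- The fibre coordinate over `U i` stands for `F x * (φ i x)⁻¹`; passing to `U j` is therefore
      -- a right multiplication.
      coordChange := fun i j x c => c * (φ i x * (φ j x)⁻¹)
      coordChange_self := fun i x _ v => by simp
      continuousOn_coordChange := by
        rintro i j ⟨x, v⟩ ⟨⟨hi, hj⟩, -⟩
        refine ContinuousAt.continuousWithinAt ?_
        have h1 : (fun p : S × G => p.2 * (φ i p.1 * (φ j p.1)⁻¹)) =ᶠ[𝓝 (x, v)]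
            fun _ => v * (φ i x * (φ j x)⁻¹) := by
          rw [nhds_prod_eq, nhds_discrete G, Filter.prod_pure]
          exact (hφ i j x hi hj).mono fun y hy => congrArg (v * ·) hy
        exact continuousAt_const.congr h1.symm
      coordChange_comp := by
        intro i j k x _ v
        group }
  -- The fibre is discrete and the transitions are locally constant, so the bundle is a covering;
  -- simple connectedness of the base then lifts the identity to a section.
  have cov : IsCoveringMap (Bundle.TotalSpace.proj : Bundle.TotalSpace G Z.Fiber → S) :=
    FiberBundle.isCoveringMap (F := G) (E := Z.Fiber)
  obtain ⟨s, ⟨hs0, hs⟩, -⟩ := cov.existsUnique_continuousMap_lifts (ContinuousMap.id S) w₀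
    (⟨w₀, (g₀ * (φ w₀ w₀)⁻¹ : G)⟩ : Bundle.TotalSpace G Z.Fiber) rfl
  have hs1 : ∀ x, (s x).1 = x := fun x => congrFun hs x
  let snd : S → G := fun x => (s x).2
  refine ⟨fun x => snd x * φ x x, ?_, ?_⟩
  · have h0 : ∀ t : Bundle.TotalSpace G Z.Fiber,
        t = ⟨w₀, (g₀ * (φ w₀ w₀)⁻¹ : G)⟩ → (show G from t.2) * φ w₀ w₀ = g₀ := by
      rintro t rfl
      simp
    exact h0 _ hs0
  · intro p q hq
    have hc : ContinuousAt (fun x => (Z.localTriv p (s x)).2) q := by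
      have h1 : ContinuousAt (Z.localTriv p) (s q) := by
        apply (Z.localTriv p).continuousAt
        rw [(Z.localTriv p).mem_source]
        change (s q).1 ∈ U p
        rw [hs1]
        exact hq
      exact continuous_snd.continuousAt.comp (h1.comp s.continuous.continuousAt)
    have hval : ∀ x, (Z.localTriv p (s x)).2 = snd x * φ x x * (φ p x)⁻¹ := by
      intro x
      have h2 : (Z.localTriv p (s x)).2 = snd x * (φ (s x).1 (s x).1 * (φ p (s x).1)⁻¹) := rfl
      rw [h2, hs1, mul_assoc]
    have h3 := (hc.tendsto.eventually (show ∀ᶠ y in 𝓝 ((Z.localTriv p (s q)).2),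
      y = (Z.localTriv p (s q)).2 by rw [nhds_discrete]; exact Filter.eventually_pure.2 rfl))
    refine h3.mono fun x hx => ?_
    rw [hval, hval] at hx
    exact hx

/-- A linear differential equation `F' = F A` with holomorphic coefficients, in a Banach algebra,
has a local solution with initial value `1`. -/
theorem exists_local_solution {𝔸 : Type*} [NormedRing 𝔸] [NormedAlgebra ℂ 𝔸] [CompleteSpace 𝔸]
    [NormOneClass 𝔸]
    {A : ℂ → 𝔸} {z₀ : ℂ} (hA : AnalyticAt ℂ A z₀) :
    ∃ F : ℂ → 𝔸, F z₀ = 1 ∧ ∀ᶠ z in 𝓝 z₀, HasDerivAt F (F z * A z) z := by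
  obtain ⟨C, hC0, hC⟩ : ∃ C : ℝ, 0 < C ∧ ∀ᶠ z in 𝓝 z₀, ‖A z‖ ≤ C := by
    refine ⟨‖A z₀‖ + 1, by positivity, ?_⟩
    have := hA.continuousAt.norm.eventually (gt_mem_nhds (lt_add_one ‖A z₀‖))
    exact this.mono fun z hz => hz.le
  obtain ⟨r, hr0, hr⟩ := Metric.eventually_nhds_iff_ball.1
    ((Complex.analyticAt_iff_eventually_differentiableAt.1 hA).and hC)
  set R : ℝ := min r (1 / (2 * C)) with hR
  have hR0 : 0 < R := lt_min hr0 (by positivity)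
  have hRC : C * R ≤ 1 / 2 := by
    calc C * R ≤ C * (1 / (2 * C)) := by gcongr; exact min_le_right _ _
      _ = 1 / 2 := by field_simp
  set B := Metric.ball z₀ R with hB
  have hBr : ∀ z ∈ B, DifferentiableAt ℂ A z ∧ ‖A z‖ ≤ C := fun z hz =>
    hr z (Metric.ball_subset_ball (min_le_left _ _) hz)
  have step : ∀ Δ : ℂ → 𝔸, ∃ Δ' : ℂ → 𝔸, Δ' z₀ = 0 ∧
      (DifferentiableOn ℂ Δ B → ∀ z ∈ B, HasDerivAt Δ' (Δ z * A z) z) := by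
    intro Δ
    by_cases h : DifferentiableOn ℂ Δ B
    · have h1 : DifferentiableOn ℂ (fun z => Δ z * A z) B :=
        h.mul fun z hz => (hBr z hz).1.differentiableWithinAt
      obtain ⟨D, hD0, hD⟩ := h1.isExactOn_ball.with_val_at z₀ 0
      exact ⟨D, hD0, fun _ => hD⟩
    · exact ⟨0, rfl, fun h' => absurd h' h⟩
  choose T hT0 hT using step
  let Δ : ℕ → ℂ → 𝔸 := fun n => T^[n] (fun _ => 1)
  have hsucc : ∀ n, Δ (n + 1) = T (Δ n) := fun n => Function.iterate_succ_apply' _ _ _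
  have hdiff : ∀ n, DifferentiableOn ℂ (Δ n) B := by
    intro n
    induction n with
    | zero => exact differentiableOn_const _
    | succ n ih =>
      rw [hsucc]
      exact fun z hz => (hT _ ih z hz).differentiableAt.differentiableWithinAt
  have hder : ∀ n, ∀ z ∈ B, HasDerivAt (Δ (n + 1)) (Δ n z * A z) z := by
    intro n z hz
    rw [hsucc]
    exact hT _ (hdiff n) z hz
  have hzero : ∀ n, Δ (n + 1) z₀ = 0 := fun n => by rw [hsucc]; exact hT0 _
  have hz₀ : z₀ ∈ B := Metric.mem_ball_self hR0
  -- Since `C * R ≤ 1 / 2`, each integration halves the bound. The iterates and their derivatives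
  -- are thus dominated by geometric series, and the sum can be differentiated termwise.
  have hbound : ∀ n, ∀ z ∈ B, ‖Δ n z‖ ≤ (1 / 2) ^ n := by
    intro n
    induction n with
    | zero => intro z _; simp [Δ]
    | succ n ih =>
      intro z hz
      have h1 : ∀ w ∈ B, ‖Δ n w * A w‖ ≤ (1 / 2) ^ n * C := fun w hw =>
        (norm_mul_le _ _).trans (mul_le_mul (ih w hw) (hBr w hw).2 (norm_nonneg _) (by positivity))
      have h2 := (convex_ball z₀ R).norm_image_sub_le_of_norm_hasDerivWithin_le
        (fun w hw => (hder n w hw).hasDerivWithinAt) h1 hz₀ hz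
      rw [hzero, sub_zero] at h2
      have h3 : ‖z - z₀‖ ≤ R := by
        rw [← dist_eq_norm]
        exact (Metric.mem_ball.1 hz).le
      calc ‖Δ (n + 1) z‖ ≤ (1 / 2) ^ n * C * ‖z - z₀‖ := h2
        _ ≤ (1 / 2) ^ n * C * R := by gcongr
        _ = (1 / 2) ^ n * (C * R) := by ring
        _ ≤ (1 / 2) ^ n * (1 / 2) := by gcongr
        _ = (1 / 2) ^ (n + 1) := by ring
  have hgeom : Summable fun n : ℕ => (1 / 2 : ℝ) ^ n := summable_geometric_two
  have hsum : ∀ z ∈ B, Summable fun n => Δ n z := fun z hz =>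
    Summable.of_norm_bounded hgeom fun n => hbound n z hz
  refine ⟨fun z => 1 + ∑' n, Δ (n + 1) z, by simp [hzero], ?_⟩
  filter_upwards [Metric.ball_mem_nhds z₀ hR0] with z hz
  have h1 := hasDerivAt_tsum_of_isPreconnected (𝕜 := ℂ) (g := fun n => Δ (n + 1))
    (g' := fun n z => Δ n z * A z)
    (u := fun n => (1 / 2 : ℝ) ^ n * C) (t := B) (y₀ := z₀) (hgeom.mul_right C) Metric.isOpen_ball
    (convex_ball _ _).isPreconnected (fun n y hy => hder n y hy)
    (fun n y hy => (norm_mul_le _ _).trans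
      (mul_le_mul (hbound n y hy) (hBr y hy).2 (norm_nonneg _) (by positivity)))
    hz₀ (by simp [hzero, summable_zero]) hz
  have h2 : 1 + ∑' n, Δ (n + 1) z = ∑' n, Δ n z := by
    rw [(hsum z hz).tsum_eq_zero_add]
    rfl
  have h3 := h1.const_add 1
  rw [(hsum z hz).tsum_mul_right] at h3
  rw [h2]
  exact h3

lemma eventually_eq_of_fderiv_zero {𝕜 : Type*} [RCLike 𝕜] {E F : Type*} [NormedAddCommGroup E]
    [NormedSpace 𝕜 E] [NormedSpace ℝ E] [NormedAddCommGroup F] [NormedSpace 𝕜 F] {f : E → F} {x : E}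
    (h : ∀ᶠ y in 𝓝 x, HasFDerivAt f (0 : E →L[𝕜] F) y) : ∀ᶠ y in 𝓝 x, f y = f x := by
  obtain ⟨r, hr0, hr⟩ := Metric.eventually_nhds_iff_ball.1 h
  filter_upwards [Metric.ball_mem_nhds x hr0] with y hy
  exact Metric.isOpen_ball.is_const_of_fderiv_eq_zero (𝕜 := 𝕜) (convex_ball x r).isPreconnected
    (fun z hz => (hr z hz).differentiableAt.differentiableWithinAt)
    (fun z hz => (hr z hz).fderiv) hy (Metric.mem_ball_self hr0)

lemma eventually_eq_of_hasDerivAt_zero {f : ℂ → ℂ} {x : ℂ}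
    (h : ∀ᶠ y in 𝓝 x, HasDerivAt f 0 y) : ∀ᶠ y in 𝓝 x, f y = f x := by
  refine eventually_eq_of_fderiv_zero (𝕜 := ℂ) (h.mono fun y hy => ?_)
  have := hy.hasFDerivAt
  simpa using this

section MatrixODE

open scoped Matrix.Norms.Operator

/-- A linear differential equation `F' = F A` for `2 × 2` matrices with holomorphic traceless
coefficients has a local solution with initial value `1` and determinant `1`. -/
lemma exists_local_matrix_solution {A : Fin 2 → Fin 2 → ℂ → ℂ} {z₀ : ℂ}
    (hA : ∀ i j, AnalyticAt ℂ (A i j) z₀) (htr : ∀ᶠ z in 𝓝 z₀, A 0 0 z + A 1 1 z = 0) :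
    ∃ F : ℂ → Matrix (Fin 2) (Fin 2) ℂ, F z₀ = 1 ∧ ∀ᶠ z in 𝓝 z₀, (F z).det = 1 ∧
      ∀ i j, HasDerivAt (fun z => F z i j) ((F z * Matrix.of fun i j => A i j z) i j) z := by
  have h1 : AnalyticAt ℂ (fun z => (Matrix.of fun i j => A i j z : Matrix (Fin 2) (Fin 2) ℂ)) z₀ := by
    have h2 : (fun z => (Matrix.of fun i j => A i j z : Matrix (Fin 2) (Fin 2) ℂ)) =
        fun z => ∑ i, ∑ j, A i j z • Matrix.single i j (1 : ℂ) := by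
      funext z
      conv_lhs => rw [Matrix.matrix_eq_sum_single (Matrix.of fun i j => A i j z)]
      simp [Matrix.smul_single]
    rw [h2]
    exact Finset.analyticAt_fun_sum _ fun i _ => Finset.analyticAt_fun_sum _ fun j _ =>
      (hA i j).smul analyticAt_const
  obtain ⟨F, hF0, hF⟩ := exists_local_solution h1
  have hent : ∀ᶠ z in 𝓝 z₀, ∀ i j,
      HasDerivAt (fun z => F z i j) ((F z * Matrix.of fun i j => A i j z) i j) z := by
    refine hF.mono fun z hz i j => ?_
    exact ((LinearMap.toContinuousLinearMap
      (Matrix.entryLinearMap ℂ ℂ i j)).hasFDerivAt.comp_hasDerivAt z hz)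
  -- Liouville's formula: the derivative of the determinant is the determinant times the trace of
  -- `A`.
  have hdet : ∀ᶠ z in 𝓝 z₀, HasDerivAt (fun z => (F z).det) 0 z := by
    filter_upwards [hent, htr] with z hz ht
    have h3 := ((hz 0 0).mul (hz 1 1)).sub ((hz 0 1).mul (hz 1 0))
    have h4 : (fun z => (F z).det) = ((fun z => F z 0 0) * (fun z => F z 1 1) -
        (fun z => F z 0 1) * fun z => F z 1 0) := funext fun z => Matrix.det_fin_two (F z)
    have h5 : (F z * Matrix.of fun i j => A i j z) 0 0 * F z 1 1 +
        F z 0 0 * (F z * Matrix.of fun i j => A i j z) 1 1 -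
        ((F z * Matrix.of fun i j => A i j z) 0 1 * F z 1 0 +
          F z 0 1 * (F z * Matrix.of fun i j => A i j z) 1 0) = 0 := by
      simp only [Matrix.mul_apply, Fin.sum_univ_two, Matrix.of_apply]
      linear_combination (F z 0 0 * F z 1 1 - F z 0 1 * F z 1 0) * ht
    rw [h5] at h3
    rw [h4]
    exact h3
  refine ⟨F, hF0, (hent.and (eventually_eq_of_hasDerivAt_zero hdet)).mono fun z hz => ⟨?_, hz.1⟩⟩
  rw [hz.2, hF0, Matrix.det_one]

end MatrixODE

/-! ### Holomorphic maps into SL(2,ℂ) -/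

section SpecialLinear

variable {S : Type*} [TopologicalSpace S] [ChartedSpace ℂ S] [IsManifold 𝓘(ℂ) ω S]

/-- A matrix-valued function given by a holomorphic function of determinant one of the local
coordinate, as a function on the surface. -/
def ofChart (p : S) (F : ℂ → Matrix (Fin 2) (Fin 2) ℂ) (q : S) :
    Matrix.SpecialLinearGroup (Fin 2) ℂ :=
  -- The determinant is known to be 1 only near the point of interest; elsewhere the value 1 is a
  -- default.
  if h : (F (chartAt ℂ p q)).det = 1 then ⟨F (chartAt ℂ p q), h⟩ else 1

omit [IsManifold 𝓘(ℂ) ω S] in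
lemma ofChart_val {p q : S} {F : ℂ → Matrix (Fin 2) (Fin 2) ℂ}
    (h : (F (chartAt ℂ p q)).det = 1) : (ofChart p F q).1 = F (chartAt ℂ p q) :=
  congrArg Subtype.val (dif_pos h)

/-- The entries of `F` are holomorphic near `p`. -/
def MatHolAt (F : S → Matrix.SpecialLinearGroup (Fin 2) ℂ) (p : S) : Prop :=
  ∀ i j, HolAt (fun q => F q i j) p

lemma matHolAt_ofChart {p q : S} (hq : q ∈ (chartAt ℂ p).source)
    {F : ℂ → Matrix (Fin 2) (Fin 2) ℂ}
    (h : ∀ᶠ z in 𝓝 (chartAt ℂ p q), (F z).det = 1 ∧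
      ∀ i j, DifferentiableAt ℂ (fun z => F z i j) z) :
    MatHolAt (ofChart p F) q := by
  intro i j
  have h1 : AnalyticAt ℂ (fun z => F z i j) (chartAt ℂ p q) :=
    Complex.analyticAt_iff_eventually_differentiableAt.2 (h.mono fun z hz => hz.2 i j)
  rw [holAt_iff_analyticAt hq]
  refine h1.congr ?_
  filter_upwards [h, (chartAt ℂ p).open_target.mem_nhds ((chartAt ℂ p).map_source hq)] with z hz hz'
  simp only [Function.comp_apply]
  rw [ofChart_val (by rw [(chartAt ℂ p).right_inv hz']; exact hz.1), (chartAt ℂ p).right_inv hz']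

/-- The derivative of a matrix-valued function with respect to the preferred coordinate at `p`. -/
def coordDeriv (F : S → Matrix.SpecialLinearGroup (Fin 2) ℂ) (p : S) (z : ℂ) :
    Matrix (Fin 2) (Fin 2) ℂ :=
  Matrix.of fun i j => deriv ((fun q => F q i j) ∘ (chartAt ℂ p).symm) z

lemma matDiff_eq {F : S → Matrix.SpecialLinearGroup (Fin 2) ℂ} {p q : S}
    (hq : q ∈ (chartAt ℂ p).source) (hF : MatHolAt F q) (v : ℂ) :
    matDiff F q v = (chartDeriv p q * v) • coordDeriv F p (chartAt ℂ p q) := by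
  ext i j
  simp only [matDiff, coordDeriv, Matrix.of_apply, Matrix.smul_apply, smul_eq_mul]
  rw [complexDiff_eq_deriv hq (hF i j).mdifferentiableAt, mul_comm]

omit [IsManifold 𝓘(ℂ) ω S] in
lemma coordDeriv_ofChart {p q : S} (hq : q ∈ (chartAt ℂ p).source)
    {F : ℂ → Matrix (Fin 2) (Fin 2) ℂ} {D : Matrix (Fin 2) (Fin 2) ℂ}
    (h : ∀ᶠ z in 𝓝 (chartAt ℂ p q), (F z).det = 1)
    (hD : ∀ i j, HasDerivAt (fun z => F z i j) (D i j) (chartAt ℂ p q)) :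
    coordDeriv (ofChart p F) p (chartAt ℂ p q) = D := by
  ext i j
  simp only [coordDeriv, Matrix.of_apply]
  have h1 : ((fun q => (ofChart p F q) i j) ∘ (chartAt ℂ p).symm) =ᶠ[𝓝 (chartAt ℂ p q)]
      fun z => F z i j := by
    filter_upwards [h, (chartAt ℂ p).open_target.mem_nhds ((chartAt ℂ p).map_source hq)] with z hz hz'
    simp only [Function.comp_apply]
    rw [ofChart_val (by rw [(chartAt ℂ p).right_inv hz']; exact hz), (chartAt ℂ p).right_inv hz']
  rw [h1.deriv_eq, (hD i j).deriv]

lemma hasDerivAt_coordDeriv {F : S → Matrix.SpecialLinearGroup (Fin 2) ℂ} {p q : S}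
    (hq : q ∈ (chartAt ℂ p).source) (hF : MatHolAt F q) (i j : Fin 2) :
    HasDerivAt (fun z => F ((chartAt ℂ p).symm z) i j) (coordDeriv F p (chartAt ℂ p q) i j)
      (chartAt ℂ p q) :=
  ((holAt_iff_analyticAt hq).1 (hF i j)).differentiableAt.hasDerivAt

/-- The determinant of `F` being constant, `F⁻¹ dF` is traceless. -/
lemma trace_coordDeriv {F : S → Matrix.SpecialLinearGroup (Fin 2) ℂ} {p q : S}
    (hq : q ∈ (chartAt ℂ p).source) (hF : MatHolAt F q) :
    F q 1 1 * coordDeriv F p (chartAt ℂ p q) 0 0 + F q 0 0 * coordDeriv F p (chartAt ℂ p q) 1 1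
      - F q 1 0 * coordDeriv F p (chartAt ℂ p q) 0 1
      - F q 0 1 * coordDeriv F p (chartAt ℂ p q) 1 0 = 0 := by
  have h := hasDerivAt_coordDeriv hq hF
  have h1 := ((h 0 0).mul (h 1 1)).sub ((h 0 1).mul (h 1 0))
  have h2 : ((fun z => F ((chartAt ℂ p).symm z) 0 0) * (fun z => F ((chartAt ℂ p).symm z) 1 1) -
      (fun z => F ((chartAt ℂ p).symm z) 0 1) * fun z => F ((chartAt ℂ p).symm z) 1 0) =
      fun _ => (1 : ℂ) := by
    funext z
    have := (F ((chartAt ℂ p).symm z)).det_coe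
    rw [Matrix.det_fin_two] at this
    exact this
  rw [h2] at h1
  have h3 := h1.unique (hasDerivAt_const _ _)
  rw [(chartAt ℂ p).left_inv hq] at h3
  linear_combination h3

end SpecialLinear

/-! ### Local normal form of Weierstrass data -/

/-- If `|α|² (1 + |h|²)² / |h|⁴` extends continuously and positively to `z₀`, then `α` is `h²`
times a nonvanishing holomorphic function. -/
lemma exists_factor_sq {α h : ℂ → ℂ} {z₀ : ℂ} (hα : AnalyticAt ℂ α z₀) (hh : AnalyticAt ℂ h z₀)
    (hne : ∀ᶠ z in 𝓝[≠] z₀, h z ≠ 0) {e : ℂ → ℝ} (he : ContinuousAt e z₀) (he0 : 0 < e z₀)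
    (heq : ∀ᶠ z in 𝓝[≠] z₀, ‖α z‖ ^ 2 * (1 + ‖h z‖ ^ 2) ^ 2 = e z * ‖h z‖ ^ 4) :
    ∃ θ : ℂ → ℂ, AnalyticAt ℂ θ z₀ ∧ θ z₀ ≠ 0 ∧ ∀ᶠ z in 𝓝 z₀, α z = h z ^ 2 * θ z := by
  have hb : ∀ᶠ z in 𝓝 z₀, e z < e z₀ + 1 := he.eventually (gt_mem_nhds (lt_add_one _))
  have hquot : ∀ᶠ z in 𝓝[≠] z₀, ‖α z / h z ^ 2‖ ^ 2 * (1 + ‖h z‖ ^ 2) ^ 2 = e z := by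
    filter_upwards [hne, heq] with z h1 h2
    have h3 : 0 < ‖h z‖ := norm_pos_iff.2 h1
    rw [norm_div, norm_pow, div_pow, div_mul_eq_mul_div, h2]
    field_simp
  obtain ⟨r, hr0, hr⟩ := Metric.eventually_nhds_iff_ball.1
    ((((hα.eventually_analyticAt.and hh.eventually_analyticAt).and hb).and
      (eventually_nhdsWithin_iff.1 (hne.and hquot))))
  set s := Metric.ball z₀ r
  have hs : s ∈ 𝓝 z₀ := Metric.ball_mem_nhds z₀ hr0
  have hd : DifferentiableOn ℂ (fun z => α z / h z ^ 2) (s \ {z₀}) := by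
    rintro z ⟨hz, hz'⟩
    have h1 := hr z hz
    exact (h1.1.1.1.differentiableAt.div (h1.1.1.2.differentiableAt.pow 2)
      (pow_ne_zero 2 (h1.2 hz').1)).differentiableWithinAt
  -- The norm of `α / h ^ 2` is controlled by the bounded function `e`, so the singularity is
  -- removable. Continuity of `e` carries the identity to the centre, where `e > 0` keeps the
  -- extension from vanishing.
  have hbdd : BddAbove (norm ∘ (fun z => α z / h z ^ 2) '' (s \ {z₀})) := by
    refine ⟨e z₀ + 2, ?_⟩
    rintro _ ⟨z, ⟨hz, hz'⟩, rfl⟩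
    have h1 := hr z hz
    have h2 := (h1.2 hz').2
    have h3 : ‖α z / h z ^ 2‖ ^ 2 ≤ ‖α z / h z ^ 2‖ ^ 2 * (1 + ‖h z‖ ^ 2) ^ 2 :=
      le_mul_of_one_le_right (by positivity) (one_le_pow₀ (by nlinarith [sq_nonneg ‖h z‖]))
    simp only [Function.comp_apply]
    nlinarith [h1.1.2, sq_nonneg (‖α z / h z ^ 2‖ - 1)]
  have hθ := Complex.differentiableOn_update_limUnder_of_bddAbove hs hd hbdd
  set θ := Function.update (fun z => α z / h z ^ 2) z₀
    ((𝓝[≠] z₀).limUnder fun z => α z / h z ^ 2) with hθdef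
  have hθa : AnalyticAt ℂ θ z₀ := hθ.analyticAt hs
  have hθv : ∀ z, z ≠ z₀ → θ z = α z / h z ^ 2 := fun z hz => by
    rw [hθdef, Function.update_of_ne hz]
  have h1 : ∀ᶠ z in 𝓝[≠] z₀, ‖θ z‖ ^ 2 * (1 + ‖h z‖ ^ 2) ^ 2 = e z := by
    filter_upwards [hquot, self_mem_nhdsWithin] with z hz hz'
    rw [hθv z hz', hz]
  have h2 : ‖θ z₀‖ ^ 2 * (1 + ‖h z₀‖ ^ 2) ^ 2 = e z₀ := by
    have hc1 : Filter.Tendsto (fun z => ‖θ z‖ ^ 2 * (1 + ‖h z‖ ^ 2) ^ 2) (𝓝[≠] z₀)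
        (𝓝 (‖θ z₀‖ ^ 2 * (1 + ‖h z₀‖ ^ 2) ^ 2)) := by
      have := ((hθa.continuousAt.norm.pow 2).mul
        (((continuousAt_const (y := (1 : ℝ))).add (hh.continuousAt.norm.pow 2)).pow 2)).tendsto
      exact this.mono_left nhdsWithin_le_nhds
    exact tendsto_nhds_unique (hc1.congr' h1) (he.tendsto.mono_left nhdsWithin_le_nhds)
  refine ⟨θ, hθa, ?_, ?_⟩
  · intro h0
    rw [h0] at h2
    simp at h2
    exact he0.ne h2
  · have h3 : ∀ᶠ z in 𝓝[≠] z₀, α z = h z ^ 2 * θ z := by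
      filter_upwards [hne, self_mem_nhdsWithin] with z hz hz'
      rw [hθv z hz']
      field_simp
    exact (hα.frequently_eq_iff_eventually_eq ((hh.pow 2).mul hθa)).1 h3.frequently

section NormalForm

variable {S : Type*} [TopologicalSpace S] [ChartedSpace ℂ S] [IsManifold 𝓘(ℂ) ω S]

/-- The functions `P, Q, θ` of the local coordinate `z` at `p` present the data near `p`:
`g = P / Q` and `η = Q² θ dz`. -/
structure IsLocalForm (g : S → OnePoint ℂ) (η : ∀ p : S, TangentSpace 𝓘(ℂ) p →L[ℂ] ℂ) (p : S)
    (P Q θ : ℂ → ℂ) : Prop where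
  analytic_P : AnalyticAt ℂ P (chartAt ℂ p p)
  analytic_Q : AnalyticAt ℂ Q (chartAt ℂ p p)
  analytic_θ : AnalyticAt ℂ θ (chartAt ℂ p p)
  Q_ne : ∀ᶠ z in 𝓝[≠] (chartAt ℂ p p), Q z ≠ 0
  eventually : ∀ᶠ q in 𝓝 p, θ (chartAt ℂ p q) ≠ 0 ∧
    (P (chartAt ℂ p q) ≠ 0 ∨ Q (chartAt ℂ p q) ≠ 0) ∧
    g q = ratio (P (chartAt ℂ p q)) (Q (chartAt ℂ p q)) ∧
    ∀ v : ℂ, η q v =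
      Q (chartAt ℂ p q) ^ 2 * θ (chartAt ℂ p q) * (chartDeriv p q * v)

omit [IsManifold 𝓘(ℂ) ω S] in
lemma eventually_mem_source (p : S) : ∀ᶠ q in 𝓝 p, q ∈ (chartAt ℂ p).source :=
  (chartAt ℂ p).open_source.mem_nhds (mem_chart_source ℂ p)

omit [IsManifold 𝓘(ℂ) ω S] in
lemma eventually_chart {P : ℂ → Prop} {p : S} (h : ∀ᶠ z in 𝓝 (chartAt ℂ p p), P z) :
    ∀ᶠ q in 𝓝 p, P (chartAt ℂ p q) :=
  ((chartAt ℂ p).continuousAt (mem_chart_source ℂ p)).eventually h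

omit [IsManifold 𝓘(ℂ) ω S] in
lemma eventually_chart_symm {P : S → Prop} {p : S} (h : ∀ᶠ q in 𝓝 p, P q) :
    ∀ᶠ z in 𝓝 (chartAt ℂ p p), P ((chartAt ℂ p).symm z) :=
  (eventually_nhds_iff_chart (mem_chart_source ℂ p)).1 h

omit [IsManifold 𝓘(ℂ) ω S] in
lemma eventually_mem_target (p : S) : ∀ᶠ z in 𝓝 (chartAt ℂ p p), z ∈ (chartAt ℂ p).target :=
  (chartAt ℂ p).open_target.mem_nhds (mem_chart_target ℂ p)

omit [IsManifold 𝓘(ℂ) ω S] in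
/-- A holomorphic form, in the coordinate at `p`. -/
lemma IsHolomorphicForm.exists_coeff {η : ∀ p : S, TangentSpace 𝓘(ℂ) p →L[ℂ] ℂ}
    (hη : IsHolomorphicForm η) (p : S) : ∃ a : S → ℂ, HolAt a p ∧
      ∀ᶠ q in 𝓝 p, ∀ v : ℂ, η q v = a q * (chartDeriv p q * v) := by
  obtain ⟨a, ha, h⟩ := hη p
  refine ⟨a, ha, h.mono fun q hq v => ?_⟩
  rw [← complexDiff_chart]
  exact hq v

/-- Evaluating the metric on the tangent vector whose `z`-coordinate is 1 isolates its first
coefficient `E`. The continuity of `E` across a pole is what the normal form needs. -/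
lemma HatMetricIsRiemannian.exists_coord {g : S → OnePoint ℂ}
    {η : ∀ p : S, TangentSpace 𝓘(ℂ) p →L[ℂ] ℂ} (h : HatMetricIsRiemannian g η) :
    ∃ ρ : S → ℂ → ℂ → ℝ, (∀ q v, v ≠ 0 → 0 < ρ q v v) ∧
      (∀ p, ∃ E : S → ℝ, ContinuousAt E p ∧ ∀ᶠ q in 𝓝 p, ρ q (chartDeriv p q)⁻¹ (chartDeriv p q)⁻¹
        = E q) ∧
      ∀ q (c : ℂ), g q = (c : OnePoint ℂ) → ∀ v w : ℂ,
        ρ q v w = (1 + ‖c‖ ^ 2) ^ 2 * ((η q v : ℂ) * conj (η q w : ℂ)).re := by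
  obtain ⟨ρ, ⟨hρpos, hρloc⟩, hρη⟩ := h
  refine ⟨ρ, fun q v hv => hρpos q trivial v hv, fun p => ?_, hρη⟩
  obtain ⟨E, F, G, hE, -, -, hEFG⟩ := hρloc p trivial
  refine ⟨E, hE.continuousAt, ?_⟩
  filter_upwards [hEFG, eventually_mem_source p] with q h1 h2
  have h3 := h1 ((chartDeriv p q)⁻¹ : ℂ) ((chartDeriv p q)⁻¹ : ℂ)
  have h4 : tderiv ℝ (chartAt ℂ p) q (chartDeriv p q)⁻¹ = 1 := by
    rw [tderiv_real_chart h2, mul_inv_cancel₀ (chartDeriv_ne_zero h2)]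
  change ρ q _ _ = E q * ((tderiv ℝ (chartAt ℂ p) q (chartDeriv p q)⁻¹).re *
    (tderiv ℝ (chartAt ℂ p) q (chartDeriv p q)⁻¹).re) + F q *
    ((tderiv ℝ (chartAt ℂ p) q (chartDeriv p q)⁻¹).re *
    (tderiv ℝ (chartAt ℂ p) q (chartDeriv p q)⁻¹).im +
    (tderiv ℝ (chartAt ℂ p) q (chartDeriv p q)⁻¹).im *
    (tderiv ℝ (chartAt ℂ p) q (chartDeriv p q)⁻¹).re) + G q *
    ((tderiv ℝ (chartAt ℂ p) q (chartDeriv p q)⁻¹).im *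
    (tderiv ℝ (chartAt ℂ p) q (chartDeriv p q)⁻¹).im) at h3
  rw [h4] at h3
  refine h3.trans ?_
  simp

lemma exists_localForm {g : S → OnePoint ℂ} {η : ∀ p : S, TangentSpace 𝓘(ℂ) p →L[ℂ] ℂ}
    (hg : IsMeromorphicFunction g) (hη : IsHolomorphicForm η) (hρ : HatMetricIsRiemannian g η)
    (p : S) : ∃ P Q θ : ℂ → ℂ, IsLocalForm g η p P Q θ := by
  have hp := mem_chart_source ℂ p
  obtain ⟨a, ha, haη⟩ := hη.exists_coeff p
  have haan := (holAt_iff_analyticAt hp).1 ha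
  obtain ⟨ρ, hρpos, hρloc, hρη⟩ := hρ.exists_coord
  have hpos : ∀ q (c : ℂ), g q = (c : OnePoint ℂ) → (η q (1 : ℂ) : ℂ) ≠ 0 := by
    intro q c hc h0
    have h1 := hρpos q 1 one_ne_zero
    rw [hρη q c hc, h0] at h1
    simp at h1
  obtain ⟨h, hh, hcase | ⟨hfreq, hcase⟩⟩ := hg p
  · have hhan := (holAt_iff_analyticAt hp).1 hh
    refine ⟨h ∘ (chartAt ℂ p).symm, fun _ => 1, a ∘ (chartAt ℂ p).symm, hhan, analyticAt_const,
      haan, by simp, ?_⟩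
    filter_upwards [hcase, haη, eventually_mem_source p] with q h1 h2 h3
    simp only [Function.comp_apply, (chartAt ℂ p).left_inv h3, one_pow, one_mul]
    refine ⟨fun h0 => hpos q _ h1 ?_, Or.inr one_ne_zero, ?_, h2⟩
    · rw [h2, h0, zero_mul]
    · simp [h1, ratio]
  · have hhan := (holAt_iff_analyticAt hp).1 hh
    set k := h ∘ (chartAt ℂ p).symm with hk
    set α := a ∘ (chartAt ℂ p).symm with hα
    have hkne : ∀ᶠ z in 𝓝[≠] (chartAt ℂ p p), k z ≠ 0 := by
      rcases hhan.eventually_eq_zero_or_eventually_ne_zero with h0 | h0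
      · refine absurd ((eventually_nhds_iff_chart (P := fun q => h q = 0) hp).2 h0) fun h1 => ?_
        exact hfreq (h1.mono fun q hq => not_not.2 hq)
      · exact h0
    obtain ⟨E, hE, hρE⟩ := hρloc p
    have hE0 : 0 < E p := by
      rw [← hρE.self_of_nhds]
      exact hρpos p _ (inv_ne_zero (chartDeriv_ne_zero hp))
    have heq : ∀ᶠ q in 𝓝 p, h q ≠ 0 →
        ‖a q‖ ^ 2 * (1 + ‖h q‖ ^ 2) ^ 2 = E q * ‖h q‖ ^ 4 := by
      filter_upwards [hρE, haη, hcase, eventually_mem_source p] with q h1 h2 h3 hq h4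
      have h5 : g q = ((1 / h q : ℂ) : OnePoint ℂ) := by rw [h3, ratio, if_neg h4]
      rw [← h1, hρη q _ h5, h2, mul_inv_cancel₀ (chartDeriv_ne_zero hq), mul_one, Complex.mul_conj, Complex.normSq_eq_norm_sq]
      have h9 : ‖h q‖ ≠ 0 := norm_ne_zero_iff.2 h4
      rw [Complex.ofReal_re, norm_div, norm_one]
      field_simp
      ring
    obtain ⟨θ, hθ, hθ0, hθα⟩ := exists_factor_sq (e := E ∘ (chartAt ℂ p).symm) haan hhan hkne
      (by
        have h1 : ContinuousAt E ((chartAt ℂ p).symm (chartAt ℂ p p)) := by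
          rw [(chartAt ℂ p).left_inv hp]
          exact hE
        exact h1.comp ((chartAt ℂ p).continuousAt_symm (mem_chart_target ℂ p)))
      (by simpa [(chartAt ℂ p).left_inv hp] using hE0)
      (by
        filter_upwards [hkne, nhdsWithin_le_nhds (eventually_chart_symm heq)] with z h1 h2
        exact h2 h1)
    refine ⟨fun _ => 1, k, θ, analyticAt_const, hhan, hθ, hkne, ?_⟩
    filter_upwards [hcase, haη, eventually_mem_source p, eventually_chart hθα,
      eventually_chart (hθ.continuousAt.eventually_ne hθ0)] with q h1 h2 h3 h4 h5
    refine ⟨h5, Or.inl one_ne_zero, ?_, ?_⟩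
    · rw [h1, hk]
      simp [(chartAt ℂ p).left_inv h3]
    · intro v
      rw [h2, ← h4, hα]
      simp [(chartAt ℂ p).left_inv h3]

end NormalForm

/-! ### The Weierstrass equation: existence and uniqueness -/

/-- The nilpotent matrix with null direction `(P, Q)`. -/
def nilMatrix (P Q : ℂ) : Matrix (Fin 2) (Fin 2) ℂ := !![P * Q, -P ^ 2; Q ^ 2, -(P * Q)]

lemma ratio_eq_coe {P Q c : ℂ} (h : ratio P Q = (c : OnePoint ℂ)) : Q ≠ 0 ∧ P = c * Q := by
  unfold ratio at h
  split_ifs at h with h0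
  · exact absurd h (OnePoint.infty_ne_coe c)
  · have h1 := OnePoint.coe_injective h
    exact ⟨h0, by rw [← h1]; field_simp⟩

/-- Substituting `P = c * Q` pulls `Q ^ 2` out of the homogeneous matrix. The left side remains
holomorphic where `Q` vanishes, that is, at the poles of `g`. -/
lemma smul_nilMatrix_eq {P Q c θ : ℂ} (h : ratio P Q = (c : OnePoint ℂ)) :
    θ • nilMatrix P Q = (Q ^ 2 * θ) • !![c, -c ^ 2; 1, -c] := by
  obtain ⟨-, rfl⟩ := ratio_eq_coe h
  ext i j
  fin_cases i <;> fin_cases j <;> simp [nilMatrix] <;> ring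

lemma nilMatrix_ne_zero {P Q : ℂ} (h : P ≠ 0 ∨ Q ≠ 0) : nilMatrix P Q ≠ 0 := by
  intro h0
  have h1 := congrFun (congrFun h0 0) 1
  have h2 := congrFun (congrFun h0 1) 0
  simp [nilMatrix] at h1 h2
  tauto

lemma inv_mul_eq_iff (A : Matrix.SpecialLinearGroup (Fin 2) ℂ) (B C : Matrix (Fin 2) (Fin 2) ℂ) :
    (A⁻¹ : Matrix.SpecialLinearGroup (Fin 2) ℂ).1 * B = C ↔ B = A.1 * C := by
  have h1 : A.1 * (A⁻¹ : Matrix.SpecialLinearGroup (Fin 2) ℂ).1 = 1 :=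
    congrArg Subtype.val (mul_inv_cancel A)
  have h2 : (A⁻¹ : Matrix.SpecialLinearGroup (Fin 2) ℂ).1 * A.1 = 1 :=
    congrArg Subtype.val (inv_mul_cancel A)
  constructor
  · rintro rfl
    rw [← mul_assoc, h1, one_mul]
  · rintro rfl
    rw [← mul_assoc, h2, one_mul]

section WeierstrassEquation

variable {S : Type*} [TopologicalSpace S] [ChartedSpace ℂ S] [IsManifold 𝓘(ℂ) ω S]

/-- The equation `F⁻¹ dF = [[g, -g²], [1, -g]] η` at one point. -/
def SolvesAt (g : S → OnePoint ℂ) (η : ∀ p : S, TangentSpace 𝓘(ℂ) p →L[ℂ] ℂ)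
    (F : S → Matrix.SpecialLinearGroup (Fin 2) ℂ) (p : S) : Prop :=
  ∀ c : ℂ, g p = (c : OnePoint ℂ) → ∀ v : ℂ,
    ((F p)⁻¹ : Matrix.SpecialLinearGroup (Fin 2) ℂ).1 * matDiff F p v
      = (η p v : ℂ) • !![c, -c ^ 2; 1, -c]

variable {g : S → OnePoint ℂ} {η : ∀ p : S, TangentSpace 𝓘(ℂ) p →L[ℂ] ℂ}
  {F G : S → Matrix.SpecialLinearGroup (Fin 2) ℂ} {p : S} {P Q θ : ℂ → ℂ}

omit [IsManifold 𝓘(ℂ) ω S] in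
lemma MatHolAt.eventually (hF : MatHolAt F p) : ∀ᶠ q in 𝓝 p, MatHolAt F q :=
  Filter.eventually_all.2 fun i => Filter.eventually_all.2 fun j => (hF i j).eventually

lemma matDiff_self (hF : MatHolAt F p) (v : ℂ) :
    matDiff F p v = v • coordDeriv F p (chartAt ℂ p p) := by
  rw [matDiff_eq (mem_chart_source ℂ p) hF, chartDeriv_self, one_mul]

lemma matDiff_const_mul {K : Matrix.SpecialLinearGroup (Fin 2) ℂ}
    (h : ∀ᶠ x in 𝓝 p, F x = K * G x) (hG : MatHolAt G p) :
    MatHolAt F p ∧ ∀ v : ℂ, matDiff F p v = K.1 * matDiff G p v := by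
  have hp := mem_chart_source ℂ p
  have h1 : ∀ i j, ((fun q => F q i j) ∘ (chartAt ℂ p).symm) =ᶠ[𝓝 (chartAt ℂ p p)]
      fun z => K i 0 * G ((chartAt ℂ p).symm z) 0 j + K i 1 * G ((chartAt ℂ p).symm z) 1 j := by
    intro i j
    filter_upwards [eventually_chart_symm h] with z hz
    simp [hz, Matrix.mul_apply, Fin.sum_univ_two]
  have h2 : MatHolAt F p := by
    intro i j
    rw [holAt_iff_analyticAt hp]
    refine AnalyticAt.congr ?_ (h1 i j).symm
    have h3 := fun k => (holAt_iff_analyticAt hp).1 (hG k j)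
    exact (analyticAt_const.mul (h3 0)).add (analyticAt_const.mul (h3 1))
  refine ⟨h2, fun v => ?_⟩
  rw [matDiff_self h2, matDiff_self hG, mul_smul_comm]
  congr 1
  ext i j
  have h4 := fun k => hasDerivAt_coordDeriv hp hG k j
  have h5 := ((h4 0).const_mul (K i 0)).add ((h4 1).const_mul (K i 1))
  simp only [coordDeriv, Matrix.of_apply, Matrix.mul_apply, Fin.sum_univ_two]
  rw [(h1 i j).deriv_eq]
  exact h5.deriv

omit [IsManifold 𝓘(ℂ) ω S] in
lemma IsLocalForm.analytic_nilMatrix (hL : IsLocalForm g η p P Q θ) (i j : Fin 2) :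
    AnalyticAt ℂ (fun z => (θ z • nilMatrix (P z) (Q z)) i j) (chartAt ℂ p p) := by
  have h1 := hL.analytic_P
  have h2 := hL.analytic_Q
  have h3 := hL.analytic_θ
  fin_cases i <;> fin_cases j <;> simp only [nilMatrix, Matrix.smul_apply, smul_eq_mul]
  · exact h3.mul (h1.mul h2)
  · exact h3.mul (h1.pow 2).neg
  · exact h3.mul (h2.pow 2)
  · exact h3.mul (h1.mul h2).neg

/-- The Weierstrass equation, in the form that makes sense also at the poles of `g`. -/
lemma IsLocalForm.coordDeriv_eq (hL : IsLocalForm g η p P Q θ) (hF : MatHolAt F p)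
    (hs : ∀ᶠ q in 𝓝 p, SolvesAt g η F q) :
    ∀ᶠ z in 𝓝 (chartAt ℂ p p), coordDeriv F p z =
      (F ((chartAt ℂ p).symm z)).1 * (θ z • nilMatrix (P z) (Q z)) := by
  have hp := mem_chart_source ℂ p
  have h1 : ∀ᶠ z in 𝓝[≠] (chartAt ℂ p p), coordDeriv F p z =
      (F ((chartAt ℂ p).symm z)).1 * (θ z • nilMatrix (P z) (Q z)) := by
    filter_upwards [hL.Q_ne, nhdsWithin_le_nhds (eventually_chart_symm hL.eventually),
      nhdsWithin_le_nhds (eventually_chart_symm hF.eventually),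
      nhdsWithin_le_nhds (eventually_chart_symm hs),
      nhdsWithin_le_nhds (eventually_mem_target p)] with z hQ ⟨_, _, hg, hη⟩ hF' hs' hz
    have hz' := (chartAt ℂ p).map_target hz
    rw [(chartAt ℂ p).right_inv hz] at hg hη
    have hc : g ((chartAt ℂ p).symm z) = ((P z / Q z : ℂ) : OnePoint ℂ) := by
      rw [hg, ratio, if_neg hQ]
    have h2 := hs' _ hc (chartDeriv p ((chartAt ℂ p).symm z))⁻¹
    rw [inv_mul_eq_iff, matDiff_eq hz' hF', hη, mul_inv_cancel₀ (chartDeriv_ne_zero hz'), one_smul,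
      mul_one, (chartAt ℂ p).right_inv hz] at h2
    rw [h2, smul_nilMatrix_eq (hg ▸ hc)]
  -- Both sides are analytic and agree off the isolated zeros of `Q`, so the equation persists at a
  -- pole.
  have h3 : ∀ i j, ∀ᶠ z in 𝓝 (chartAt ℂ p p), coordDeriv F p z i j =
      ((F ((chartAt ℂ p).symm z)).1 * (θ z • nilMatrix (P z) (Q z))) i j := by
    intro i j
    have hF' := fun i j => (holAt_iff_analyticAt hp).1 (hF i j)
    have h4 : AnalyticAt ℂ (fun z => coordDeriv F p z i j) (chartAt ℂ p p) := (hF' i j).deriv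
    refine (h4.frequently_eq_iff_eventually_eq ?_).1
      (h1.mono fun z hz => congrFun (congrFun hz i) j).frequently
    simp only [Matrix.mul_apply, Fin.sum_univ_two]
    exact ((hF' i 0).mul (hL.analytic_nilMatrix 0 j)).add
      ((hF' i 1).mul (hL.analytic_nilMatrix 1 j))
  filter_upwards [h3 0 0, h3 0 1, h3 1 0, h3 1 1] with z h00 h01 h10 h11
  ext i j
  fin_cases i <;> fin_cases j <;> assumption

/-- Local solutions of the Weierstrass equation exist. -/
lemma IsLocalForm.exists_solution (hL : IsLocalForm g η p P Q θ) :
    ∃ F : S → Matrix.SpecialLinearGroup (Fin 2) ℂ,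
      ∀ᶠ q in 𝓝 p, MatHolAt F q ∧ SolvesAt g η F q := by
  obtain ⟨F, -, hF⟩ := exists_local_matrix_solution
    (A := fun i j z => (θ z • nilMatrix (P z) (Q z)) i j) hL.analytic_nilMatrix
    (Filter.Eventually.of_forall fun z => by simp [nilMatrix])
  refine ⟨ofChart p F, ?_⟩
  filter_upwards [eventually_chart hF.eventually_nhds, eventually_mem_source p, hL.eventually]
    with q h1 hq ⟨_, _, hg, hη⟩
  have h2 : MatHolAt (ofChart p F) q :=
    matHolAt_ofChart hq (h1.mono fun z hz => ⟨hz.1, fun i j => (hz.2 i j).differentiableAt⟩)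
  refine ⟨h2, fun c hc v => ?_⟩
  rw [inv_mul_eq_iff, matDiff_eq hq h2, coordDeriv_ofChart hq (h1.mono fun z hz => hz.1)
    h1.self_of_nhds.2, hη, ofChart_val h1.self_of_nhds.1, mul_comm (_ ^ 2 * _),
    mul_smul (chartDeriv p q * v) (_ ^ 2 * _), ← smul_nilMatrix_eq (hg ▸ hc), mul_smul_comm]
  rfl

/-- Two solutions differ by a left factor that is locally constant. -/
lemma IsLocalForm.eventually_mul_inv_eq (hL : IsLocalForm g η p P Q θ) (hF : MatHolAt F p)
    (hG : MatHolAt G p) (hFs : ∀ᶠ q in 𝓝 p, SolvesAt g η F q)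
    (hGs : ∀ᶠ q in 𝓝 p, SolvesAt g η G q) :
    ∀ᶠ q in 𝓝 p, F q * (G q)⁻¹ = F p * (G p)⁻¹ := by
  have hp := mem_chart_source ℂ p
  -- These are the entries of `F * adj G`, which is `F * G⁻¹`. With a common traceless coefficient
  -- `A` one has `adj A = -A`, and the two terms of the derivative cancel.
  have hd : ∀ᶠ z in 𝓝 (chartAt ℂ p p), ∀ i,
      HasDerivAt (fun z => F ((chartAt ℂ p).symm z) i 0 * G ((chartAt ℂ p).symm z) 1 1 -
        F ((chartAt ℂ p).symm z) i 1 * G ((chartAt ℂ p).symm z) 1 0) 0 z ∧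
      HasDerivAt (fun z => F ((chartAt ℂ p).symm z) i 1 * G ((chartAt ℂ p).symm z) 0 0 -
        F ((chartAt ℂ p).symm z) i 0 * G ((chartAt ℂ p).symm z) 0 1) 0 z := by
    filter_upwards [hL.coordDeriv_eq hF hFs, hL.coordDeriv_eq hG hGs, eventually_mem_target p,
      eventually_chart_symm hF.eventually, eventually_chart_symm hG.eventually]
      with z h1 h2 hz hF' hG' i
    have h3 := hasDerivAt_coordDeriv ((chartAt ℂ p).map_target hz) hF'
    have h4 := hasDerivAt_coordDeriv ((chartAt ℂ p).map_target hz) hG'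
    rw [(chartAt ℂ p).right_inv hz] at h3 h4
    rw [h1] at h3
    rw [h2] at h4
    constructor
    · have h5 := ((h3 i 0).mul (h4 1 1)).sub ((h3 i 1).mul (h4 1 0))
      refine h5.congr_deriv ?_
      simp [Matrix.mul_apply, Fin.sum_univ_two, nilMatrix]
      ring
    · have h5 := ((h3 i 1).mul (h4 0 0)).sub ((h3 i 0).mul (h4 0 1))
      refine h5.congr_deriv ?_
      simp [Matrix.mul_apply, Fin.sum_univ_two, nilMatrix]
      ring
  have he := fun i => eventually_eq_of_hasDerivAt_zero (hd.mono fun z hz => (hz i).1)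
  have he' := fun i => eventually_eq_of_hasDerivAt_zero (hd.mono fun z hz => (hz i).2)
  filter_upwards [eventually_chart (Filter.eventually_all.2 he),
    eventually_chart (Filter.eventually_all.2 he'), eventually_mem_source p] with q h1 h2 hq
  rw [(chartAt ℂ p).left_inv hq, (chartAt ℂ p).left_inv hp] at h1 h2
  ext i j
  simp only [Matrix.SpecialLinearGroup.coe_mul, Matrix.SpecialLinearGroup.coe_inv,
    Matrix.adjugate_fin_two, Matrix.mul_apply, Fin.sum_univ_two]
  fin_cases j
  · simpa [sub_eq_add_neg] using h1 i
  · simpa [sub_eq_add_neg, add_comm] using h2 i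

lemma IsLocalForm.matDiff_eq (hL : IsLocalForm g η p P Q θ) (hF : MatHolAt F p)
    (hs : ∀ᶠ q in 𝓝 p, SolvesAt g η F q) (v : ℂ) :
    matDiff F p v = (F p).1 * ((v * θ (chartAt ℂ p p)) •
      nilMatrix (P (chartAt ℂ p p)) (Q (chartAt ℂ p p))) := by
  rw [matDiff_self hF, (hL.coordDeriv_eq hF hs).self_of_nhds,
    (chartAt ℂ p).left_inv (mem_chart_source ℂ p), ← mul_smul_comm, smul_smul]

omit [IsManifold 𝓘(ℂ) ω S] in
lemma IsHolomorphicImmersion.matHolAt (hF : IsHolomorphicImmersion F) (p : S) : MatHolAt F p :=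
  fun i j => Filter.Eventually.of_forall (hF.1 i j)

omit [IsManifold 𝓘(ℂ) ω S] in
lemma SolvesWeierstrass.solvesAt (hF : SolvesWeierstrass g η F) (p : S) : SolvesAt g η F p :=
  fun c hc v => hF p c hc v

/-- Existence and uniqueness of the solution of the Weierstrass equation. -/
theorem existsUnique_solvesWeierstrass [SimplyConnectedSpace S] (hg : IsMeromorphicFunction g)
    (hη : IsHolomorphicForm η) (hρ : HatMetricIsRiemannian g η) (w₀ : S) :
    ∃! F : S → Matrix.SpecialLinearGroup (Fin 2) ℂ,
      IsHolomorphicImmersion F ∧ F w₀ = 1 ∧ SolvesWeierstrass g η F := by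
  have : LocallyPathConnectedSpace S := ChartedSpace.locallyPathConnectedSpace ℂ S
  choose P Q θ hL using exists_localForm hg hη hρ
  choose H hH using fun p => (hL p).exists_solution
  choose U hUs hUo hUp using fun p => mem_nhds_iff.1 (hH p)
  have hHU : ∀ p q, q ∈ U p → MatHolAt (H p) q ∧ ∀ᶠ x in 𝓝 q, SolvesAt g η (H p) x :=
    fun p q hq => ⟨(hUs p hq).1, Filter.mem_of_superset ((hUo p).mem_nhds hq)
      fun x hx => (hUs p hx).2⟩
  obtain ⟨F, hF0, hF⟩ := exists_glued_function U hUo hUp H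
    (fun p p' q hq hq' => (hL q).eventually_mul_inv_eq (hHU p q hq).1 (hHU p' q hq').1
      (hHU p q hq).2 (hHU p' q hq').2) w₀ 1
  have hF' : ∀ p, MatHolAt F p ∧ SolvesAt g η F p := by
    intro p
    have h1 := hHU p p (hUp p)
    have h2 : ∀ᶠ x in 𝓝 p, F x = F p * (H p p)⁻¹ * H p x := by
      filter_upwards [hF p p (hUp p)] with x hx
      rw [← hx]
      group
    obtain ⟨h3, h4⟩ := matDiff_const_mul h2 h1.1
    refine ⟨h3, fun c hc v => ?_⟩
    have h5 := h1.2.self_of_nhds c hc v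
    rw [inv_mul_eq_iff] at h5 ⊢
    rw [h4, h5, Matrix.SpecialLinearGroup.coe_mul, mul_assoc, (inv_mul_eq_iff _ _ _).2 rfl]
  refine ⟨F, ⟨⟨fun i j p => ((hF' p).1 i j).mdifferentiableAt, fun p v hv h0 => ?_⟩, hF0,
    fun p c hc v => (hF' p).2 c hc v⟩, ?_⟩
  · have h1 := (hL p).matDiff_eq (hF' p).1 (Filter.Eventually.of_forall fun q => (hF' q).2) v
    rw [← inv_mul_eq_iff, h0, mul_zero] at h1
    obtain ⟨h2, h3, -⟩ := (hL p).eventually.self_of_nhds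
    exact smul_ne_zero (mul_ne_zero hv h2) (nilMatrix_ne_zero h3) h1.symm
  · rintro G ⟨hG, hG0, hGs⟩
    -- The quotient of two solutions is locally constant, hence constant on a connected surface, and
    -- it is 1 at the base point.
    have h1 : IsLocallyConstant fun q => G q * (F q)⁻¹ := by
      rw [IsLocallyConstant.iff_eventually_eq]
      exact fun p => (hL p).eventually_mul_inv_eq (hG.matHolAt p) (hF' p).1
        (Filter.Eventually.of_forall hGs.solvesAt) (Filter.Eventually.of_forall fun q => (hF' q).2)
    funext q
    have h2 := h1.apply_eq_of_preconnectedSpace q w₀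
    simp only [hG0, hF0] at h2
    simpa [mul_inv_eq_one] using h2

end WeierstrassEquation

/-! ### Lorentz geometry of the matrices x y^* + y x^* -/

lemma lorentz_comm (x y : L4) : lorentz x y = lorentz y x := by simp only [lorentz]; ring

lemma lorentz_add_left (x y z : L4) : lorentz (x + y) z = lorentz x z + lorentz y z := by
  simp only [lorentz, Pi.add_apply]; ring

lemma lorentz_sub_left (x y z : L4) : lorentz (x - y) z = lorentz x z - lorentz y z := by
  simp only [lorentz, Pi.sub_apply]; ring

lemma lorentz_smul_left (c : ℝ) (x y : L4) : lorentz (c • x) y = c * lorentz x y := by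
  simp only [lorentz, Pi.smul_apply, smul_eq_mul]; ring

lemma lorentz_add_right (x y z : L4) : lorentz x (y + z) = lorentz x y + lorentz x z := by
  simp only [lorentz, Pi.add_apply]; ring

lemma lorentz_sub_right (x y z : L4) : lorentz x (y - z) = lorentz x y - lorentz x z := by
  simp only [lorentz, Pi.sub_apply]; ring

lemma lorentz_smul_right (c : ℝ) (x y : L4) : lorentz x (c • y) = c * lorentz x y := by
  simp only [lorentz, Pi.smul_apply, smul_eq_mul]; ring

/-- The vector of Lorentz space given by the Hermitian matrix `x y^* + y x^*`. -/
def hermProd (x y : ℂ × ℂ) : L4 :=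
  ![x.1.re * y.1.re + x.1.im * y.1.im + (x.2.re * y.2.re + x.2.im * y.2.im),
    x.1.re * y.2.re + x.1.im * y.2.im + (y.1.re * x.2.re + y.1.im * x.2.im),
    x.1.im * y.2.re - x.1.re * y.2.im + (y.1.im * x.2.re - y.1.re * x.2.im),
    x.1.re * y.1.re + x.1.im * y.1.im - (x.2.re * y.2.re + x.2.im * y.2.im)]

/-- The determinant of the matrix with columns `x` and `y`. -/
def pairDet (x y : ℂ × ℂ) : ℂ := x.1 * y.2 - x.2 * y.1

lemma hermProd_comm (x y : ℂ × ℂ) : hermProd x y = hermProd y x := by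
  ext i; fin_cases i <;> simp [hermProd] <;> ring

lemma hermProd_add_left (x x' y : ℂ × ℂ) :
    hermProd (x + x') y = hermProd x y + hermProd x' y := by
  ext i; fin_cases i <;> simp [hermProd] <;> ring

lemma hermProd_add_right (x y y' : ℂ × ℂ) :
    hermProd x (y + y') = hermProd x y + hermProd x y' := by
  rw [hermProd_comm, hermProd_add_left, hermProd_comm y, hermProd_comm y']

lemma hermProd_smul_left (c : ℝ) (x y : ℂ × ℂ) : hermProd (c • x) y = c • hermProd x y := by
  ext i; fin_cases i <;> simp [hermProd] <;> ring

lemma hermProd_smul_right (c : ℝ) (x y : ℂ × ℂ) : hermProd x (c • y) = c • hermProd x y := by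
  rw [hermProd_comm, hermProd_smul_left, hermProd_comm]

lemma hermProd_complex_smul (c : ℂ) (x y : ℂ × ℂ) :
    hermProd (c • x) y = hermProd x (conj c • y) := by
  ext i; fin_cases i <;> simp [hermProd] <;> ring

/-- The Lorentz square of a Hermitian matrix is minus its determinant. Since `x y^* + y x^*` is the
product of the matrices with columns `x, y` and `y, x` (the latter starred), its determinant is a
product of pair determinants; this is the polarised form. -/
lemma lorentz_hermProd (x y z w : ℂ × ℂ) : lorentz (hermProd x y) (hermProd z w) =
    -(pairDet x z * conj (pairDet y w)).re - (pairDet x w * conj (pairDet y z)).re := by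
  simp [lorentz, hermProd, pairDet]
  ring

lemma pairDet_self (x : ℂ × ℂ) : pairDet x x = 0 := by simp [pairDet]; ring

lemma pairDet_comm (x y : ℂ × ℂ) : pairDet x y = -pairDet y x := by simp [pairDet]; ring

lemma pairDet_smul_left (c : ℂ) (x y : ℂ × ℂ) : pairDet (c • x) y = c * pairDet x y := by
  simp [pairDet]; ring

lemma pairDet_smul_right (c : ℂ) (x y : ℂ × ℂ) : pairDet x (c • y) = c * pairDet x y := by
  simp [pairDet]; ring

/-- `hermProd` as a continuous bilinear map. -/
def hermProdL : (ℂ × ℂ) →L[ℝ] (ℂ × ℂ) →L[ℝ] L4 :=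
  LinearMap.toContinuousLinearMap ((LinearMap.toContinuousLinearMap (𝕜 := ℝ)).toLinearMap ∘ₗ
    LinearMap.mk₂ ℝ hermProd hermProd_add_left hermProd_smul_left hermProd_add_right
      hermProd_smul_right)

lemma hermProdL_apply (x y : ℂ × ℂ) : hermProdL x y = hermProd x y := rfl

/-- The sign on the right fixes the orientation of the frame built from `x` and `y`; the sign of the
unit normal rests on it. -/
lemma det_hermProd_aux (x y : ℂ × ℂ) : (Matrix.of ![hermProd x x, hermProd x y,
    hermProd (Complex.I • x) y, hermProd y y]).det = -2 * Complex.normSq (pairDet x y) ^ 2 := by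
  rw [Matrix.det_succ_row_zero]
  simp [Fin.sum_univ_succ, Matrix.det_fin_three, Fin.succAbove, hermProd, pairDet,
    Complex.normSq_apply]
  ring

/-! ### First order geometry of F e₃ F^* -/

section Face

variable {S : Type*} [TopologicalSpace S] [ChartedSpace ℂ S] [IsManifold 𝓘(ℂ) ω S]

lemma tderiv_eq_of_hasFDerivAt {E : Type*} [NormedAddCommGroup E] [NormedSpace ℝ E] {f : S → E}
    {p : S} {L : ℂ →L[ℝ] E} (h : HasFDerivAt (f ∘ (chartAt ℂ p).symm) L (chartAt ℂ p p)) :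
    tderiv ℝ f p = L := by
  have hp := mem_chart_source ℂ p
  rw [tderiv_eq_comp hp ((mdifferentiableAt_iff_chart hp).2 h.differentiableAt), h.fderiv,
    tderiv_chart_self, ContinuousLinearMap.comp_id]

omit [IsManifold 𝓘(ℂ) ω S] in
lemma diff_eq_tderiv (f : S → L4) (p : S) (v : ℂ) : diff f p v = tderiv ℝ f p v := rfl

lemma exists_hasFDerivAt_hermProd {x y : ℂ → ℂ × ℂ} {x' y' : ℂ × ℂ} {z : ℂ}
    (hx : HasDerivAt x x' z) (hy : HasDerivAt y y' z) : ∃ L : ℂ →L[ℝ] L4,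
      HasFDerivAt (fun z => hermProd (x z) (y z)) L z ∧
      ∀ v, L v = hermProd (v • x') (y z) + hermProd (x z) (v • y') := by
  have h := hermProdL.hasFDerivAt_of_bilinear (hx.hasFDerivAt.restrictScalars ℝ)
    (hy.hasFDerivAt.restrictScalars ℝ)
  refine ⟨_, h, fun v => ?_⟩
  simp [hermProdL_apply, add_comm]

/-- The columns of `F`. -/
def colVec (F : S → Matrix.SpecialLinearGroup (Fin 2) ℂ) (j : Fin 2) (q : S) : ℂ × ℂ :=
  (F q 0 j, F q 1 j)

omit [TopologicalSpace S] [ChartedSpace ℂ S] [IsManifold 𝓘(ℂ) ω S] in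
lemma pairDet_colVec (F : S → Matrix.SpecialLinearGroup (Fin 2) ℂ) (q : S) :
    pairDet (colVec F 0 q) (colVec F 1 q) = 1 := by
  have h := (F q).det_coe
  rw [Matrix.det_fin_two] at h
  simp only [pairDet, colVec]
  linear_combination h

omit [TopologicalSpace S] [ChartedSpace ℂ S] [IsManifold 𝓘(ℂ) ω S] in
lemma faceOf_eq (F : S → Matrix.SpecialLinearGroup (Fin 2) ℂ) (q : S) :
    faceOf F q = (1 / 2 : ℝ) • hermProd (colVec F 0 q) (colVec F 0 q) -
      (1 / 2 : ℝ) • hermProd (colVec F 1 q) (colVec F 1 q) := by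
  ext i
  fin_cases i <;> simp [faceOf, hermEquiv, e3, hermProd, colVec, Matrix.mul_apply,
    Fin.sum_univ_two] <;> ring

omit [TopologicalSpace S] [ChartedSpace ℂ S] [IsManifold 𝓘(ℂ) ω S] in
lemma faceOf_mem_deSitter (F : S → Matrix.SpecialLinearGroup (Fin 2) ℂ) (q : S) :
    faceOf F q ∈ deSitter := by
  have h := pairDet_colVec F q
  have h' := pairDet_comm (colVec F 0 q) (colVec F 1 q)
  rw [h] at h'
  have h'' : pairDet (colVec F 1 q) (colVec F 0 q) = -1 := by linear_combination h'
  simp only [deSitter, Set.mem_ofPred_eq, faceOf_eq, lorentz_sub_left, lorentz_sub_right,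
    lorentz_smul_left, lorentz_smul_right, lorentz_hermProd, pairDet_self, h, h'']
  norm_num

variable {F : S → Matrix.SpecialLinearGroup (Fin 2) ℂ} {p : S} {P Q t : ℂ}

/-- The vector `F (P, Q)`. -/
def dirVec (F : S → Matrix.SpecialLinearGroup (Fin 2) ℂ) (P Q : ℂ) (q : S) : ℂ × ℂ :=
  P • colVec F 0 q + Q • colVec F 1 q

omit [TopologicalSpace S] [ChartedSpace ℂ S] [IsManifold 𝓘(ℂ) ω S] in
lemma pairDet_dirVec (F : S → Matrix.SpecialLinearGroup (Fin 2) ℂ) (P Q P' Q' : ℂ) (q : S) :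
    pairDet (dirVec F P Q q) (dirVec F P' Q' q) = P * Q' - Q * P' := by
  have h := pairDet_colVec F q
  simp only [pairDet, dirVec, Prod.fst_add, Prod.snd_add, Prod.smul_fst, Prod.smul_snd,
    smul_eq_mul] at h ⊢
  linear_combination (P * Q' - Q * P') * h

/-- The nilpotent matrix is the column `(P, Q)` times the row `(Q, -P)`. Hence both columns of `F'`
are multiples of the single vector `F (P, Q)`. -/
lemma hasDerivAt_colVec (hF : MatHolAt F p) (hd : ∀ v : ℂ, matDiff F p v =
    (F p).1 * ((v * t) • nilMatrix P Q)) :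
    HasDerivAt (fun z => colVec F 0 ((chartAt ℂ p).symm z)) ((t * Q) • dirVec F P Q p)
      (chartAt ℂ p p) ∧
    HasDerivAt (fun z => colVec F 1 ((chartAt ℂ p).symm z)) (-(t * P) • dirVec F P Q p)
      (chartAt ℂ p p) := by
  have hp := mem_chart_source ℂ p
  have h1 := hasDerivAt_coordDeriv hp hF
  have h2 := hd 1
  rw [matDiff_self hF, one_smul, one_mul] at h2
  rw [h2] at h1
  constructor
  · refine ((h1 0 0).prodMk (h1 1 0)).congr_deriv ?_
    ext <;> simp [Matrix.mul_apply, Fin.sum_univ_two, nilMatrix, dirVec, colVec] <;> ring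
  · refine ((h1 0 1).prodMk (h1 1 1)).congr_deriv ?_
    ext <;> simp [Matrix.mul_apply, Fin.sum_univ_two, nilMatrix, dirVec, colVec] <;> ring

/-- The differential of the face is `df = F (u w^* θ + w u^* θ̄) F^*`, where `u = (P, Q)` and
`w` is the conjugate of `(Q, P)`. -/
lemma diff_faceOf (hF : MatHolAt F p) (hd : ∀ v : ℂ, matDiff F p v =
    (F p).1 * ((v * t) • nilMatrix P Q)) :
    MDifferentiableAt 𝓘(ℝ, ℂ) 𝓘(ℝ, L4) (faceOf F) p ∧ ∀ v : ℂ, diff (faceOf F) p v =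
      hermProd ((v * t) • dirVec F P Q p) (dirVec F (conj Q) (conj P) p) := by
  have hp := mem_chart_source ℂ p
  obtain ⟨h0, h1⟩ := hasDerivAt_colVec hF hd
  obtain ⟨L0, hL0, hL0v⟩ := exists_hasFDerivAt_hermProd h0 h0
  obtain ⟨L1, hL1, hL1v⟩ := exists_hasFDerivAt_hermProd h1 h1
  have h2 : HasFDerivAt (faceOf F ∘ (chartAt ℂ p).symm)
      ((1 / 2 : ℝ) • L0 - (1 / 2 : ℝ) • L1) (chartAt ℂ p p) := by
    have h3 : faceOf F ∘ (chartAt ℂ p).symm = fun z =>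
        (1 / 2 : ℝ) • hermProd (colVec F 0 ((chartAt ℂ p).symm z))
          (colVec F 0 ((chartAt ℂ p).symm z)) -
        (1 / 2 : ℝ) • hermProd (colVec F 1 ((chartAt ℂ p).symm z))
          (colVec F 1 ((chartAt ℂ p).symm z)) := funext fun z => faceOf_eq F _
    rw [h3]
    exact (hL0.const_smul (1 / 2 : ℝ)).sub (hL1.const_smul (1 / 2 : ℝ))
  refine ⟨(mdifferentiableAt_iff_chart hp).2 h2.differentiableAt, fun v => ?_⟩
  rw [diff_eq_tderiv, tderiv_eq_of_hasFDerivAt h2]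
  simp only [sub_apply, smul_apply, hL0v, hL1v,
    (chartAt ℂ p).left_inv hp]
  rw [show dirVec F (conj Q) (conj P) p = conj Q • colVec F 0 p + conj P • colVec F 1 p from rfl]
  generalize dirVec F P Q p = u, colVec F 0 p = a, colVec F 1 p = b
  ext i
  fin_cases i <;> simp [hermProd] <;> ring

/-- `|P|² - |Q|²`. -/
def defect (P Q : ℂ) : ℝ := ‖P‖ ^ 2 - ‖Q‖ ^ 2

lemma defect_eq (P Q : ℂ) : (defect P Q : ℂ) = P * conj P - Q * conj Q := by
  rw [defect, Complex.mul_conj, Complex.mul_conj, Complex.normSq_eq_norm_sq,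
    Complex.normSq_eq_norm_sq]
  push_cast
  rfl

omit [TopologicalSpace S] [ChartedSpace ℂ S] [IsManifold 𝓘(ℂ) ω S] in
lemma pairDet_dirVec_conj (F : S → Matrix.SpecialLinearGroup (Fin 2) ℂ) (P Q : ℂ) (q : S) :
    pairDet (dirVec F P Q q) (dirVec F (conj Q) (conj P) q) = defect P Q := by
  rw [pairDet_dirVec, defect_eq]

omit [TopologicalSpace S] [ChartedSpace ℂ S] [IsManifold 𝓘(ℂ) ω S] in
lemma pairDet_dirVec_conj' (F : S → Matrix.SpecialLinearGroup (Fin 2) ℂ) (P Q : ℂ) (q : S) :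
    pairDet (dirVec F (conj Q) (conj P) q) (dirVec F P Q q) = -defect P Q := by
  rw [pairDet_comm, pairDet_dirVec_conj]

/-- With `df` in the form `u w^* + w u^*`, the determinants of `u` or `w` with itself drop out. Only
the mixed determinant survives, which is the defect, and it enters squared. -/
lemma inducedMetric_faceOf (hF : MatHolAt F p) (hd : ∀ v : ℂ, matDiff F p v =
    (F p).1 * ((v * t) • nilMatrix P Q)) (v w : ℂ) :
    inducedMetric (faceOf F) p v w = defect P Q ^ 2 * (v * t * conj (w * t)).re := by
  simp only [inducedMetric]
  rw [(diff_faceOf hF hd).2, (diff_faceOf hF hd).2, lorentz_hermProd]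
  simp only [pairDet_smul_left, pairDet_smul_right, pairDet_self, pairDet_dirVec_conj,
    pairDet_dirVec_conj']
  simp
  ring

-- For `a = (P, Q)` and `b = (Q̄, P̄)` the matrix `a a^* - b b^*` is diagonal and equals the defect
-- times `e₃`. Conjugating by `F` gives the identity, and it stays meaningful at singular points.
omit [TopologicalSpace S] [ChartedSpace ℂ S] [IsManifold 𝓘(ℂ) ω S] in
lemma defect_smul_faceOf (F : S → Matrix.SpecialLinearGroup (Fin 2) ℂ) (P Q : ℂ) (q : S) :
    defect P Q • faceOf F q = (1 / 2 : ℝ) • (hermProd (dirVec F P Q q) (dirVec F P Q q) -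
      hermProd (dirVec F (conj Q) (conj P) q) (dirVec F (conj Q) (conj P) q)) := by
  rw [faceOf_eq, defect, ← Complex.normSq_eq_norm_sq, ← Complex.normSq_eq_norm_sq,
    Complex.normSq_apply, Complex.normSq_apply]
  ext i
  fin_cases i <;> simp [hermProd, dirVec] <;> ring

/-- The unit normal of the face, in terms of homogeneous coordinates of `g`. -/
def normalVec (F : S → Matrix.SpecialLinearGroup (Fin 2) ℂ) (P Q : ℂ) (q : S) : L4 :=
  (1 / (2 * defect P Q)) • (hermProd (dirVec F P Q q) (dirVec F P Q q) +
    hermProd (dirVec F (conj Q) (conj P) q) (dirVec F (conj Q) (conj P) q))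

omit [TopologicalSpace S] [ChartedSpace ℂ S] [IsManifold 𝓘(ℂ) ω S] in
lemma faceOf_eq_of_defect (hδ : defect P Q ≠ 0) (q : S) : faceOf F q = (1 / (2 * defect P Q)) •
    (hermProd (dirVec F P Q q) (dirVec F P Q q) -
      hermProd (dirVec F (conj Q) (conj P) q) (dirVec F (conj Q) (conj P) q)) := by
  have h := congrArg (fun x => (defect P Q)⁻¹ • x) (defect_smul_faceOf F P Q q)
  simp only [smul_smul] at h
  rw [inv_mul_cancel₀ hδ, one_smul] at h
  rw [h]
  congr 1
  field_simp

-- The `w w^*` terms cancel, so the null vector is a multiple of `u u^*` alone. Both the Gauss map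
-- and the second fundamental form are read off from this.
omit [TopologicalSpace S] [ChartedSpace ℂ S] [IsManifold 𝓘(ℂ) ω S] in
lemma faceOf_add_normalVec (hδ : defect P Q ≠ 0) (q : S) : faceOf F q + normalVec F P Q q =
    (1 / defect P Q) • hermProd (dirVec F P Q q) (dirVec F P Q q) := by
  rw [faceOf_eq_of_defect hδ, normalVec, ← smul_add]
  have : ∀ a b : L4, a - b + (a + b) = (2 : ℝ) • a := fun a b => by rw [two_smul]; abel
  rw [this, smul_smul]
  congr 1
  field_simp

lemma det_frame (a b c d : L4) (k : ℝ) : (Matrix.of ![k • (a + b), c, d, k • (a - b)]).det =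
    -2 * k ^ 2 * (Matrix.of ![a, c, d, b]).det := by
  rw [Matrix.det_succ_row_zero, Matrix.det_succ_row_zero]
  simp [Fin.sum_univ_succ, Matrix.det_fin_three, Fin.succAbove]
  ring

/-- Multiplying the tangent plane by the complex number `r + i s` scales the volume by its squared
modulus; orientation is thus independent of the holomorphic coordinate. -/
lemma det_combination (a b c d : L4) (r s : ℝ) :
    (Matrix.of ![a, r • c + s • d, -s • c + r • d, b]).det =
    (r ^ 2 + s ^ 2) * (Matrix.of ![a, c, d, b]).det := by
  rw [Matrix.det_succ_row_zero, Matrix.det_succ_row_zero]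
  simp [Fin.sum_univ_succ, Matrix.det_fin_three, Fin.succAbove]
  ring

lemma isOrientedUnitNormal_normalVec (hF : MatHolAt F p) (hd : ∀ v : ℂ, matDiff F p v =
    (F p).1 * ((v * t) • nilMatrix P Q)) (ht : t ≠ 0) (hδ : defect P Q ≠ 0) :
    IsOrientedUnitNormal (faceOf F) p (normalVec F P Q p) := by
  have hδ' := pairDet_dirVec_conj F P Q p
  have hδ'' := pairDet_dirVec_conj' F P Q p
  have key : ∀ v : ℂ, lorentz (normalVec F P Q p) (diff (faceOf F) p v) = 0 := by
    intro v
    rw [(diff_faceOf hF hd).2]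
    simp only [normalVec, lorentz_smul_left, lorentz_add_left, lorentz_hermProd,
      pairDet_smul_right, pairDet_self, hδ', hδ'']
    simp
  refine ⟨?_, ?_, key, ?_⟩
  · simp only [normalVec, lorentz_smul_left, lorentz_smul_right, lorentz_add_left,
      lorentz_add_right, lorentz_hermProd, pairDet_self, hδ', hδ'']
    simp
    field_simp
    ring
  · rw [faceOf_eq_of_defect hδ]
    simp only [normalVec, lorentz_smul_left, lorentz_smul_right, lorentz_add_left,
      lorentz_sub_right, lorentz_hermProd, pairDet_self, hδ', hδ'']
    simp
  · have h1 : diff (faceOf F) p (1 : ℂ) = t.re • hermProd (dirVec F P Q p)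
        (dirVec F (conj Q) (conj P) p) + t.im • hermProd (Complex.I • dirVec F P Q p)
        (dirVec F (conj Q) (conj P) p) := by
      rw [(diff_faceOf hF hd).2, one_mul]
      generalize dirVec F P Q p = a
      ext i
      fin_cases i <;> simp [hermProd] <;> ring
    have h2 : diff (faceOf F) p Complex.I = -t.im • hermProd (dirVec F P Q p)
        (dirVec F (conj Q) (conj P) p) + t.re • hermProd (Complex.I • dirVec F P Q p)
        (dirVec F (conj Q) (conj P) p) := by
      rw [(diff_faceOf hF hd).2]
      generalize dirVec F P Q p = a
      ext i
      fin_cases i <;> simp [hermProd] <;> ring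
    -- Two negative factors occur, one from replacing the rows `N`, `f` by `u u^*`, `w w^*` and one
    -- from `det_hermProd_aux`. Their product is positive for either sign of the defect.
    rw [h1, h2, faceOf_eq_of_defect hδ, normalVec, det_frame, det_combination, det_hermProd_aux,
      hδ', Complex.normSq_ofReal]
    have h3 : 0 < t.re ^ 2 + t.im ^ 2 := by
      have := Complex.normSq_pos.2 ht
      rw [Complex.normSq_apply] at this
      nlinarith
    have h4 : 0 < (1 / (2 * defect P Q)) ^ 2 := by positivity
    have h5 : 0 < (defect P Q * defect P Q) ^ 2 := by positivity
    have h6 := mul_pos (mul_pos h4 h3) h5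
    nlinarith

end Face

/-! ### Unique continuation -/

section Continuation

variable {S : Type*} [TopologicalSpace S] [ChartedSpace ℂ S]

/-- Unique continuation: a condition on the value of a local holomorphic function that forces the
function to be constant holds everywhere if it holds near one point. -/
lemma forall_of_eventually [PreconnectedSpace S] {R : S → Prop} {T : ℂ → Prop}
    (hT : ∀ (f : ℂ → ℂ) (z : ℂ), AnalyticAt ℂ f z → (∀ᶠ x in 𝓝 z, T (f x)) →
      ∀ᶠ x in 𝓝 z, f x = f z)
    (hloc : ∀ p : S, ∃ f : ℂ → ℂ, AnalyticAt ℂ f (chartAt ℂ p p) ∧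
      ∀ᶠ q in 𝓝 p, (R q ↔ T (f (chartAt ℂ p q))))
    {p₀ : S} (h₀ : ∀ᶠ q in 𝓝 p₀, R q) (q : S) : R q := by
  set A : Set S := {p | ∀ᶠ q in 𝓝 p, R q} with hA
  have hopen : IsOpen A := isOpen_iff_mem_nhds.2 fun p hp => eventually_eventually_nhds.2 hp
  have hclosed : IsClosed A := by
    refine isClosed_of_closure_subset fun p hp => ?_
    obtain ⟨f, hf, hR⟩ := hloc p
    obtain ⟨r, hr0, hr⟩ := Metric.eventually_nhds_iff_ball.1
      ((hf.eventually_analyticAt.and (eventually_chart_symm hR)).and (eventually_mem_target p))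
    have hball := Metric.ball_mem_nhds (chartAt ℂ p p) hr0
    obtain ⟨q, ⟨hq1, hq2⟩, hq3⟩ := mem_closure_iff_nhds.1 hp _
      ((eventually_chart hball).and (eventually_mem_source p))
    have hz : chartAt ℂ p q ∈ Metric.ball (chartAt ℂ p p) r := hq1
    -- A limit point `p` of `A` has some `q` of `A` inside a ball of analyticity. The condition
    -- makes `f` constant near `q`, and the identity theorem spreads this over the ball, including
    -- `p`.
    have h1 : ∀ᶠ x in 𝓝 (chartAt ℂ p q), T (f x) := by
      filter_upwards [(eventually_nhds_iff_chart hq2).1 hq3, Metric.isOpen_ball.mem_nhds hz]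
        with x hx hx'
      have h2 := (hr x hx').1.2.1 hx
      rwa [(chartAt ℂ p).right_inv (hr x hx').2] at h2
    have h2 := hT f _ (hr _ hz).1.1 h1
    have h3 : Set.EqOn f (fun _ => f (chartAt ℂ p q)) (Metric.ball (chartAt ℂ p p) r) :=
      AnalyticOnNhd.eqOn_of_preconnected_of_eventuallyEq (fun x hx => (hr x hx).1.1)
        (fun x _ => analyticAt_const) (convex_ball _ _).isPreconnected hz h2
    have h4 : T (f (chartAt ℂ p q)) := h1.self_of_nhds
    filter_upwards [hR, eventually_chart hball] with x hx hx'
    rw [hx, h3 hx']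
    exact h4
  have huniv : A = Set.univ := IsClopen.eq_univ ⟨hclosed, hopen⟩ ⟨p₀, h₀⟩
  have hq : q ∈ A := huniv ▸ Set.mem_univ q
  exact Filter.Eventually.self_of_nhds hq

/-- A norm that is constant has a local maximum at every point, so the maximum modulus principle
applies. -/
lemma eventually_eq_of_norm_eq_one (f : ℂ → ℂ) (z : ℂ) (hf : AnalyticAt ℂ f z)
    (h : ∀ᶠ x in 𝓝 z, ‖f x‖ = 1) : ∀ᶠ x in 𝓝 z, f x = f z := by
  refine Complex.eventually_eq_of_isLocalMax_norm
    (hf.eventually_analyticAt.mono fun x hx => hx.differentiableAt) ?_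
  filter_upwards [h] with x hx
  simp only [Function.comp_apply]
  rw [hx, h.self_of_nhds]

end Continuation

/-! ### Pointwise form of the data; density of the regular set -/

section Data

variable {S : Type*} [TopologicalSpace S] [ChartedSpace ℂ S] [IsManifold 𝓘(ℂ) ω S]
  {g : S → OnePoint ℂ} {η : ∀ p : S, TangentSpace 𝓘(ℂ) p →L[ℂ] ℂ}

lemma unitModulus_coe (c : ℂ) : UnitModulus (c : OnePoint ℂ) ↔ ‖c‖ = 1 := by
  refine ⟨?_, fun h => ⟨c, rfl, h⟩⟩
  rintro ⟨c', hc, h⟩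
  rwa [OnePoint.coe_injective hc]

lemma unitModulus_ratio_one (c : ℂ) : UnitModulus (ratio 1 c) ↔ ‖c‖ = 1 := by
  unfold ratio
  split_ifs with h
  · subst h
    simp only [norm_zero, zero_ne_one, iff_false]
    rintro ⟨c', hc, -⟩
    exact OnePoint.infty_ne_coe _ hc
  · rw [unitModulus_coe, norm_div, norm_one, div_eq_one_iff_eq (norm_ne_zero_iff.2 h), eq_comm]

lemma IsMeromorphicFunction.exists_modulus (hg : IsMeromorphicFunction g) (p : S) :
    ∃ f : ℂ → ℂ, AnalyticAt ℂ f (chartAt ℂ p p) ∧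
      ∀ᶠ q in 𝓝 p, (UnitModulus (g q) ↔ ‖f (chartAt ℂ p q)‖ = 1) := by
  obtain ⟨h, hh, hcase⟩ := hg p
  refine ⟨_, (holAt_iff_analyticAt (mem_chart_source ℂ p)).1 hh, ?_⟩
  rcases hcase with hcase | ⟨-, hcase⟩
  · filter_upwards [hcase, eventually_mem_source p] with q h1 h2
    simp only [Function.comp_apply, (chartAt ℂ p).left_inv h2]
    rw [h1, unitModulus_coe]
  · filter_upwards [hcase, eventually_mem_source p] with q h1 h2
    simp only [Function.comp_apply, (chartAt ℂ p).left_inv h2]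
    rw [h1, unitModulus_ratio_one]

/-- Homogeneous coordinates on the Riemann sphere. -/
def homog (x : OnePoint ℂ) : ℂ × ℂ := x.elim (1, 0) fun c => (c, 1)

@[simp] lemma homog_coe (c : ℂ) : homog (c : OnePoint ℂ) = (c, 1) := rfl

@[simp] lemma homog_infty : homog OnePoint.infty = (1, 0) := rfl

/-- The local pair `(P, Q)` depends on choices. Rescaling it by `l` to the canonical representative
of `g` multiplies the nilpotent matrix by a square, which is absorbed in the scalar `t` of
`exists_matDiff_eq`. -/
lemma exists_smul_homog {P Q : ℂ} (h : P ≠ 0 ∨ Q ≠ 0) :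
    ∃ l : ℂ, l ≠ 0 ∧ P = l * (homog (ratio P Q)).1 ∧ Q = l * (homog (ratio P Q)).2 := by
  unfold ratio
  split_ifs with h0
  · exact ⟨P, by tauto, by simp, by simp [h0]⟩
  · refine ⟨Q, h0, ?_, by simp⟩
    simp
    field_simp

lemma homog_defect_eq_zero_iff (x : OnePoint ℂ) :
    defect (homog x).1 (homog x).2 = 0 ↔ UnitModulus x := by
  induction x using OnePoint.rec with
  | infty =>
    simp only [homog_infty, defect, norm_one, norm_zero]
    norm_num
    rintro ⟨c, hc, -⟩
    exact OnePoint.infty_ne_coe _ hc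
  | coe c =>
    rw [unitModulus_coe]
    simp only [homog_coe, defect, norm_one]
    rw [sub_eq_zero, one_pow, pow_eq_one_iff_of_nonneg (norm_nonneg c) two_ne_zero]

/-- The value of `F⁻¹ dF` at a point, in terms of `g`. -/
lemma exists_matDiff_eq {F : S → Matrix.SpecialLinearGroup (Fin 2) ℂ}
    (hg : IsMeromorphicFunction g) (hη : IsHolomorphicForm η)
    (hρ : HatMetricIsRiemannian g η) (hF : ∀ p, MatHolAt F p) (hs : ∀ p, SolvesAt g η F p) (p : S) :
    ∃ t : ℂ, t ≠ 0 ∧ (∀ v : ℂ, matDiff F p v = (F p).1 * ((v * t) •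
      nilMatrix (homog (g p)).1 (homog (g p)).2)) ∧
      ∀ c : ℂ, g p = (c : OnePoint ℂ) → ∀ v : ℂ, η p v = v * t := by
  obtain ⟨P, Q, θ, hL⟩ := exists_localForm hg hη hρ p
  have h1 := hL.matDiff_eq (hF p) (Filter.Eventually.of_forall hs)
  obtain ⟨hθ, hPQ, hgp, hηp⟩ := hL.eventually.self_of_nhds
  obtain ⟨l, hl, hP, hQ⟩ := exists_smul_homog hPQ
  rw [← hgp] at hP hQ
  refine ⟨θ (chartAt ℂ p p) * l ^ 2, mul_ne_zero hθ (pow_ne_zero 2 hl), fun v => ?_, fun c hc v => ?_⟩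
  · rw [h1]
    congr 1
    ext i j
    fin_cases i <;> fin_cases j <;> simp [nilMatrix, hP, hQ] <;> ring
  · rw [hηp, chartDeriv_self, hQ, hc]
    simp
    ring

/-- Where `g` is finite it is a holomorphic function. -/
lemma IsMeromorphicFunction.finite_near (hg : IsMeromorphicFunction g) {p : S} {c : ℂ}
    (hc : g p = (c : OnePoint ℂ)) : HolAt (fun q => finiteValue (g q)) p ∧
      ∀ᶠ q in 𝓝 p, g q = (finiteValue (g q) : OnePoint ℂ) := by
  have hcongr : ∀ h : S → ℂ, HolAt h p → (∀ᶠ q in 𝓝 p, g q = (h q : OnePoint ℂ)) →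
      HolAt (fun q => finiteValue (g q)) p ∧
      ∀ᶠ q in 𝓝 p, g q = (finiteValue (g q) : OnePoint ℂ) := by
    intro h hh hgh
    have h1 : ∀ᶠ q in 𝓝 p, finiteValue (g q) = h q := hgh.mono fun q hq => by rw [hq]; rfl
    constructor
    · filter_upwards [hh, h1.eventually_nhds] with q h2 h3
      exact h2.congr_of_eventuallyEq h3
    · filter_upwards [hgh, h1] with q h2 h3
      rw [h3, h2]
  obtain ⟨h, hh, hcase | ⟨-, hcase⟩⟩ := hg p
  · exact hcongr h hh hcase
  -- If `1 / g` is the holomorphic function near `p`, it cannot vanish at `p`, since `g p` is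
  -- finite; so it may be inverted.
  · have h0 : h p ≠ 0 := by
      intro h0
      have h1 := hcase.self_of_nhds
      rw [h0, hc, ratio, if_pos rfl] at h1
      exact OnePoint.coe_ne_infty _ h1
    have hne : ∀ᶠ q in 𝓝 p, h q ≠ 0 := (HolAt.mdifferentiableAt hh).continuousAt.eventually_ne h0
    refine hcongr (fun q => 1 / h q) ?_ ?_
    · rw [holAt_iff_analyticAt (mem_chart_source ℂ p)]
      refine analyticAt_const.div ((holAt_iff_analyticAt (mem_chart_source ℂ p)).1 hh) ?_
      simpa [(chartAt ℂ p).left_inv (mem_chart_source ℂ p)] using h0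
    · filter_upwards [hcase, hne] with q h1 h2
      rw [h1, ratio, if_neg h2]

/-- The points where `g` is finite and not of modulus one. -/
def regularSet (g : S → OnePoint ℂ) : Set S := {q | ∃ c : ℂ, g q = (c : OnePoint ℂ) ∧ ‖c‖ ≠ 1}

lemma isOpen_regularSet (hg : IsMeromorphicFunction g) : IsOpen (regularSet g) := by
  rw [isOpen_iff_mem_nhds]
  rintro p ⟨c, hc, hc1⟩
  obtain ⟨h1, h2⟩ := hg.finite_near hc
  have h3 : ‖finiteValue (g p)‖ ≠ 1 := by rw [hc]; exact hc1
  filter_upwards [h2, h1.mdifferentiableAt.continuousAt.norm.eventually_ne h3] with q h4 h5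
  exact ⟨_, h4, h5⟩

/-- On an open set missing the regular set, `|g| = 1` except at poles. Poles are isolated, so
continuity of `1 / g` excludes them too. Unique continuation then makes `|g|` equal to 1 everywhere.
-/
lemma dense_regularSet [PreconnectedSpace S] (hg : IsMeromorphicFunction g)
    (h1 : ¬ ∀ p, UnitModulus (g p)) : Dense (regularSet g) := by
  intro p
  by_contra hp
  have hev : ∀ᶠ q in 𝓝 p, q ∉ regularSet g := by
    have := isClosed_closure.isOpen_compl.mem_nhds hp
    exact Filter.mem_of_superset this fun q hq hq' => hq (subset_closure hq')
  refine h1 (forall_of_eventually (T := fun x => ‖x‖ = 1) eventually_eq_of_norm_eq_one hg.exists_modulus (p₀ := p) ?_)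
  have hps := mem_chart_source ℂ p
  obtain ⟨h, hh, hcase | ⟨hfreq, hcase⟩⟩ := hg p
  · filter_upwards [hev, hcase] with q h2 h3
    by_contra h4
    rw [h3, unitModulus_coe] at h4
    exact h2 ⟨_, h3, h4⟩
  · have hhan := (holAt_iff_analyticAt hps).1 hh
    have hne : ∀ᶠ z in 𝓝[≠] (chartAt ℂ p p), (h ∘ (chartAt ℂ p).symm) z ≠ 0 := by
      rcases hhan.eventually_eq_zero_or_eventually_ne_zero with h0 | h0
      · refine absurd ((eventually_nhds_iff_chart (P := fun q => h q = 0) hps).2 h0) fun h1 => ?_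
        exact hfreq (h1.mono fun q hq => not_not.2 hq)
      · exact h0
    have h2 : ∀ᶠ z in 𝓝[≠] (chartAt ℂ p p), ‖(h ∘ (chartAt ℂ p).symm) z‖ = 1 := by
      filter_upwards [hne, nhdsWithin_le_nhds (eventually_chart_symm hev),
        nhdsWithin_le_nhds (eventually_chart_symm hcase)] with z h3 h4 h5
      by_contra h6
      simp only [Function.comp_apply] at h3 h6
      refine h4 ⟨1 / h ((chartAt ℂ p).symm z), by rw [h5, ratio, if_neg h3], ?_⟩
      rw [norm_div, norm_one, ne_eq, div_eq_one_iff_eq (norm_ne_zero_iff.2 h3)]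
      exact fun h7 => h6 h7.symm
    have h3 : ‖(h ∘ (chartAt ℂ p).symm) (chartAt ℂ p p)‖ = 1 := by
      refine tendsto_nhds_unique
        (hhan.continuousAt.norm.tendsto.mono_left nhdsWithin_le_nhds : Filter.Tendsto _
          (𝓝[≠] (chartAt ℂ p p)) _) ?_
      exact tendsto_const_nhds.congr' (h2.mono fun z hz => hz.symm)
    have h4 : ∀ᶠ z in 𝓝 (chartAt ℂ p p), ‖(h ∘ (chartAt ℂ p).symm) z‖ = 1 := by
      filter_upwards [eventually_nhdsWithin_iff.1 h2] with z hz
      by_cases hz' : z = chartAt ℂ p p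
      · rw [hz', h3]
      · exact hz hz'
    filter_upwards [hcase, eventually_chart h4, eventually_mem_source p] with q h5 h6 h7
    rw [h5, unitModulus_ratio_one]
    simpa [(chartAt ℂ p).left_inv h7] using h6

end Data

/-! ### The face of Weierstrass data: second fundamental form, admissibility, Gauss map -/

section FaceOfData

variable {S : Type*} [TopologicalSpace S] [ChartedSpace ℂ S] [IsManifold 𝓘(ℂ) ω S]
  {g : S → OnePoint ℂ} {η : ∀ p : S, TangentSpace 𝓘(ℂ) p →L[ℂ] ℂ}
  {F : S → Matrix.SpecialLinearGroup (Fin 2) ℂ} {p : S} {t : ℂ}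

lemma contMDiffAt_faceOf (hF : MatHolAt F p) (n : WithTop ℕ∞) :
    ContMDiffAt 𝓘(ℝ, ℂ) 𝓘(ℝ, L4) n (faceOf F) p := by
  have h1 : ∀ j, ContMDiffAt 𝓘(ℝ, ℂ) 𝓘(ℝ, ℂ × ℂ) n (colVec F j) p := fun j =>
    ((hF 0 j).contMDiffAt n).prodMk_space ((hF 1 j).contMDiffAt n)
  have h2 : ContDiff ℝ n fun x : ℂ × ℂ => (1 / 2 : ℝ) • hermProd x x :=
    ((hermProdL.contDiff).clm_apply contDiff_id).const_smul (1 / 2 : ℝ)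
  have h3 : faceOf F = fun q => (1 / 2 : ℝ) • hermProd (colVec F 0 q) (colVec F 0 q) -
      (1 / 2 : ℝ) • hermProd (colVec F 1 q) (colVec F 1 q) := funext (faceOf_eq F)
  rw [h3]
  exact (h2.contDiffAt.comp_contMDiffAt (h1 0)).sub (h2.contDiffAt.comp_contMDiffAt (h1 1))

/-- The oriented unit normal of the face. -/
def faceNormal (g : S → OnePoint ℂ) (F : S → Matrix.SpecialLinearGroup (Fin 2) ℂ) (q : S) : L4 :=
  normalVec F (homog (g q)).1 (homog (g q)).2 q

/-- The metric is a conformal factor times `|dz|²`, with the factor `t` nonzero; it degenerates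
exactly at the zeros of the defect. -/
lemma isSingularPoint_faceOf_iff (hF : MatHolAt F p) (ht : t ≠ 0) (hd : ∀ v : ℂ, matDiff F p v =
    (F p).1 * ((v * t) • nilMatrix (homog (g p)).1 (homog (g p)).2)) :
    IsSingularPoint (faceOf F) p ↔ UnitModulus (g p) := by
  have hm := inducedMetric_faceOf hF hd
  rw [← homog_defect_eq_zero_iff]
  constructor
  · have key : ∀ v : ℂ, v ≠ 0 → inducedMetric (faceOf F) p v v = 0 →
        defect (homog (g p)).1 (homog (g p)).2 = 0 := by
      intro v hv h
      have h1 := hm v v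
      rw [h, Complex.mul_conj, Complex.ofReal_re] at h1
      have h2 : v * t ≠ 0 := mul_ne_zero hv ht
      have h3 := (mul_eq_zero.1 h1.symm).resolve_right (Complex.normSq_pos.2 h2).ne'
      exact pow_eq_zero_iff two_ne_zero |>.1 h3
    rintro ⟨v, hv, h⟩
    exact key v hv (h v)
  · intro h0
    refine ⟨(1 : ℂ), one_ne_zero (α := ℂ), fun w => ?_⟩
    refine (hm 1 w).trans ?_
    rw [h0]
    simp

lemma inducedMetric_faceOf' (hF : MatHolAt F p) (hd : ∀ v : ℂ, matDiff F p v =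
    (F p).1 * ((v * t) • nilMatrix (homog (g p)).1 (homog (g p)).2)) (v w : ℂ) :
    inducedMetric (faceOf F) p v w =
      defect (homog (g p)).1 (homog (g p)).2 ^ 2 * ‖t‖ ^ 2 * (v * conj w).re := by
  rw [inducedMetric_faceOf hF hd, ← Complex.normSq_eq_norm_sq, Complex.normSq_apply]
  simp
  ring

-- Write `N = s ξ ξ^* - f`, up to a constant in the scalar `s`, with `ξ = F (g, 1)`. The term `-f`
-- contributes `ds²`. Since `F'` annihilates the direction `(g, 1)`, the derivative of `ξ` is `g'`
-- times the first column of `F`, and pairing with `df` yields `2 Re (ω dg)`.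
set_option maxHeartbeats 1000000 in
lemma secondForm_faceOf (hF : MatHolAt F p) (hg : IsMeromorphicFunction g) {c : ℂ}
    (hd : ∀ v : ℂ, matDiff F p v =
      (F p).1 * ((v * t) • nilMatrix (homog (g p)).1 (homog (g p)).2))
    (hc : g p = (c : OnePoint ℂ)) (hc1 : ‖c‖ ≠ 1) (v w : ℂ) :
    secondForm (faceOf F) (faceNormal g F) p v w =
      2 * (v * t * complexDiff (fun q => finiteValue (g q)) p w).re +
        inducedMetric (faceOf F) p v w := by
  have hp := mem_chart_source ℂ p
  obtain ⟨k, hk⟩ : ∃ k : S → ℂ, k = fun q => finiteValue (g q) := ⟨_, rfl⟩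
  obtain ⟨hkhol, hkg⟩ : HolAt k p ∧ ∀ᶠ q in 𝓝 p, g q = (k q : OnePoint ℂ) := by
    rw [hk]
    exact hg.finite_near hc
  have hkp : k p = c := by
    rw [hk]
    simp only [hc]
    rfl
  rw [← hk]
  rw [hc, homog_coe] at hd
  have hδ : defect c 1 ≠ 0 := by
    intro h
    have := (homog_defect_eq_zero_iff (c : OnePoint ℂ)).1 h
    exact hc1 ((unitModulus_coe c).1 this)
  have hkd := ((holAt_iff_analyticAt hp).1 hkhol).differentiableAt.hasDerivAt
  set k' := deriv (k ∘ (chartAt ℂ p).symm) (chartAt ℂ p p) with hk'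
  obtain ⟨h0, h1⟩ := hasDerivAt_colVec hF hd
  -- the null direction and the scalar factor, near `p`
  have hξ : HasDerivAt (fun z => dirVec F (k ((chartAt ℂ p).symm z)) 1 ((chartAt ℂ p).symm z))
      (k' • colVec F 0 p) (chartAt ℂ p p) := by
    have h2 := (hkd.smul h0).add h1
    have h3 : (fun z => dirVec F (k ((chartAt ℂ p).symm z)) 1 ((chartAt ℂ p).symm z)) =
        (k ∘ (chartAt ℂ p).symm) • (fun z => colVec F 0 ((chartAt ℂ p).symm z)) +
          fun z => colVec F 1 ((chartAt ℂ p).symm z) := by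
      funext z
      simp [dirVec]
    rw [h3]
    refine h2.congr_deriv ?_
    simp only [Function.comp_apply, (chartAt ℂ p).left_inv hp, hkp, mul_one]
    generalize dirVec F c 1 p = u
    ext <;> simp <;> ring
  obtain ⟨Lh, hLh, hLhv⟩ := exists_hasFDerivAt_hermProd hξ hξ
  -- Only the existence of the derivative of the scalar factor matters: it multiplies `ξ ξ^*`, which
  -- is orthogonal to `df`.
  have hs : ∃ Ls : ℂ →L[ℝ] ℝ, HasFDerivAt
      (fun z => 1 / defect (k ((chartAt ℂ p).symm z)) 1) Ls (chartAt ℂ p p) := by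
    have h2 : DifferentiableAt ℝ (k ∘ (chartAt ℂ p).symm) (chartAt ℂ p p) :=
      hkd.differentiableAt.restrictScalars ℝ
    have h3 : DifferentiableAt ℝ (fun z => defect (k ((chartAt ℂ p).symm z)) 1)
        (chartAt ℂ p p) := (h2.norm_sq ℝ).sub (differentiableAt_const _)
    have h4 : defect (k ((chartAt ℂ p).symm (chartAt ℂ p p))) 1 ≠ 0 := by
      rwa [(chartAt ℂ p).left_inv hp, hkp]
    simp only [one_div]
    exact ⟨_, (DifferentiableAt.fun_inv h3 h4).hasFDerivAt⟩
  obtain ⟨Ls, hLs⟩ := hs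
  have hf := (mdifferentiableAt_iff_chart hp).1 (diff_faceOf hF hd).1
  have hN := (hLs.smul hLh).sub hf.hasFDerivAt
  have hNeq : faceNormal g F ∘ (chartAt ℂ p).symm =ᶠ[𝓝 (chartAt ℂ p p)]
      (fun z => 1 / defect (k ((chartAt ℂ p).symm z)) 1) • (fun z =>
        hermProd (dirVec F (k ((chartAt ℂ p).symm z)) 1 ((chartAt ℂ p).symm z))
          (dirVec F (k ((chartAt ℂ p).symm z)) 1 ((chartAt ℂ p).symm z))) -
        faceOf F ∘ (chartAt ℂ p).symm := by
    have hδ' : ∀ᶠ q in 𝓝 p, ‖k q‖ ≠ 1 := by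
      refine hkhol.mdifferentiableAt.continuousAt.norm.eventually_ne ?_
      rwa [hkp]
    filter_upwards [eventually_chart_symm hkg, eventually_chart_symm hδ'] with z h2 h3
    have h4 : defect (k ((chartAt ℂ p).symm z)) 1 ≠ 0 := by
      intro h
      have := (homog_defect_eq_zero_iff (k ((chartAt ℂ p).symm z) : OnePoint ℂ)).1 h
      exact h3 ((unitModulus_coe _).1 this)
    have h5 := faceOf_add_normalVec (F := F) h4 ((chartAt ℂ p).symm z)
    simp only [Function.comp_apply, faceNormal, Pi.sub_apply, Pi.smul_apply', ← h5]
    rw [h2, homog_coe]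
    abel
  have hdN := tderiv_eq_of_hasFDerivAt (hN.congr_of_eventuallyEq hNeq)
  have hfd : fderiv ℝ (faceOf F ∘ (chartAt ℂ p).symm) (chartAt ℂ p p) v =
      diff (faceOf F) p v := by
    rw [diff_eq_tderiv, tderiv_eq_of_hasFDerivAt hf.hasFDerivAt]
  have hδu := pairDet_dirVec_conj F c 1 p
  have hδw := pairDet_dirVec_conj' F c 1 p
  have hcol : pairDet (colVec F 0 p) (dirVec F c 1 p) = 1 := by
    have := pairDet_dirVec F 1 0 c 1 p
    simpa [dirVec] using this
  rw [complexDiff_eq_deriv_self hkhol.mdifferentiableAt, ← hk']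
  change -lorentz (tderiv ℝ (faceNormal g F) p v) (diff (faceOf F) p w) = _
  rw [hdN]
  simp only [add_apply, sub_apply, smul_apply, ContinuousLinearMap.smulRight_apply, hLhv, hfd,
    (chartAt ℂ p).left_inv hp, hkp, lorentz_sub_left, lorentz_add_left, lorentz_smul_left]
  rw [show lorentz (diff (faceOf F) p v) (diff (faceOf F) p w) =
    inducedMetric (faceOf F) p v w from rfl, (diff_faceOf hF hd).2 w]
  simp only [lorentz_hermProd, pairDet_smul_left, pairDet_smul_right, pairDet_self, hδu, hcol]
  simp
  field_simp
  ring

omit [IsManifold 𝓘(ℂ) ω S] in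
lemma complexDiff_one_mul (h : S → ℂ) (p : S) (w : ℂ) :
    complexDiff h p w = complexDiff h p (1 : ℂ) * w := clm_apply_eq_mul _ _

/-- The face of Weierstrass data is an oriented CMC 1 immersion on the regular set. -/
lemma isSpacelikeCMC1On_regularSet (hg : IsMeromorphicFunction g)
    (hF : ∀ p, MatHolAt F p) (hd : ∀ p, ∃ t : ℂ, t ≠ 0 ∧ ∀ v : ℂ, matDiff F p v =
      (F p).1 * ((v * t) • nilMatrix (homog (g p)).1 (homog (g p)).2)) :
    IsSpacelikeCMC1On (faceOf F) (regularSet g) := by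
  have hδ : ∀ p ∈ regularSet g, defect (homog (g p)).1 (homog (g p)).2 ≠ 0 := by
    rintro p ⟨c, hc, hc1⟩ h
    rw [homog_defect_eq_zero_iff, hc, unitModulus_coe] at h
    exact hc1 h
  constructor
  · intro p hp
    obtain ⟨t, ht, hdp⟩ := hd p
    have key : ∀ v : ℂ, v ≠ 0 → 0 < inducedMetric (faceOf F) p v v := by
      intro v hv
      rw [inducedMetric_faceOf' (hF p) hdp v v, Complex.mul_conj, Complex.ofReal_re]
      have h1 := Complex.normSq_pos.2 hv
      have h2 := hδ p hp
      have h3 := norm_pos_iff.2 ht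
      positivity
    exact key
  · refine ⟨faceNormal g F, fun p hp => ?_⟩
    obtain ⟨t, ht, hdp⟩ := hd p
    refine ⟨isOrientedUnitNormal_normalVec (hF p) hdp ht (hδ p hp), ?_⟩
    obtain ⟨c, hc, hc1⟩ := hp
    have hII := secondForm_faceOf (hF p) hg hdp hc hc1
    have hI := inducedMetric_faceOf' (hF p) hdp
    have hδp : defect (homog (g p)).1 (homog (g p)).2 ≠ 0 := hδ p ⟨c, hc, hc1⟩
    have h3 := norm_pos_iff.2 ht
    -- The form `Re (ω dg)` changes sign between the arguments `(1, 1)` and `(i, i)`, so it is trace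
    -- free for a conformal metric. The summand `ds²` alone gives mean curvature 1.
    unfold meanCurvature
    rw [hII, hII, hII, hI, hI, hI, complexDiff_one_mul _ p Complex.I]
    simp
    field_simp
    ring

/-- On the open set where `g` is finite, the multiplier `(1 - |g|²)⁻²` cancels the degenerate factor
of `ds²` and leaves `|ω|²`, a smooth metric because `ω` has no zeros there. That `df` does not
vanish when `|g| = 1` follows from `df` being a nonzero multiple of `u u^*` in a suitable direction.
-/
lemma isAdmissible_faceOf (hg : IsMeromorphicFunction g) (hη : IsHolomorphicForm η)
    (hF : ∀ p, MatHolAt F p) (hd : ∀ p, ∃ t : ℂ, t ≠ 0 ∧ (∀ v : ℂ, matDiff F p v =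
      (F p).1 * ((v * t) • nilMatrix (homog (g p)).1 (homog (g p)).2)) ∧
      ∀ c : ℂ, g p = (c : OnePoint ℂ) → ∀ v : ℂ, η p v = v * t) (hp : UnitModulus (g p)) :
    IsAdmissible (faceOf F) (regularSet g) p := by
  constructor
  · refine ⟨{q | ∃ c : ℂ, g q = (c : OnePoint ℂ)}, ?_, ?_,
      fun q => ((defect (finiteValue (g q)) 1) ^ 2)⁻¹, ?_, ?_,
      fun q v w => ((η q v : ℂ) * conj (η q w : ℂ)).re, ⟨?_, ?_⟩, ?_⟩
    · rw [isOpen_iff_mem_nhds]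
      rintro q ⟨c, hc⟩
      exact (hg.finite_near hc).2.mono fun x hx => ⟨_, hx⟩
    · obtain ⟨c, hc, -⟩ := hp
      exact ⟨c, hc⟩
    · rintro q ⟨-, c, hc, hc1⟩
      have h1 : defect c 1 ≠ 0 := by
        intro h
        exact hc1 ((unitModulus_coe c).1 ((homog_defect_eq_zero_iff (c : OnePoint ℂ)).1 h))
      have h2 : finiteValue (g q) = c := by rw [hc]; rfl
      simp only [h2]
      positivity
    · rintro q ⟨-, c, hc, hc1⟩
      have h1 : defect c 1 ≠ 0 := by
        intro h
        exact hc1 ((unitModulus_coe c).1 ((homog_defect_eq_zero_iff (c : OnePoint ℂ)).1 h))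
      have h2 := (hg.finite_near hc).1.contMDiffAt 1
      refine ContMDiffAt.contMDiffWithinAt ?_
      have h3 : ContDiffAt ℝ 1 (fun x : ℂ => ((defect x 1) ^ 2)⁻¹) (finiteValue (g q)) := by
        refine ContDiffAt.inv ?_ ?_
        · exact (((contDiff_id.norm_sq ℝ).sub contDiff_const).pow 2).contDiffAt
        · rw [hc]
          exact pow_ne_zero 2 h1
      exact ContDiffAt.comp_contMDiffAt (g := fun x : ℂ => ((defect x 1) ^ 2)⁻¹)
        (f := fun q => finiteValue (g q)) h3 h2
    · rintro q ⟨c, hc⟩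
      obtain ⟨t, ht, -, hηt⟩ := hd q
      have key : ∀ v : ℂ, v ≠ 0 → 0 < ((η q v : ℂ) * conj (η q v : ℂ)).re := by
        intro v hv
        rw [hηt c hc v, Complex.mul_conj, Complex.ofReal_re]
        exact Complex.normSq_pos.2 (mul_ne_zero hv ht)
      exact key
    · rintro q -
      obtain ⟨a, ha, haη⟩ := hη.exists_coeff q
      have h1 : ContMDiffAt 𝓘(ℝ, ℂ) 𝓘(ℝ) 1 (fun x => ‖a x‖ ^ 2) q :=
        ((contDiff_id.norm_sq ℝ).contDiffAt (n := 1) (x := a q)).comp_contMDiffAt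
          (ha.contMDiffAt 1)
      refine ⟨fun x => ‖a x‖ ^ 2, fun _ => 0, fun x => ‖a x‖ ^ 2, h1, contMDiffAt_const, h1, ?_⟩
      filter_upwards [haη, eventually_mem_source q] with x hx hxs
      have key : ∀ v w : ℂ, ((η x v : ℂ) * conj (η x w : ℂ)).re =
          ‖a x‖ ^ 2 * ((tderiv ℝ (chartAt ℂ q) x v).re * (tderiv ℝ (chartAt ℂ q) x w).re) +
          0 * ((tderiv ℝ (chartAt ℂ q) x v).re * (tderiv ℝ (chartAt ℂ q) x w).im +
            (tderiv ℝ (chartAt ℂ q) x v).im * (tderiv ℝ (chartAt ℂ q) x w).re) +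
          ‖a x‖ ^ 2 * ((tderiv ℝ (chartAt ℂ q) x v).im * (tderiv ℝ (chartAt ℂ q) x w).im) := by
        intro v w
        rw [hx v, hx w, tderiv_real_chart hxs, tderiv_real_chart hxs,
          ← Complex.normSq_eq_norm_sq, Complex.normSq_apply]
        generalize chartDeriv q x * v = y, chartDeriv q x * w = y'
        simp
        ring
      exact key
    · rintro q ⟨-, c, hc, hc1⟩
      obtain ⟨t, ht, hdt, hηt⟩ := hd q
      have h1 : defect c 1 ≠ 0 := by
        intro h
        exact hc1 ((unitModulus_coe c).1 ((homog_defect_eq_zero_iff (c : OnePoint ℂ)).1 h))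
      have key : ∀ v w : ℂ, ((η q v : ℂ) * conj (η q w : ℂ)).re =
          ((defect (finiteValue (g q)) 1) ^ 2)⁻¹ * inducedMetric (faceOf F) q v w := by
        intro v w
        have h2 : finiteValue (g q) = c := by rw [hc]; rfl
        rw [inducedMetric_faceOf (hF q) hdt v w, hηt c hc v, hηt c hc w, h2, hc, homog_coe]
        field_simp
      exact key
  · obtain ⟨t, ht, hdt, -⟩ := hd p
    obtain ⟨c, hc, hc1⟩ := hp
    have hcc : c * conj c = 1 := by
      rw [Complex.mul_conj, Complex.normSq_eq_norm_sq, hc1]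
      simp
    have hc0 : c ≠ 0 := left_ne_zero_of_mul_eq_one hcc
    rw [hc, homog_coe] at hdt
    -- Here `w = c̄ u`, so `df v` is the Hermitian product of `c v t u` with `u`; this choice of `v`
    -- turns it into that of `u` with itself. Its time component is the squared norm of `u`.
    refine ⟨((t * c)⁻¹ : ℂ), fun h => ?_⟩
    have h1 : dirVec F (conj 1) (conj c) p = conj c • dirVec F c 1 p := by
      simp only [dirVec, map_one, smul_add, smul_smul, mul_one]
      rw [mul_comm, hcc]
    have h2 : (t * c)⁻¹ * t = c⁻¹ := by field_simp
    have h3 := (diff_faceOf (hF p) hdt).2 ((t * c)⁻¹)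
    rw [h1, h2, ← hermProd_complex_smul, smul_smul, mul_inv_cancel₀ hc0, one_smul] at h3
    have h4 : hermProd (dirVec F c 1 p) (dirVec F c 1 p) = 0 := h3.symm.trans h
    have h5 := congrFun h4 0
    have h6 := pairDet_dirVec F 1 0 c 1 p
    generalize dirVec F c 1 p = u at h5 h6
    simp [hermProd] at h5
    have h7 : u.1.re = 0 := by nlinarith [sq_nonneg u.1.re, sq_nonneg u.1.im, sq_nonneg u.2.re, sq_nonneg u.2.im]
    have h8 : u.1.im = 0 := by nlinarith [sq_nonneg u.1.re, sq_nonneg u.1.im, sq_nonneg u.2.re, sq_nonneg u.2.im]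
    have h9 : u.2.re = 0 := by nlinarith [sq_nonneg u.1.re, sq_nonneg u.1.im, sq_nonneg u.2.re, sq_nonneg u.2.im]
    have h10 : u.2.im = 0 := by nlinarith [sq_nonneg u.1.re, sq_nonneg u.1.im, sq_nonneg u.2.re, sq_nonneg u.2.im]
    have h11 : u.1 = 0 := Complex.ext h7 h8
    have h12 : u.2 = 0 := Complex.ext h9 h10
    simp [pairDet, h11, h12] at h6

end FaceOfData

lemma ratio_mul_left {k : ℂ} (hk : k ≠ 0) (a b : ℂ) : ratio (k * a) (k * b) = ratio a b := by
  unfold ratio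
  by_cases hb : b = 0
  · simp [hb]
  · rw [if_neg hb, if_neg (mul_ne_zero hk hb), mul_div_mul_left _ _ hk]

section FaceOfData

variable {S : Type*} [TopologicalSpace S] [ChartedSpace ℂ S]
  {g : S → OnePoint ℂ} {η : ∀ p : S, TangentSpace 𝓘(ℂ) p →L[ℂ] ℂ}
  {F : S → Matrix.SpecialLinearGroup (Fin 2) ℂ} {p : S} {t : ℂ}

omit [TopologicalSpace S] [ChartedSpace ℂ S] in
/-- The null line spanned by a multiple of `u u^*` is the point `u₁ / u₂` of the sphere. -/
lemma hyperbolicGaussMap_eq_ratio {f N : S → L4} {k : ℝ} (hk : k ≠ 0) {u : ℂ × ℂ}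
    (h : f p + N p = k • hermProd u u) : hyperbolicGaussMap f N p = ratio u.1 u.2 := by
  have h01 : (hermEquiv (f p + N p)).1 0 1 = 2 * k * conj u.2 * u.1 := by
    rw [h]
    apply Complex.ext <;> simp [hermEquiv, hermProd] <;> ring
  have h11 : (hermEquiv (f p + N p)).1 1 1 = 2 * k * conj u.2 * u.2 := by
    rw [h]
    apply Complex.ext <;> simp [hermEquiv, hermProd] <;> ring
  unfold hyperbolicGaussMap
  simp only [h01, h11]
  by_cases hu : u.2 = 0
  · simp [ratio, hu]
  · have hk' : (k : ℂ) ≠ 0 := Complex.ofReal_ne_zero.2 hk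
    exact ratio_mul_left (mul_ne_zero (mul_ne_zero two_ne_zero hk')
      ((map_ne_zero _).2 hu)) _ _

/-- `dF` has rank one with image spanned by `u = F (P, Q)`. Every column with a nonzero entry
therefore has the same ratio `u₁ / u₂`. -/
lemma matDiff_apply_eq {P Q : ℂ} {v : ℂ}
    (hd : matDiff F p v = (F p).1 * ((v * t) • nilMatrix P Q)) (j : Fin 2) :
    matDiff F p v 0 j = (v * t * ![Q, -P] j) * (dirVec F P Q p).1 ∧
      matDiff F p v 1 j = (v * t * ![Q, -P] j) * (dirVec F P Q p).2 := by
  rw [hd]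
  fin_cases j <;> constructor <;>
    simp [Matrix.mul_apply, Fin.sum_univ_two, nilMatrix, dirVec, colVec] <;> ring

theorem isCMC1Face_faceOf [IsManifold 𝓘(ℂ) ω S] [PreconnectedSpace S] (hW : IsWeierstrassData g η)
    (hFi : IsHolomorphicImmersion F) (hFs : SolvesWeierstrass g η F) :
    IsCMC1Face (faceOf F) ∧
    (∀ p, ¬ IsSingularPoint (faceOf F) p → IsConformalAt (faceOf F) p) ∧
    (∀ (p : S) (c : ℂ), g p = (c : OnePoint ℂ) → ∀ v w : TangentSpace 𝓘(ℝ, ℂ) p,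
      inducedMetric (faceOf F) p v w
        = (1 - ‖c‖ ^ 2) ^ 2 * (η p v * conj (η p w)).re) ∧
    (∃ N : S → L4,
      (∀ p, ¬ IsSingularPoint (faceOf F) p → IsOrientedUnitNormal (faceOf F) p (N p)) ∧
      (∀ (p : S) (c : ℂ), ¬ IsSingularPoint (faceOf F) p → g p = (c : OnePoint ℂ) →
        ∀ v w : TangentSpace 𝓘(ℝ, ℂ) p,
          let Q : ℂ := η p v * complexDiff (fun q => finiteValue (g q)) p w
          ((secondForm (faceOf F) N p v w : ℝ) : ℂ)
            = Q + conj Q + ((inducedMetric (faceOf F) p v w : ℝ) : ℂ)) ∧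
      (∀ p, ¬ IsSingularPoint (faceOf F) p → ∀ (j : Fin 2) (v : TangentSpace 𝓘(ℂ) p),
        (matDiff F p v 0 j ≠ 0 ∨ matDiff F p v 1 j ≠ 0) →
          hyperbolicGaussMap (faceOf F) N p
            = ratio (matDiff F p v 0 j) (matDiff F p v 1 j))) ∧
    (∀ p, IsSingularPoint (faceOf F) p ↔ UnitModulus (g p)) := by
  obtain ⟨hg, hη, hρ, h1⟩ := hW
  have hF : ∀ p, MatHolAt F p := hFi.matHolAt
  have hd := exists_matDiff_eq hg hη hρ hF hFs.solvesAt
  have hsing : ∀ p, IsSingularPoint (faceOf F) p ↔ UnitModulus (g p) := fun p => by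
    obtain ⟨t, ht, hdt, -⟩ := hd p
    exact isSingularPoint_faceOf_iff (hF p) ht hdt
  have hδ : ∀ p, ¬ IsSingularPoint (faceOf F) p → defect (homog (g p)).1 (homog (g p)).2 ≠ 0 :=
    fun p hp h => hp ((hsing p).2 ((homog_defect_eq_zero_iff _).1 h))
  refine ⟨⟨fun p => contMDiffAt_faceOf (hF p) _, fun p => faceOf_mem_deSitter F p,
    regularSet g, isOpen_regularSet hg, dense_regularSet hg h1, ?_, ?_⟩, ?_, ?_,
    ⟨faceNormal g F, ?_, ?_, ?_⟩, hsing⟩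
  · refine isSpacelikeCMC1On_regularSet hg hF fun p => ?_
    obtain ⟨t, ht, hdt, -⟩ := hd p
    exact ⟨t, ht, hdt⟩
  · exact fun p hp => isAdmissible_faceOf hg hη hF hd ((hsing p).1 hp)
  · intro p hp
    obtain ⟨t, ht, hdt, -⟩ := hd p
    have hδp := hδ p hp
    have ht' := norm_pos_iff.2 ht
    exact ⟨_, by positivity, inducedMetric_faceOf' (hF p) hdt⟩
  · intro p c hc
    obtain ⟨t, ht, hdt, hηt⟩ := hd p
    have key : ∀ v w : ℂ, inducedMetric (faceOf F) p v w
        = (1 - ‖c‖ ^ 2) ^ 2 * ((η p v : ℂ) * conj (η p w : ℂ)).re := by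
      intro v w
      rw [inducedMetric_faceOf (hF p) hdt, hηt c hc v, hηt c hc w, hc, homog_coe, defect,
        norm_one]
      ring
    exact key
  · intro p hp
    obtain ⟨t, ht, hdt, -⟩ := hd p
    exact isOrientedUnitNormal_normalVec (hF p) hdt ht (hδ p hp)
  · intro p c hp hc
    obtain ⟨t, ht, hdt, hηt⟩ := hd p
    have hc1 : ‖c‖ ≠ 1 := fun h => hp ((hsing p).2 ⟨c, hc, h⟩)
    have key : ∀ v w : ℂ, ((secondForm (faceOf F) (faceNormal g F) p v w : ℝ) : ℂ)
        = (η p v : ℂ) * complexDiff (fun q => finiteValue (g q)) p w +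
          conj ((η p v : ℂ) * complexDiff (fun q => finiteValue (g q)) p w) +
          ((inducedMetric (faceOf F) p v w : ℝ) : ℂ) := by
      intro v w
      rw [secondForm_faceOf (hF p) hg hdt hc hc1, hηt c hc v, Complex.add_conj]
      push_cast
      ring
    exact key
  · intro p hp j
    obtain ⟨t, ht, hdt, -⟩ := hd p
    have key : ∀ v : ℂ, (matDiff F p v 0 j ≠ 0 ∨ matDiff F p v 1 j ≠ 0) →
        hyperbolicGaussMap (faceOf F) (faceNormal g F) p =
          ratio (matDiff F p v 0 j) (matDiff F p v 1 j) := by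
      intro v hv
      obtain ⟨h0, h1⟩ := matDiff_apply_eq (hdt v) j
      rw [h0, h1] at hv ⊢
      have hk : v * t * ![(homog (g p)).2, -(homog (g p)).1] j ≠ 0 := by
        rcases hv with hv | hv <;> exact left_ne_zero_of_mul hv
      rw [ratio_mul_left hk]
      exact hyperbolicGaussMap_eq_ratio (one_div_ne_zero (hδ p hp))
        (faceOf_add_normalVec (hδ p hp) p)
    exact key

end FaceOfData

/-! ### Algebra of Hermitian matrices and conformal frames -/

/-- The Hermitian matrix of a vector of Lorentz space. -/
def herm (x : L4) : Matrix (Fin 2) (Fin 2) ℂ :=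
  !![(x 0 + x 3 : ℂ), x 1 + Complex.I * x 2; x 1 - Complex.I * x 2, x 0 - x 3]

lemma herm_add (x y : L4) : herm (x + y) = herm x + herm y := by
  ext i j
  fin_cases i <;> fin_cases j <;> simp [herm] <;> ring

lemma herm_smul (c : ℝ) (x : L4) : herm (c • x) = (c : ℂ) • herm x := by
  ext i j
  fin_cases i <;> fin_cases j <;> simp [herm] <;> ring

/-- In size two the adjugate is linear in the entries. It serves as a differentiable substitute for
the inverse, from which it differs by a sign on de Sitter space. -/
lemma adjugate_add_two (A B : Matrix (Fin 2) (Fin 2) ℂ) :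
    (A + B).adjugate = A.adjugate + B.adjugate := by
  ext i j
  fin_cases i <;> fin_cases j <;> simp [Matrix.adjugate_fin_two] <;> ring

lemma adjugate_smul_two (c : ℂ) (A : Matrix (Fin 2) (Fin 2) ℂ) :
    (c • A).adjugate = c • A.adjugate := by
  ext i j
  fin_cases i <;> fin_cases j <;> simp [Matrix.adjugate_fin_two]

/-- The Clifford relation: it polarises the identity `X adj X = det X`, where `det X` is minus the
Lorentz square. -/
lemma herm_mul_adjugate_add (x y : L4) :
    herm x * (herm y).adjugate + herm y * (herm x).adjugate =
      (-2 * lorentz x y : ℂ) • (1 : Matrix (Fin 2) (Fin 2) ℂ) := by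
  ext i j
  fin_cases i <;> fin_cases j <;>
    simp [herm, Matrix.adjugate_fin_two, lorentz] <;>
    ring_nf <;> simp <;> ring

lemma herm_mul_adjugate_self (x : L4) : herm x * (herm x).adjugate =
    (-lorentz x x : ℂ) • (1 : Matrix (Fin 2) (Fin 2) ℂ) := by
  have h := herm_mul_adjugate_add x x
  rw [← two_smul ℂ, show (-2 * lorentz x x : ℂ) = 2 * -lorentz x x by ring, mul_smul] at h
  exact smul_right_injective _ (two_ne_zero (α := ℂ)) h

/-- The vector product of three vectors of Lorentz space. -/
def tripleProd (a b x : L4) : L4 :=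
  ![-(a 1 * (b 2 * x 3 - b 3 * x 2) - a 2 * (b 1 * x 3 - b 3 * x 1) +
      a 3 * (b 1 * x 2 - b 2 * x 1)),
    -(a 0 * (b 2 * x 3 - b 3 * x 2) - a 2 * (b 0 * x 3 - b 3 * x 0) +
      a 3 * (b 0 * x 2 - b 2 * x 0)),
    a 0 * (b 1 * x 3 - b 3 * x 1) - a 1 * (b 0 * x 3 - b 3 * x 0) +
      a 3 * (b 0 * x 1 - b 1 * x 0),
    -(a 0 * (b 1 * x 2 - b 2 * x 1) - a 1 * (b 0 * x 2 - b 2 * x 0) +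
      a 2 * (b 0 * x 1 - b 1 * x 0))]

lemma lorentz_tripleProd (a b x y : L4) :
    lorentz (tripleProd a b x) y = (Matrix.of ![y, a, b, x]).det := by
  rw [Matrix.det_succ_row_zero]
  simp [Fin.sum_univ_succ, Matrix.det_fin_three, Fin.succAbove, lorentz, tripleProd]
  ring

/-- A Clifford product of three vectors splits into a vector part, made of inner products, and `-i`
times their vector product. The normal enters Hermitian matrix algebra through the second part. -/
lemma herm_mul_adjugate_mul (a b x : L4) : herm a * (herm b).adjugate * herm x =
    -((lorentz a b : ℂ) • herm x + (lorentz b x : ℂ) • herm a - (lorentz a x : ℂ) • herm b) -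
      Complex.I • herm (tripleProd a b x) := by
  ext i j
  fin_cases i <;> fin_cases j <;> apply Complex.ext <;>
    simp [herm, Matrix.adjugate_fin_two, Matrix.mul_apply, Fin.sum_univ_two, lorentz,
      tripleProd] <;> ring

/-- The four vectors form a basis and the Lorentz form is nondegenerate; lowering the index of `y`
turns the hypotheses into a linear system with invertible matrix. -/
lemma eq_zero_of_lorentz_eq_zero {n a b x y : L4} (hD : (Matrix.of ![n, a, b, x]).det ≠ 0)
    (hn : lorentz y n = 0) (ha : lorentz y a = 0) (hb : lorentz y b = 0)
    (hx : lorentz y x = 0) : y = 0 := by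
  have h : (Matrix.of ![n, a, b, x]) *ᵥ ![-y 0, y 1, y 2, y 3] = 0 := by
    simp only [lorentz] at hn ha hb hx
    ext i
    fin_cases i <;> simp [Matrix.mulVec, dotProduct, Fin.sum_univ_four] <;> linarith
  have h2 := Matrix.eq_zero_of_mulVec_eq_zero hD h
  have e0 := congrFun h2 0
  have e1 := congrFun h2 1
  have e2 := congrFun h2 2
  have e3 := congrFun h2 3
  ext i
  fin_cases i <;> simp_all

lemma det_sq_eq (n a b x : L4) : -(Matrix.of ![n, a, b, x]).det ^ 2 =
    (Matrix.of ![![lorentz n n, lorentz n a, lorentz n b, lorentz n x],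
      ![lorentz a n, lorentz a a, lorentz a b, lorentz a x],
      ![lorentz b n, lorentz b a, lorentz b b, lorentz b x],
      ![lorentz x n, lorentz x a, lorentz x b, lorentz x x]]).det := by
  have h : (Matrix.of ![![lorentz n n, lorentz n a, lorentz n b, lorentz n x],
      ![lorentz a n, lorentz a a, lorentz a b, lorentz a x],
      ![lorentz b n, lorentz b a, lorentz b b, lorentz b x],
      ![lorentz x n, lorentz x a, lorentz x b, lorentz x x]]) =
      (Matrix.of ![n, a, b, x]) * Matrix.diagonal ![-1, 1, 1, 1] * (Matrix.of ![n, a, b, x])ᵀ := by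
    ext i j
    rw [Matrix.mul_apply, Fin.sum_univ_four]
    simp only [Matrix.mul_diagonal]
    fin_cases i <;> fin_cases j <;> simp [lorentz]
  rw [h, Matrix.det_mul, Matrix.det_mul, Matrix.det_transpose, Matrix.det_diagonal,
    Fin.prod_univ_four]
  simp
  ring

/-- A positive frame: `n` is the oriented unit normal at `x` of a surface with the conformal
tangent frame `a, b`. -/
structure IsConformalFrame (n a b x : L4) (l : ℝ) : Prop where
  pos : 0 < l
  nn : lorentz n n = -1
  xx : lorentz x x = 1
  nx : lorentz n x = 0
  na : lorentz n a = 0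
  nb : lorentz n b = 0
  ax : lorentz a x = 0
  bx : lorentz b x = 0
  aa : lorentz a a = l
  bb : lorentz b b = l
  ab : lorentz a b = 0
  det_pos : 0 < (Matrix.of ![n, a, b, x]).det

namespace IsConformalFrame

variable {n a b x : L4} {l : ℝ}

/-- The Gram matrix is `diag(-1, l, l, 1)`, so the determinant is `l` or `-l`, and the orientation
decides. -/
lemma det_eq (h : IsConformalFrame n a b x l) : (Matrix.of ![n, a, b, x]).det = l := by
  have h1 := det_sq_eq n a b x
  rw [lorentz_comm a n, lorentz_comm b n, lorentz_comm x n, lorentz_comm b a, lorentz_comm x a,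
    lorentz_comm x b, h.nn, h.xx, h.nx, h.na, h.nb, h.ax, h.bx, h.aa, h.bb, h.ab] at h1
  rw [Matrix.det_succ_row_zero (A := Matrix.of ![![-1, 0, 0, 0], _, _, _])] at h1
  simp [Fin.sum_univ_succ, Matrix.det_fin_three, Fin.succAbove] at h1
  have h2 := h.pos
  have h3 := h.det_pos
  have h4 : ((Matrix.of ![n, a, b, x]).det - l) * ((Matrix.of ![n, a, b, x]).det + l) = 0 := by
    linear_combination h1
  rcases mul_eq_zero.1 h4 with h5 | h5 <;> linarith

/-- Pairing the vector product with `y` is the determinant with first row `y`. It vanishes on `a`,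
`b`, `x` and is `l` on `n`, whose Lorentz square is -1. -/
lemma tripleProd_eq (h : IsConformalFrame n a b x l) : tripleProd a b x = -l • n := by
  have h0 : tripleProd a b x + l • n = 0 := by
    refine eq_zero_of_lorentz_eq_zero h.det_pos.ne' ?_ ?_ ?_ ?_ <;>
      rw [lorentz_add_left, lorentz_smul_left, lorentz_tripleProd]
    · rw [h.det_eq, h.nn]; ring
    · rw [h.na, mul_zero, add_zero]
      exact Matrix.det_zero_of_row_eq (i := 0) (j := 1) (by decide) rfl
    · rw [h.nb, mul_zero, add_zero]
      exact Matrix.det_zero_of_row_eq (i := 0) (j := 2) (by decide) rfl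
    · rw [h.nx, mul_zero, add_zero]
      exact Matrix.det_zero_of_row_eq (i := 0) (j := 3) (by decide) rfl
  rw [neg_smul]
  exact eq_neg_of_add_eq_zero_left h0

/-- This expresses the normal through `f` and its first derivatives, from which its regularity is
deduced. -/
lemma normal_eq (h : IsConformalFrame n a b x l) : n = (-l⁻¹) • tripleProd a b x := by
  rw [h.tripleProd_eq, smul_smul, neg_mul_neg, inv_mul_cancel₀ h.pos.ne', one_smul]

/-- By orthogonality `a adj b = -b adj a`, so the second product is `-2 l + 2 i a adj b`. The triple
product formula gives `a adj b = -i l n adj x`, which cancels the first product since `x adj x =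
-1`. -/
lemma herm_identity (h : IsConformalFrame n a b x l) :
    herm ((-2 * l) • (x + n)) * (herm x).adjugate +
      (herm a - Complex.I • herm b) * (herm a + Complex.I • herm b).adjugate = 0 := by
  have h1 := herm_mul_adjugate_mul a b x
  rw [h.ab, h.bx, h.ax, h.tripleProd_eq, herm_smul] at h1
  have hX := herm_mul_adjugate_self x
  have hA := herm_mul_adjugate_self a
  have hB := herm_mul_adjugate_self b
  have hAB := herm_mul_adjugate_add a b
  rw [h.xx] at hX
  rw [h.aa] at hA
  rw [h.bb] at hB
  rw [h.ab] at hAB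
  have h2 := congrArg (fun A => A * (herm x).adjugate) h1
  simp only [mul_assoc, hX] at h2
  rw [adjugate_add_two, adjugate_smul_two, herm_smul, herm_add]
  simp only [Complex.ofReal_zero, zero_smul, mul_zero, add_zero, sub_zero, neg_zero, zero_sub,
    Complex.ofReal_neg, Complex.ofReal_one, neg_smul, one_smul, mul_neg, mul_one] at h2 hX hAB hA hB
  simp only [smul_mul_assoc, add_mul, sub_mul, mul_add, mul_smul_comm, hX, hA, hB]
  simp only [smul_mul_assoc, smul_neg, neg_neg] at h2
  generalize herm a * (herm b).adjugate = Y at *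
  generalize herm b * (herm a).adjugate = Y' at *
  generalize herm n * (herm x).adjugate = V at *
  ext i j
  have h3 := congrFun (congrFun h2 i) j
  have h4 := congrFun (congrFun hAB i) j
  simp at h3 h4 ⊢
  generalize (1 : Matrix (Fin 2) (Fin 2) ℂ) i j = e at *
  linear_combination (-2 * Complex.I) * h3 + (-Complex.I) * h4 + (l * e - 2 * l * V i j) * Complex.I_sq

end IsConformalFrame

/-! ### The equation of conformal CMC 1 surfaces in a plane domain -/

/-- The Lorentz metric as a continuous bilinear map. -/
def lorentzL : L4 →L[ℝ] L4 →L[ℝ] ℝ :=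
  LinearMap.toContinuousLinearMap ((LinearMap.toContinuousLinearMap (𝕜 := ℝ)).toLinearMap ∘ₗ
    LinearMap.mk₂ ℝ lorentz lorentz_add_left lorentz_smul_left lorentz_add_right
      lorentz_smul_right)

lemma fderiv_lorentz {u v : ℂ → L4} {z : ℂ} (hu : DifferentiableAt ℝ u z)
    (hv : DifferentiableAt ℝ v z) (w : ℂ) : fderiv ℝ (fun x => lorentz (u x) (v x)) z w =
      lorentz (fderiv ℝ u z w) (v z) + lorentz (u z) (fderiv ℝ v z w) := by
  have h := (lorentzL.hasFDerivAt_of_bilinear hu.hasFDerivAt hv.hasFDerivAt).fderiv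
  rw [show (fun x => lorentz (u x) (v x)) = fun y => (lorentzL (u y)) (v y) from rfl, h, add_comm]
  rfl

lemma differentiableAt_lorentz {u v : ℂ → L4} {z : ℂ} (hu : DifferentiableAt ℝ u z)
    (hv : DifferentiableAt ℝ v z) : DifferentiableAt ℝ (fun x => lorentz (u x) (v x)) z :=
  (lorentzL.hasFDerivAt_of_bilinear hu.hasFDerivAt hv.hasFDerivAt).differentiableAt

lemma lorentz_fderiv_add_of_eventually_const {u v : ℂ → L4} {z : ℂ} (hu : DifferentiableAt ℝ u z)
    (hv : DifferentiableAt ℝ v z) {c : ℝ} (h : ∀ᶠ x in 𝓝 z, lorentz (u x) (v x) = c) (w : ℂ) :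
    lorentz (fderiv ℝ u z w) (v z) + lorentz (u z) (fderiv ℝ v z w) = 0 := by
  rw [← fderiv_lorentz hu hv,
    Filter.EventuallyEq.fderiv_eq (show _ =ᶠ[𝓝 z] fun _ => c from h), fderiv_const_apply]
  rfl

/-- The derivative in the real direction. -/
def partialX (f : ℂ → L4) (z : ℂ) : L4 := fderiv ℝ f z 1

/-- The derivative in the imaginary direction. -/
def partialY (f : ℂ → L4) (z : ℂ) : L4 := fderiv ℝ f z Complex.I

/-- The Laplacian of a map of the plane. -/
def lap (f : ℂ → L4) (z : ℂ) : L4 := partialX (partialX f) z + partialY (partialY f) z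

section Planar

variable {f N : ℂ → L4} {z : ℂ}

lemma contDiffAt_fderiv_apply (hf : ContDiffAt ℝ ∞ f z) (w : ℂ) :
    ContDiffAt ℝ ∞ (fun x => fderiv ℝ f x w) z :=
  (hf.fderiv_right (m := ∞) (by simp)).clm_apply contDiffAt_const

lemma fderiv_fderiv_apply (hf : ContDiffAt ℝ ∞ f z) (v w : ℂ) :
    fderiv ℝ (fun x => fderiv ℝ f x w) z v = fderiv ℝ (fderiv ℝ f) z v w := by
  have h : DifferentiableAt ℝ (fderiv ℝ f) z :=
    (hf.fderiv_right (m := 1) (by norm_cast)).differentiableAt one_ne_zero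
  have h2 := (h.hasFDerivAt.clm_apply (hasFDerivAt_const w z)).fderiv
  rw [h2]
  simp

lemma partialY_partialX (hf : ContDiffAt ℝ ∞ f z) :
    partialY (partialX f) z = partialX (partialY f) z := by
  unfold partialX partialY
  rw [fderiv_fderiv_apply hf, fderiv_fderiv_apply hf]
  exact (hf.isSymmSndFDerivAt (by simp; norm_cast)).eq _ _

lemma differentiableAt_tripleProd {a b x : ℂ → L4} (ha : DifferentiableAt ℝ a z)
    (hb : DifferentiableAt ℝ b z) (hx : DifferentiableAt ℝ x z) :
    DifferentiableAt ℝ (fun z => tripleProd (a z) (b z) (x z)) z := by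
  have ha := differentiableAt_pi.1 ha
  have hb := differentiableAt_pi.1 hb
  have hx := differentiableAt_pi.1 hx
  refine differentiableAt_pi.2 fun i => ?_
  fin_cases i <;> simp [tripleProd] <;> fun_prop

/-- A normal field is given pointwise, without any regularity; it agrees locally with a rational
expression in `f` and its first derivatives. -/
lemma differentiableAt_of_isConformalFrame (hf : ContDiffAt ℝ ∞ f z)
    (hN : ∀ᶠ x in 𝓝 z, ∃ l, IsConformalFrame (N x) (partialX f x) (partialY f x) (f x) l) :
    DifferentiableAt ℝ N z := by
  have hx : DifferentiableAt ℝ (partialX f) z :=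
    (contDiffAt_fderiv_apply hf 1).differentiableAt (by simp)
  have hy : DifferentiableAt ℝ (partialY f) z :=
    (contDiffAt_fderiv_apply hf Complex.I).differentiableAt (by simp)
  have h1 : (lorentz (partialX f z) (partialX f z)) ≠ 0 := by
    obtain ⟨l, hl⟩ := hN.self_of_nhds
    rw [hl.aa]
    exact hl.pos.ne'
  have h2 : DifferentiableAt ℝ (fun x => (-(lorentz (partialX f x) (partialX f x))⁻¹) •
      tripleProd (partialX f x) (partialY f x) (f x)) z :=
    (DifferentiableAt.fun_neg (DifferentiableAt.fun_inv (differentiableAt_lorentz hx hx) h1)).smul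
      (differentiableAt_tripleProd hx hy (hf.differentiableAt (by simp)))
  refine h2.congr_of_eventuallyEq (hN.mono fun x hx => ?_)
  obtain ⟨l, hl⟩ := hx
  simp only [hl.aa]
  exact hl.normal_eq

/-- The Laplacian of a conformal immersion of mean curvature 1. -/
lemma lap_eq (hf : ∀ᶠ x in 𝓝 z, ContDiffAt ℝ ∞ f x)
    (hN : ∀ᶠ x in 𝓝 z, ∃ l, IsConformalFrame (N x) (partialX f x) (partialY f x) (f x) l) {l : ℝ}
    (hl : IsConformalFrame (N z) (partialX f z) (partialY f z) (f z) l)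
    (hH : lorentz (partialX N z) (partialX f z) + lorentz (partialY N z) (partialY f z)
      = -2 * l) :
    lap f z = (-2 * l) • (f z + N z) := by
  have hfz := hf.self_of_nhds
  have hdf : DifferentiableAt ℝ f z := hfz.differentiableAt (by simp)
  have hx : DifferentiableAt ℝ (partialX f) z :=
    (contDiffAt_fderiv_apply hfz 1).differentiableAt (by simp)
  have hy : DifferentiableAt ℝ (partialY f) z :=
    (contDiffAt_fderiv_apply hfz Complex.I).differentiableAt (by simp)
  have hn := differentiableAt_of_isConformalFrame hfz hN
  have hsymm := partialY_partialX hfz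
  have hab : ∀ w, lorentz (fderiv ℝ (partialX f) z w) (partialY f z) +
      lorentz (partialX f z) (fderiv ℝ (partialY f) z w) = 0 :=
    lorentz_fderiv_add_of_eventually_const hx hy (hN.mono fun x ⟨l, h⟩ => h.ab)
  have hax : ∀ w, lorentz (fderiv ℝ (partialX f) z w) (f z) +
      lorentz (partialX f z) (fderiv ℝ f z w) = 0 :=
    lorentz_fderiv_add_of_eventually_const hx hdf (hN.mono fun x ⟨l, h⟩ => h.ax)
  have hbx : ∀ w, lorentz (fderiv ℝ (partialY f) z w) (f z) +
      lorentz (partialY f z) (fderiv ℝ f z w) = 0 :=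
    lorentz_fderiv_add_of_eventually_const hy hdf (hN.mono fun x ⟨l, h⟩ => h.bx)
  have hna : ∀ w, lorentz (fderiv ℝ N z w) (partialX f z) +
      lorentz (N z) (fderiv ℝ (partialX f) z w) = 0 :=
    lorentz_fderiv_add_of_eventually_const hn hx (hN.mono fun x ⟨l, h⟩ => h.na)
  have hnb : ∀ w, lorentz (fderiv ℝ N z w) (partialY f z) +
      lorentz (N z) (fderiv ℝ (partialY f) z w) = 0 :=
    lorentz_fderiv_add_of_eventually_const hn hy (hN.mono fun x ⟨l, h⟩ => h.nb)
  have haabb : ∀ w, lorentz (fderiv ℝ (partialX f) z w) (partialX f z) =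
      lorentz (fderiv ℝ (partialY f) z w) (partialY f z) := by
    intro w
    have h1 := fderiv_lorentz hx hx w
    have h2 := fderiv_lorentz hy hy w
    have h3 : (fun x => lorentz (partialX f x) (partialX f x)) =ᶠ[𝓝 z]
        fun x => lorentz (partialY f x) (partialY f x) :=
      hN.mono fun x ⟨l, h⟩ => h.aa.trans h.bb.symm
    rw [h3.fderiv_eq, h2, lorentz_comm (partialX f z), lorentz_comm (partialY f z)] at h1
    linarith
  have hlap : ∀ y, lorentz (lap f z + (2 * l) • (f z + N z)) y =
      lorentz (fderiv ℝ (partialX f) z 1) y + lorentz (fderiv ℝ (partialY f) z Complex.I) y +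
        2 * l * (lorentz (f z) y + lorentz (N z) y) := by
    intro y
    rw [lorentz_add_left, lorentz_smul_left, lorentz_add_left, lap, lorentz_add_left]
    rfl
  have hsymm' : fderiv ℝ (partialX f) z Complex.I = fderiv ℝ (partialY f) z 1 := hsymm
  -- The vector is tested against the frame: tangentially it vanishes by differentiating the
  -- conformality relations, along `N` by mean curvature 1, and along `f` by differentiating `⟨f,
  -- df⟩ = 0`.
  have h0 : lap f z + (2 * l) • (f z + N z) = 0 := by
    refine eq_zero_of_lorentz_eq_zero hl.det_pos.ne' ?_ ?_ ?_ ?_ <;> rw [hlap]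
    · have h1 := hna 1
      have h2 := hnb Complex.I
      rw [lorentz_comm _ (N z), lorentz_comm _ (N z), lorentz_comm (f z), hl.nx, hl.nn]
      change lorentz (partialX N z) (partialX f z) + _ = 0 at h1
      change lorentz (partialY N z) (partialY f z) + _ = 0 at h2
      linarith
    · have h1 := haabb 1
      have h2 := hab Complex.I
      rw [hsymm', lorentz_comm (partialX f z)] at h2
      rw [lorentz_comm (f z), hl.ax, hl.na]
      linarith
    · have h1 := haabb Complex.I
      have h2 := hab 1
      rw [hsymm', lorentz_comm (fderiv ℝ (partialY f) z 1)] at h1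
      rw [lorentz_comm (f z), hl.bx, hl.nb]
      linarith
    · have h1 := hax 1
      have h2 := hbx Complex.I
      change _ + lorentz (partialX f z) (partialX f z) = 0 at h1
      change _ + lorentz (partialY f z) (partialY f z) = 0 at h2
      rw [hl.aa] at h1
      rw [hl.bb] at h2
      rw [hl.xx, hl.nx]
      linarith
  rw [neg_mul, neg_smul]
  exact eq_neg_of_add_eq_zero_left h0

end Planar

lemma clm_complex_apply {E : Type*} [NormedAddCommGroup E] [NormedSpace ℝ E] (L : ℂ →L[ℝ] E)
    (v : ℂ) : L v = v.re • L 1 + v.im • L Complex.I := by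
  rw [← map_smul, ← map_smul, ← map_add]
  congr 1
  apply Complex.ext <;> simp

/-- The defect of the equation `Δ f = f_z f⁻¹ f_z̄` of CMC 1 surfaces. -/
def bryantDefect (f : ℂ → L4) (z : ℂ) : Matrix (Fin 2) (Fin 2) ℂ :=
  herm (lap f z) * (herm (f z)).adjugate + (herm (partialX f z) - Complex.I • herm (partialY f z)) *
    (herm (partialX f z) + Complex.I • herm (partialY f z)).adjugate

/-- The local equations of a CMC 1 face in an isothermal coordinate. -/
structure IsFaceEquation (f : ℂ → L4) (z : ℂ) : Prop where
  smooth : ContDiffAt ℝ ∞ f z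
  unit : lorentz (f z) (f z) = 1
  bryant : bryantDefect f z = 0
  norm_eq : lorentz (partialX f z) (partialX f z) = lorentz (partialY f z) (partialY f z)
  orthogonal : lorentz (partialX f z) (partialY f z) = 0
  ne_zero : partialX f z ≠ 0 ∨ partialY f z ≠ 0

lemma continuous_herm : Continuous herm := by
  refine continuous_matrix fun i j => ?_
  fin_cases i <;> fin_cases j <;> simp [herm] <;> fun_prop

lemma continuousAt_bryantDefect {f : ℂ → L4} {z : ℂ} (hf : ContDiffAt ℝ ∞ f z) :
    ContinuousAt (bryantDefect f) z := by
  have hx : ContDiffAt ℝ ∞ (partialX f) z := contDiffAt_fderiv_apply hf 1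
  have hy : ContDiffAt ℝ ∞ (partialY f) z := contDiffAt_fderiv_apply hf Complex.I
  have hxx : ContDiffAt ℝ ∞ (partialX (partialX f)) z := contDiffAt_fderiv_apply hx 1
  have hyy : ContDiffAt ℝ ∞ (partialY (partialY f)) z := contDiffAt_fderiv_apply hy Complex.I
  have hlap : ContinuousAt (lap f) z := hxx.continuousAt.add hyy.continuousAt
  have hherm : ∀ u : ℂ → L4, ContinuousAt u z → ContinuousAt (fun x => herm (u x)) z :=
    fun u hu => ContinuousAt.comp (g := herm) continuous_herm.continuousAt hu
  have hadj : ∀ u : ℂ → Matrix (Fin 2) (Fin 2) ℂ, ContinuousAt u z →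
      ContinuousAt (fun x => (u x).adjugate) z :=
    fun u hu => ContinuousAt.comp (g := Matrix.adjugate)
      (continuous_id.matrix_adjugate).continuousAt hu
  have h1 := hherm _ hx.continuousAt
  have h2 : ContinuousAt (Complex.I • fun x => herm (partialY f x)) z :=
    (hherm _ hy.continuousAt).const_smul Complex.I
  have h3 := hadj _ (hherm _ hf.continuousAt)
  have h4 := hadj _ (h1.add h2)
  exact ((hherm _ hlap).mul h3).add ((h1.sub h2).mul h4)

/-! ### From a CMC 1 face to its local equations -/

section Surface

variable {S : Type*} [TopologicalSpace S] [ChartedSpace ℂ S] [IsManifold 𝓘(ℂ) ω S]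
  {f N : S → L4} {p q : S}

lemma contDiffAt_comp_chart_symm (hf : ContMDiff 𝓘(ℝ, ℂ) 𝓘(ℝ, L4) ∞ f)
    (hq : q ∈ (chartAt ℂ p).source) :
    ContDiffAt ℝ ∞ (f ∘ (chartAt ℂ p).symm) (chartAt ℂ p q) := by
  rw [← contMDiffAt_iff_contDiffAt]
  have h := contMDiffOn_chart_symm (I := 𝓘(ℝ, ℂ)) (n := ∞) (x := p) (H := ℂ)
  exact (hf _).comp _ (h.contMDiffAt
    ((chartAt ℂ p).open_target.mem_nhds ((chartAt ℂ p).map_source hq)))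

lemma diff_eq_fderiv (hf : MDifferentiableAt 𝓘(ℝ, ℂ) 𝓘(ℝ, L4) f q)
    (hq : q ∈ (chartAt ℂ p).source) (v : ℂ) : diff f q v =
      fderiv ℝ (f ∘ (chartAt ℂ p).symm) (chartAt ℂ p q) (chartDeriv p q * v) := by
  rw [diff_eq_tderiv, tderiv_eq_comp hq hf, ContinuousLinearMap.comp_apply, tderiv_real_chart hq]

omit [IsManifold 𝓘(ℂ) ω S] in
lemma not_isSingularPoint_of_pos
    (h : ∀ v : TangentSpace 𝓘(ℝ, ℂ) p, v ≠ 0 → 0 < inducedMetric f p v v) :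
    ¬ IsSingularPoint f p := by
  rintro ⟨v, hv, hw⟩
  exact (h v hv).ne' (hw v)

/-- A conformal immersion, with its oriented unit normal, in the coordinate at `p`. -/
lemma exists_isConformalFrame (hf : MDifferentiableAt 𝓘(ℝ, ℂ) 𝓘(ℝ, L4) f q)
    (hd : ∀ x, f x ∈ deSitter) (hN : IsOrientedUnitNormal f q (N q))
    (hq : q ∈ (chartAt ℂ p).source) {r : ℝ} (hr : 0 < r) (hc : ∀ v w : ℂ,
      inducedMetric f q v w = r * (v * conj w).re) :
    IsConformalFrame (N q) (partialX (f ∘ (chartAt ℂ p).symm) (chartAt ℂ p q))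
      (partialY (f ∘ (chartAt ℂ p).symm) (chartAt ℂ p q)) (f q)
      (r * ‖(chartDeriv p q)⁻¹‖ ^ 2) := by
  have hc0 := chartDeriv_ne_zero hq
  have hx : partialX (f ∘ (chartAt ℂ p).symm) (chartAt ℂ p q) =
      diff f q ((chartDeriv p q)⁻¹ : ℂ) := by
    rw [diff_eq_fderiv hf hq, mul_inv_cancel₀ hc0]
    rfl
  have hy : partialY (f ∘ (chartAt ℂ p).symm) (chartAt ℂ p q) =
      diff f q ((chartDeriv p q)⁻¹ * Complex.I : ℂ) := by
    rw [diff_eq_fderiv hf hq, mul_inv_cancel_left₀ hc0]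
    rfl
  rw [hx, hy]
  set c := (chartDeriv p q)⁻¹ with hcdef
  have hcn : c ≠ 0 := inv_ne_zero hc0
  obtain ⟨h1, h2, h3, h4⟩ := hN
  have hI : ∀ v w : ℂ, lorentz (diff f q v) (diff f q w) = r * (v * conj w).re := hc
  have hfd : ∀ v : ℂ, lorentz (diff f q v) (f q) = 0 := by
    intro v
    have hf' := (mdifferentiableAt_iff_chart hq).1 hf
    have h5 := lorentz_fderiv_add_of_eventually_const hf' hf' (c := 1)
      (Filter.Eventually.of_forall fun x => hd _) (chartDeriv p q * v)
    rw [← diff_eq_fderiv hf hq, lorentz_comm _ (diff f q v), Function.comp_apply,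
      (chartAt ℂ p).left_inv hq] at h5
    linarith
  refine ⟨by positivity, h1, hd q, h2, h3 c, h3 (c * Complex.I : ℂ), hfd _, hfd _, ?_, ?_, ?_, ?_⟩
  · rw [hI, Complex.mul_conj, Complex.normSq_eq_norm_sq, Complex.ofReal_re]
  · rw [hI, Complex.mul_conj, Complex.normSq_eq_norm_sq, Complex.ofReal_re, norm_mul,
      Complex.norm_I, mul_one]
  · rw [hI]
    simp
    right
    ring
  · have hdc : ∀ v : ℂ, diff f q v = v.re • diff f q (1 : ℂ) + v.im • diff f q Complex.I :=
      fun v => clm_complex_apply (tderiv ℝ f q) v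
    rw [hdc c, hdc (c * Complex.I)]
    have h5 := det_combination (N q) (f q) (diff f q (1 : ℂ)) (diff f q Complex.I) c.re c.im
    simp only [Complex.mul_re, Complex.mul_im, Complex.I_re, Complex.I_im, mul_zero, mul_one,
      zero_sub, add_zero]
    refine (mul_pos ?_ h4).trans_eq h5.symm
    have := Complex.normSq_pos.2 hcn
    rw [Complex.normSq_apply] at this
    nlinarith

/-- A conformal surface of mean curvature 1 satisfies its equation in every coordinate. -/
lemma bryantDefect_eq_zero (hf : ContMDiff 𝓘(ℝ, ℂ) 𝓘(ℝ, L4) ∞ f) (hd : ∀ x, f x ∈ deSitter)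
    {W : Set S} (hW : IsOpen W)
    (hN : ∀ x ∈ W, IsOrientedUnitNormal f x (N x) ∧ meanCurvature f N x = 1)
    (hc : ∀ x ∈ W, ∃ r : ℝ, 0 < r ∧ ∀ v w : ℂ, inducedMetric f x v w = r * (v * conj w).re)
    (hq : q ∈ (chartAt ℂ p).source) (hqW : q ∈ W) :
    bryantDefect (f ∘ (chartAt ℂ p).symm) (chartAt ℂ p q) = 0 := by
  have hmd : ∀ x, MDifferentiableAt 𝓘(ℝ, ℂ) 𝓘(ℝ, L4) f x := fun x =>
    (hf x).mdifferentiableAt (by simp)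
  have hframe : ∀ᶠ z in 𝓝 (chartAt ℂ p q), ∃ l, IsConformalFrame ((N ∘ (chartAt ℂ p).symm) z)
      (partialX (f ∘ (chartAt ℂ p).symm) z) (partialY (f ∘ (chartAt ℂ p).symm) z)
      ((f ∘ (chartAt ℂ p).symm) z) l := by
    filter_upwards [(eventually_nhds_iff_chart hq).1 (hW.mem_nhds hqW),
      (chartAt ℂ p).open_target.mem_nhds ((chartAt ℂ p).map_source hq)] with z h1 h2
    obtain ⟨r, hr, hcr⟩ := hc _ h1
    have h3 := exists_isConformalFrame (hmd _) hd (hN _ h1).1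
      ((chartAt ℂ p).map_target h2) hr hcr
    rw [(chartAt ℂ p).right_inv h2] at h3
    exact ⟨_, h3⟩
  have hsm : ∀ᶠ z in 𝓝 (chartAt ℂ p q), ContDiffAt ℝ ∞ (f ∘ (chartAt ℂ p).symm) z := by
    filter_upwards [(chartAt ℂ p).open_target.mem_nhds ((chartAt ℂ p).map_source hq)] with z h2
    have h3 := contDiffAt_comp_chart_symm hf ((chartAt ℂ p).map_target h2)
    rwa [(chartAt ℂ p).right_inv h2] at h3
  obtain ⟨r, hr, hcr⟩ := hc q hqW
  have hl := exists_isConformalFrame (hmd q) hd (hN q hqW).1 hq hr hcr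
  -- Without this, the derivative of `N` in the mean curvature could be a default value.
  have hNd : MDifferentiableAt 𝓘(ℝ, ℂ) 𝓘(ℝ, L4) N q :=
    (mdifferentiableAt_iff_chart hq).2
      (differentiableAt_of_isConformalFrame (N := N ∘ (chartAt ℂ p).symm) hsm.self_of_nhds hframe)
  have hleft : (chartAt ℂ p).symm (chartAt ℂ p q) = q := (chartAt ℂ p).left_inv hq
  have hH : lorentz (partialX (N ∘ (chartAt ℂ p).symm) (chartAt ℂ p q))
      (partialX (f ∘ (chartAt ℂ p).symm) (chartAt ℂ p q)) +
      lorentz (partialY (N ∘ (chartAt ℂ p).symm) (chartAt ℂ p q))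
        (partialY (f ∘ (chartAt ℂ p).symm) (chartAt ℂ p q)) =
      -2 * (r * ‖(chartDeriv p q)⁻¹‖ ^ 2) := by
    have hm := (hN q hqW).2
    have h2 : ∀ v w : ℂ, secondForm f N q v w =
        -lorentz (fderiv ℝ (N ∘ (chartAt ℂ p).symm) (chartAt ℂ p q) (chartDeriv p q * v))
          (fderiv ℝ (f ∘ (chartAt ℂ p).symm) (chartAt ℂ p q) (chartDeriv p q * w)) := by
      intro v w
      rw [← diff_eq_fderiv (hmd q) hq, ← diff_eq_fderiv hNd hq]
      rfl
    unfold meanCurvature at hm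
    rw [hcr, hcr, hcr, h2, h2, h2] at hm
    have hc0 := chartDeriv_ne_zero hq
    have hc1 : ‖(chartDeriv p q)⁻¹‖ ^ 2 * ((chartDeriv p q).re ^ 2 + (chartDeriv p q).im ^ 2) = 1 := by
      have h3 := Complex.normSq_pos.2 hc0
      rw [norm_inv, inv_pow, ← Complex.normSq_eq_norm_sq, Complex.normSq_apply] at *
      rw [← sq, ← sq] at *
      exact inv_mul_cancel₀ h3.ne'
    -- Mean curvature is defined in the preferred coordinate at `q`, while the equation lives in the
    -- one at `p`. The two differ by the complex factor `chartDeriv p q`, and the trace over a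
    -- conformal frame only sees its squared modulus.
    unfold partialX partialY
    rw [clm_complex_apply _ (chartDeriv p q * 1), clm_complex_apply _ (chartDeriv p q * 1),
      clm_complex_apply _ (chartDeriv p q * Complex.I),
      clm_complex_apply _ (chartDeriv p q * Complex.I)] at hm
    generalize fderiv ℝ (N ∘ (chartAt ℂ p).symm) (chartAt ℂ p q) 1 = A at *
    generalize fderiv ℝ (N ∘ (chartAt ℂ p).symm) (chartAt ℂ p q) Complex.I = B at *
    generalize fderiv ℝ (f ∘ (chartAt ℂ p).symm) (chartAt ℂ p q) 1 = C at *
    generalize fderiv ℝ (f ∘ (chartAt ℂ p).symm) (chartAt ℂ p q) Complex.I = D at *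
    generalize ‖(chartDeriv p q)⁻¹‖ ^ 2 = m at *
    generalize chartDeriv p q = c at *
    simp only [lorentz_add_left, lorentz_add_right, lorentz_smul_left, lorentz_smul_right] at hm
    simp at hm
    field_simp at hm
    linear_combination (-m) * hm - (lorentz A C + lorentz B D) * hc1
  have hlap := lap_eq hsm hframe (l := r * ‖(chartDeriv p q)⁻¹‖ ^ 2)
    (by simpa only [Function.comp_apply, hleft] using hl) hH
  unfold bryantDefect
  rw [hlap]
  simp only [Function.comp_apply, hleft]
  exact hl.herm_identity

/-- This carries the equations from the dense set of regular points to the singular points. -/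
lemma eq_of_frequently_eq {X : Type*} [TopologicalSpace X] [T2Space X] {u v : ℂ → X} {z : ℂ}
    (hu : ContinuousAt u z) (hv : ContinuousAt v z) (h : ∃ᶠ x in 𝓝 z, u x = v x) : u z = v z := by
  by_contra hne
  obtain ⟨A, B, hA, hB, hzA, hzB, hAB⟩ := t2_separation hne
  refine h ?_
  filter_upwards [hu.eventually (hA.mem_nhds hzA), hv.eventually (hB.mem_nhds hzB)] with x h1 h2 h3
  exact Set.disjoint_left.1 hAB h1 (h3 ▸ h2)

/-- A conformal CMC 1 face satisfies the local equations in every coordinate, also at its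
singular points. -/
theorem isFaceEquation_of_isCMC1Face (hf : IsCMC1Face f)
    (hconf : ∀ x, ¬ IsSingularPoint f x → IsConformalAt f x) (hq : q ∈ (chartAt ℂ p).source) :
    IsFaceEquation (f ∘ (chartAt ℂ p).symm) (chartAt ℂ p q) := by
  obtain ⟨hsm, hd, W, hW, hWd, ⟨hpos, N, hN⟩, hadm⟩ := hf
  have hc : ∀ x, ¬ IsSingularPoint f x →
      ∃ r : ℝ, 0 < r ∧ ∀ v w : ℂ, inducedMetric f x v w = r * (v * conj w).re := hconf
  have hcW : ∀ x ∈ W, ∃ r : ℝ, 0 < r ∧ ∀ v w : ℂ, inducedMetric f x v w = r * (v * conj w).re :=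
    fun x hx => hc x (not_isSingularPoint_of_pos (hpos x hx))
  have hmd : ∀ x, MDifferentiableAt 𝓘(ℝ, ℂ) 𝓘(ℝ, L4) f x := fun x =>
    (hsm x).mdifferentiableAt (by simp)
  have hfreq : ∃ᶠ z in 𝓝 (chartAt ℂ p q), z ∈ (chartAt ℂ p).target ∧ (chartAt ℂ p).symm z ∈ W := by
    have h1 : ∃ᶠ x in 𝓝 q, x ∈ W := mem_closure_iff_frequently.1 (hWd q)
    have h2 : ∃ᶠ z in 𝓝 (chartAt ℂ p q), (chartAt ℂ p).symm z ∈ W := fun h =>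
      h1 ((eventually_nhds_iff_chart hq).2 h)
    exact (h2.and_eventually ((chartAt ℂ p).open_target.mem_nhds
      ((chartAt ℂ p).map_source hq))).mono fun z hz => ⟨hz.2, hz.1⟩
  have hW' : ∀ z, z ∈ (chartAt ℂ p).target → (chartAt ℂ p).symm z ∈ W →
      bryantDefect (f ∘ (chartAt ℂ p).symm) z = 0 ∧ ∃ l,
      IsConformalFrame (N ((chartAt ℂ p).symm z)) (partialX (f ∘ (chartAt ℂ p).symm) z)
        (partialY (f ∘ (chartAt ℂ p).symm) z) (f ((chartAt ℂ p).symm z)) l := by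
    intro z hz hzW
    have h1 := (chartAt ℂ p).map_target hz
    obtain ⟨r, hr, hcr⟩ := hcW _ hzW
    have h2 := bryantDefect_eq_zero hsm hd hW hN hcW h1 hzW
    have h3 := exists_isConformalFrame (hmd _) hd (hN _ hzW).1 h1 hr hcr
    rw [(chartAt ℂ p).right_inv hz] at h2 h3
    exact ⟨h2, _, h3⟩
  have hs := contDiffAt_comp_chart_symm hsm hq
  have hx : ContDiffAt ℝ ∞ (partialX (f ∘ (chartAt ℂ p).symm)) (chartAt ℂ p q) :=
    contDiffAt_fderiv_apply hs 1
  have hy : ContDiffAt ℝ ∞ (partialY (f ∘ (chartAt ℂ p).symm)) (chartAt ℂ p q) :=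
    contDiffAt_fderiv_apply hs Complex.I
  have hx' := hx.differentiableAt (by simp)
  have hy' := hy.differentiableAt (by simp)
  refine ⟨hs, hd _, ?_, ?_, ?_, ?_⟩
  · exact eq_of_frequently_eq (continuousAt_bryantDefect hs) (continuousAt_const (y := 0))
      (hfreq.mono fun z hz => (hW' z hz.1 hz.2).1)
  · refine eq_of_frequently_eq (differentiableAt_lorentz hx' hx').continuousAt
      (differentiableAt_lorentz hy' hy').continuousAt (hfreq.mono fun z hz => ?_)
    obtain ⟨-, l, hl⟩ := hW' z hz.1 hz.2
    exact hl.aa.trans hl.bb.symm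
  · refine eq_of_frequently_eq (differentiableAt_lorentz hx' hy').continuousAt
      (continuousAt_const (y := 0)) (hfreq.mono fun z hz => ?_)
    obtain ⟨-, l, hl⟩ := hW' z hz.1 hz.2
    exact hl.ab
  -- Nonvanishing of `df` is not a closed condition. At a singular point it comes from
  -- admissibility, elsewhere from the positive conformal factor.
  · by_contra h
    push Not at h
    have h0 : ∀ v : ℂ, diff f q v = 0 := by
      intro v
      rw [diff_eq_fderiv (hmd q) hq, clm_complex_apply]
      change _ • partialX _ _ + _ • partialY _ _ = 0
      rw [h.1, h.2, smul_zero, smul_zero, add_zero]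
    by_cases hsing : IsSingularPoint f q
    · obtain ⟨-, v, hv⟩ := hadm q hsing
      exact hv (h0 v)
    · obtain ⟨r, hr, hcr⟩ := hc q hsing
      have h2 := hcr 1 1
      simp only [inducedMetric] at h2
      rw [h0] at h2
      simp [lorentz] at h2
      exact hr.ne h2

end Surface

/-! ### The local holomorphic lift -/

section LocalLift

open scoped Matrix.Norms.Operator

/-- `herm` as a continuous linear map. -/
def hermL : L4 →L[ℝ] Matrix (Fin 2) (Fin 2) ℂ :=
  LinearMap.toContinuousLinearMap
    { toFun := herm
      map_add' := herm_add
      map_smul' := fun c x => by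
        rw [herm_smul]
        rfl }

/-- The adjugate as a continuous linear map. -/
def adjugateL : Matrix (Fin 2) (Fin 2) ℂ →L[ℂ] Matrix (Fin 2) (Fin 2) ℂ :=
  LinearMap.toContinuousLinearMap
    { toFun := Matrix.adjugate
      map_add' := adjugate_add_two
      map_smul' := adjugate_smul_two }

/-- The conjugate transpose as a continuous linear map. -/
def conjTransposeL : Matrix (Fin 2) (Fin 2) ℂ →L[ℝ] Matrix (Fin 2) (Fin 2) ℂ :=
  LinearMap.toContinuousLinearMap
    { toFun := Matrix.conjTranspose
      map_add' := Matrix.conjTranspose_add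
      map_smul' := fun c A => by simp }

lemma hasDerivAt_matrix {F : ℂ → Matrix (Fin 2) (Fin 2) ℂ} {F' : Matrix (Fin 2) (Fin 2) ℂ} {z : ℂ}
    (h : ∀ i j, HasDerivAt (fun z => F z i j) (F' i j) z) : HasDerivAt F F' z := by
  have h2 : ∀ A : Matrix (Fin 2) (Fin 2) ℂ, A = ∑ i, ∑ j, A i j • Matrix.single i j (1 : ℂ) := by
    intro A
    conv_lhs => rw [Matrix.matrix_eq_sum_single A]
    simp [Matrix.smul_single]
  rw [h2 F', show F = fun z => ∑ i, ∑ j, F z i j • Matrix.single i j (1 : ℂ) from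
    funext fun z => h2 (F z)]
  exact HasDerivAt.fun_sum fun i _ => HasDerivAt.fun_sum fun j _ => (h i j).smul_const _

lemma HasDerivAt.matrix_apply {F : ℂ → Matrix (Fin 2) (Fin 2) ℂ} {F' : Matrix (Fin 2) (Fin 2) ℂ}
    {z : ℂ} (h : HasDerivAt F F' z) (i j : Fin 2) : HasDerivAt (fun z => F z i j) (F' i j) z :=
  (LinearMap.toContinuousLinearMap
    (Matrix.entryLinearMap ℂ ℂ i j)).hasFDerivAt.comp_hasDerivAt z h

/-- The coefficient `f_z f⁻¹` of the equation of the holomorphic lift of `f`. -/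
def liftCoeff (f : ℂ → L4) (z : ℂ) : Matrix (Fin 2) (Fin 2) ℂ :=
  (-(1 / 2) : ℂ) • ((herm (partialX f z) - Complex.I • herm (partialY f z)) * (herm (f z)).adjugate)

variable {f : ℂ → L4} {z : ℂ}

/-- The Cauchy–Riemann equation holds because the antiholomorphic derivative of `f_z adj f` is a
constant multiple of `bryantDefect f`, by linearity of the adjugate and symmetry of second
derivatives. -/
lemma IsFaceEquation.differentiableAt_liftCoeff (h : IsFaceEquation f z) :
    DifferentiableAt ℂ (liftCoeff f) z := by
  have hf := h.smooth
  have hx : DifferentiableAt ℝ (partialX f) z :=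
    (contDiffAt_fderiv_apply hf 1).differentiableAt (by simp)
  have hy : DifferentiableAt ℝ (partialY f) z :=
    (contDiffAt_fderiv_apply hf Complex.I).differentiableAt (by simp)
  have h1 := hermL.hasFDerivAt.comp z hx.hasFDerivAt
  have h2 := (hermL.hasFDerivAt.comp z hy.hasFDerivAt).const_smul Complex.I
  have h3 := (adjugateL.restrictScalars ℝ).hasFDerivAt.comp z
    (hermL.hasFDerivAt.comp z (hf.differentiableAt (by simp)).hasFDerivAt)
  have h4 := ((h1.sub h2).mul' h3).const_smul (-(1 / 2) : ℂ)
  have h5 : HasFDerivAt (liftCoeff f) _ z := h4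
  refine differentiableAt_complex_iff_differentiableAt_real.2 ⟨h5.differentiableAt, ?_⟩
  have hsymm : fderiv ℝ (partialX f) z Complex.I = fderiv ℝ (partialY f) z 1 :=
    partialY_partialX hf
  have hb := h.bryant
  unfold bryantDefect lap at hb
  rw [adjugate_add_two, adjugate_smul_two, herm_add] at hb
  have h7 : ∀ v, fderiv ℝ (liftCoeff f) z v = _ := fun v => congrArg (fun L => L v) h5.fderiv
  refine (h7 Complex.I).trans (Eq.trans ?_ (congrArg (fun A => Complex.I • A) (h7 1)).symm)
  change (-(1 / 2) : ℂ) • ((herm (partialX f z) - Complex.I • herm (partialY f z)) *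
      (herm (partialY f z)).adjugate + (herm (fderiv ℝ (partialX f) z Complex.I) -
        Complex.I • herm (partialY (partialY f) z)) * (herm (f z)).adjugate) =
    Complex.I • (-(1 / 2) : ℂ) • ((herm (partialX f z) - Complex.I • herm (partialY f z)) *
      (herm (partialX f z)).adjugate + (herm (partialX (partialX f) z) -
        Complex.I • herm (fderiv ℝ (partialY f) z 1)) * (herm (f z)).adjugate)
  rw [hsymm]
  simp only [sub_mul, mul_add, add_mul, smul_mul_assoc, mul_smul_comm] at hb ⊢
  ext i j
  have h6 := congrFun (congrFun hb i) j
  simp only [Matrix.add_apply, Matrix.sub_apply, Matrix.smul_apply, smul_eq_mul,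
    Matrix.zero_apply] at h6 ⊢
  linear_combination (Complex.I / 2) * h6 +
    (Complex.I / 2 * (herm (partialY f z) * (herm (partialY f z)).adjugate) i j -
      (herm (partialX f z) * (herm (partialY f z)).adjugate) i j / 2 -
      (herm (fderiv ℝ (partialY f) z 1) * (herm (f z)).adjugate) i j / 2) * Complex.I_sq

lemma adjugate_mul_herm {x : L4} (hx : lorentz x x = 1) : (herm x).adjugate * herm x = -1 := by
  have h := herm_mul_adjugate_self x
  rw [Matrix.mul_adjugate] at h
  rw [Matrix.adjugate_mul, h, hx]
  simp

lemma conjTranspose_herm (x : L4) : (herm x)ᴴ = herm x := (hermEquiv x).2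

lemma liftCoeff_mul_herm (h : lorentz (f z) (f z) = 1) : liftCoeff f z * herm (f z) =
    (1 / 2 : ℂ) • (herm (partialX f z) - Complex.I • herm (partialY f z)) := by
  rw [liftCoeff, smul_mul_assoc, mul_assoc, adjugate_mul_herm h, mul_neg_one, neg_smul_neg]

/-- Since `f` is Hermitian, `df` is `f_z dz` plus its adjoint, and `f_z = A f` for the coefficient
`A`. -/
lemma herm_fderiv_eq (h : lorentz (f z) (f z) = 1) (v : ℂ) : herm (fderiv ℝ f z v) =
    v • (liftCoeff f z * herm (f z)) + (v • (liftCoeff f z * herm (f z)))ᴴ := by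
  rw [liftCoeff_mul_herm h, clm_complex_apply, herm_add, herm_smul, herm_smul]
  simp only [Matrix.conjTranspose_smul, Matrix.conjTranspose_sub, conjTranspose_herm]
  change _ • herm (partialX f z) + _ • herm (partialY f z) = _
  generalize herm (partialX f z) = A
  generalize herm (partialY f z) = B
  ext i j
  simp
  have h1 := Complex.re_add_im v
  have h2 : conj v = v.re - v.im * Complex.I := by
    apply Complex.ext <;> simp
  have h3 := Complex.I_sq
  rw [h2]
  generalize hs : (v.re : ℂ) = s at *
  generalize ht : (v.im : ℂ) = t at *
  rw [← h1]
  linear_combination (t * B i j) * h3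

lemma trace_herm_mul_adjugate (x y : L4) : (herm x * (herm y).adjugate) 0 0 +
    (herm x * (herm y).adjugate) 1 1 = -2 * lorentz x y := by
  simp [herm, Matrix.adjugate_fin_two, Matrix.mul_apply, Fin.sum_univ_two, lorentz]
  linear_combination (2 * x 2 * y 2) * Complex.I_sq

/-- The trace of `f_x adj f` is a multiple of `⟨f_x, f⟩`, and `f` has constant Lorentz square; the
same holds for `f_y`. -/
lemma trace_liftCoeff (h : ∀ᶠ x in 𝓝 z, IsFaceEquation f x) :
    liftCoeff f z 0 0 + liftCoeff f z 1 1 = 0 := by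
  have hd : DifferentiableAt ℝ f z := h.self_of_nhds.smooth.differentiableAt (by simp)
  have h0 : ∀ v, lorentz (fderiv ℝ f z v) (f z) = 0 := by
    intro v
    have h1 := lorentz_fderiv_add_of_eventually_const hd hd (h.mono fun x hx => hx.unit) v
    rw [lorentz_comm (f z)] at h1
    linarith
  have h1 := trace_herm_mul_adjugate (partialX f z) (f z)
  have h2 := trace_herm_mul_adjugate (partialY f z) (f z)
  rw [show lorentz (partialX f z) (f z) = 0 from h0 1] at h1
  rw [show lorentz (partialY f z) (f z) = 0 from h0 Complex.I] at h2
  simp only [liftCoeff, sub_mul, smul_mul_assoc, Matrix.sub_apply, Matrix.smul_apply, smul_eq_mul]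
  rw [Complex.ofReal_zero] at h1 h2
  linear_combination (-(1 / 2)) * h1 + Complex.I / 2 * h2

/-- The determinant is minus the complex bilinear extension of the Lorentz square. Its vanishing on
`f_x - i f_y` is therefore conformality. -/
lemma det_herm_sub (x y : L4) : (herm x - Complex.I • herm y).det =
    -(lorentz x x - lorentz y y - 2 * Complex.I * lorentz x y) := by
  rw [Matrix.det_fin_two]
  simp [herm, lorentz]
  linear_combination (y 0 ^ 2 - y 3 ^ 2 + x 2 ^ 2 - y 1 ^ 2 - 2 * Complex.I * x 2 * y 2 +
    (Complex.I ^ 2 - 1) * y 2 ^ 2) * Complex.I_sq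

lemma IsFaceEquation.det_liftCoeff (h : IsFaceEquation f z) : (liftCoeff f z).det = 0 := by
  rw [liftCoeff, Matrix.det_smul, Matrix.det_mul, det_herm_sub, h.norm_eq, h.orthogonal]
  simp

lemma herm_injective : Function.Injective herm := fun _ _ h =>
  hermEquiv.injective (Subtype.ext h)

/-- If it vanished then `f_x = i f_y`; both matrices are Hermitian, so taking adjoints gives `f_x =
-i f_y`, and `df` would be zero. -/
lemma IsFaceEquation.liftCoeff_ne_zero (h : IsFaceEquation f z) : liftCoeff f z ≠ 0 := by
  intro h0
  have h1 := liftCoeff_mul_herm h.unit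
  have hz : herm 0 = 0 := hermL.map_zero
  rw [h0, zero_mul, eq_comm, smul_eq_zero_iff_right (by norm_num), sub_eq_zero] at h1
  have h2 := congrArg Matrix.conjTranspose h1
  rw [Matrix.conjTranspose_smul, conjTranspose_herm, conjTranspose_herm] at h2
  have h3 : herm (partialX f z) = 0 := by
    have h4 : (2 : ℂ) • herm (partialX f z) = 0 := by
      rw [two_smul]
      nth_rewrite 1 [h1]
      rw [h2, ← add_smul]
      simp
    exact (smul_eq_zero_iff_right two_ne_zero).1 h4
  have h5 : herm (partialY f z) = 0 := by
    rw [h3, eq_comm, smul_eq_zero_iff_right Complex.I_ne_zero] at h1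
    exact h1
  rw [← hz] at h3 h5
  have h6 := h.ne_zero
  rw [herm_injective h3, herm_injective h5] at h6
  simp at h6

/-- The group `SL(2, ℂ)` acts transitively on de Sitter space. -/
lemma exists_mul_e3_mul {x : L4} (hx : lorentz x x = 1) :
    ∃ K : Matrix (Fin 2) (Fin 2) ℂ, K.det = 1 ∧ K * e3 * Kᴴ = herm x := by
  have key : ∀ a b c d : ℂ, a * d - b * c = 1 → ‖a‖ ^ 2 - ‖b‖ ^ 2 = x 0 + x 3 →
      ‖c‖ ^ 2 - ‖d‖ ^ 2 = x 0 - x 3 → a * conj c - b * conj d = x 1 + Complex.I * x 2 →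
      ∃ K : Matrix (Fin 2) (Fin 2) ℂ, K.det = 1 ∧ K * e3 * Kᴴ = herm x := by
    intro a b c d h1 h2 h3 h4
    refine ⟨!![a, b; c, d], by rw [Matrix.det_fin_two]; simpa using h1, ?_⟩
    have h5 := congrArg conj h4
    have h2' : a * conj a - b * conj b = x 0 + x 3 := by
      rw [Complex.mul_conj, Complex.mul_conj, Complex.normSq_eq_norm_sq, Complex.normSq_eq_norm_sq]
      exact_mod_cast h2
    have h3' : c * conj c - d * conj d = x 0 - x 3 := by
      rw [Complex.mul_conj, Complex.mul_conj, Complex.normSq_eq_norm_sq, Complex.normSq_eq_norm_sq]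
      exact_mod_cast h3
    simp at h5
    ext i j
    fin_cases i <;> fin_cases j <;>
      simp [e3, herm, Matrix.mul_apply, Fin.sum_univ_two]
    · linear_combination h2'
    · linear_combination h4
    · linear_combination h5
    · linear_combination h3'
  simp only [lorentz] at hx
  have hn : ∀ r : ℝ, ‖(r : ℂ)‖ ^ 2 = r ^ 2 := fun r => by
    rw [Complex.norm_real, Real.norm_eq_abs, sq_abs]
  have hβ : ‖(x 1 + Complex.I * x 2 : ℂ)‖ ^ 2 = x 1 ^ 2 + x 2 ^ 2 := by
    rw [← Complex.normSq_eq_norm_sq, Complex.normSq_apply]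
    simp
    ring
  -- The lower right entry `|c|² - |d|²` selects the second row of `K`: `(0, s)` or `(s, 0)` with
  -- `s` a square root when it is nonzero, and `(1, β̄)` when it is zero, where `β`, the upper right
  -- entry, has modulus 1.
  rcases lt_trichotomy (x 0 - x 3) 0 with hr | hr | hr
  · have hs := Real.sq_sqrt (neg_pos.2 hr).le
    have hs0 : (Real.sqrt (-(x 0 - x 3)) : ℂ) ≠ 0 :=
      Complex.ofReal_ne_zero.2 (Real.sqrt_pos.2 (neg_pos.2 hr)).ne'
    generalize Real.sqrt (-(x 0 - x 3)) = s at hs hs0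
    have hs0' : s ≠ 0 := Complex.ofReal_ne_zero.1 hs0
    refine key (1 / s) (-(x 1 + Complex.I * x 2) / s) 0 s (by field_simp; ring) ?_ ?_ ?_
    · rw [norm_div, norm_div, norm_neg, div_pow, div_pow, hβ, hn]
      simp
      field_simp
      nlinarith
    · rw [hn, hs]
      simp
    · rw [Complex.conj_ofReal]
      field_simp
      simp
  · have hβ1 : ‖(x 1 + Complex.I * x 2 : ℂ)‖ ^ 2 = 1 := by
      rw [hβ]
      linear_combination hx + (x 0 + x 3) * hr
    generalize (x 1 + Complex.I * x 2 : ℂ) = β at *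
    have hββ : β * conj β = 1 := by
      rw [Complex.mul_conj, Complex.normSq_eq_norm_sq, hβ1, Complex.ofReal_one]
    refine key ((1 + ((x 0 + x 3 - 1) / 2 : ℝ)) * β) ((x 0 + x 3 - 1) / 2 : ℝ) 1 (conj β)
      ?_ ?_ ?_ ?_
    · linear_combination (1 + (((x 0 + x 3 - 1) / 2 : ℝ) : ℂ)) * hββ
    · rw [norm_mul, mul_pow, hβ1, hn, ← Complex.ofReal_one, ← Complex.ofReal_add, hn]
      ring
    · rw [Complex.norm_conj, hβ1, hr]
      simp
    · rw [map_one, Complex.conj_conj]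
      ring
  · have hs := Real.sq_sqrt hr.le
    have hs0 : (Real.sqrt (x 0 - x 3) : ℂ) ≠ 0 :=
      Complex.ofReal_ne_zero.2 (Real.sqrt_pos.2 hr).ne'
    generalize Real.sqrt (x 0 - x 3) = s at hs hs0
    have hs0' : s ≠ 0 := Complex.ofReal_ne_zero.1 hs0
    refine key ((x 1 + Complex.I * x 2) / s) (-1 / s) s 0 (by field_simp; ring) ?_ ?_ ?_
    · rw [norm_div, norm_div, norm_neg, div_pow, div_pow, hβ, hn]
      simp
      field_simp
      nlinarith
    · rw [hn, hs]
      simp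
    · rw [Complex.conj_ofReal]
      field_simp
      simp

/-- Let `A = f_z f⁻¹` and solve `G' = -G A` with `G z₀ = 1`. Then `G f G^*` has derivative zero and
equals `f z₀ = K e₃ K^*`, so `F = G⁻¹ K` lifts `f`. It satisfies `F' = A F`, and `F'` inherits rank
one from `A`. -/
theorem exists_local_lift {z₀ : ℂ} (h : ∀ᶠ z in 𝓝 z₀, IsFaceEquation f z) :
    ∃ F : ℂ → Matrix (Fin 2) (Fin 2) ℂ, ∀ᶠ z in 𝓝 z₀, (F z).det = 1 ∧
      F z * e3 * (F z)ᴴ = herm (f z) ∧ ∃ D : Matrix (Fin 2) (Fin 2) ℂ, D ≠ 0 ∧ D.det = 0 ∧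
        ∀ i j, HasDerivAt (fun z => F z i j) (D i j) z := by
  have hA : ∀ i j, AnalyticAt ℂ (fun z => -liftCoeff f z i j) z₀ := by
    intro i j
    refine Complex.analyticAt_iff_eventually_differentiableAt.2 (h.mono fun z hz => ?_)
    exact (HasDerivAt.matrix_apply hz.differentiableAt_liftCoeff.hasDerivAt i j).neg.differentiableAt
  have htr : ∀ᶠ z in 𝓝 z₀, -liftCoeff f z 0 0 + -liftCoeff f z 1 1 = 0 :=
    (eventually_eventually_nhds.2 h).mono fun z hz => by linear_combination -trace_liftCoeff hz
  obtain ⟨G, hG0, hG⟩ := exists_local_matrix_solution hA htr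
  have hofneg : ∀ z, (Matrix.of fun i j => -liftCoeff f z i j) = -liftCoeff f z := fun z => rfl
  simp only [hofneg] at hG
  obtain ⟨K, hK, hKx⟩ := exists_mul_e3_mul h.self_of_nhds.unit
  have hR : ∀ᶠ z in 𝓝 z₀, G z * herm (f z) * (G z)ᴴ = herm (f z₀) := by
    have h1 : ∀ᶠ z in 𝓝 z₀, HasFDerivAt (fun z => G z * herm (f z) * (G z)ᴴ)
        (0 : ℂ →L[ℝ] Matrix (Fin 2) (Fin 2) ℂ) z := by
      filter_upwards [h, hG] with z hz hGz
      have h2 := (hasDerivAt_matrix hGz.2).hasFDerivAt.restrictScalars ℝ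
      have h3 := conjTransposeL.hasFDerivAt.comp z h2
      have h4 := hermL.hasFDerivAt.comp z (hz.smooth.differentiableAt (by simp)).hasFDerivAt
      refine ((h2.mul' h4).mul' h3).congr_fderiv ?_
      ext1 v
      change (G z * herm (f z)) * (v • (G z * -liftCoeff f z))ᴴ +
        (G z * herm (fderiv ℝ f z v) + (v • (G z * -liftCoeff f z)) * herm (f z)) * (G z)ᴴ = 0
      rw [herm_fderiv_eq hz.unit]
      simp only [Matrix.conjTranspose_smul, Matrix.conjTranspose_mul, Matrix.conjTranspose_neg,
        conjTranspose_herm, mul_add, add_mul, mul_assoc, smul_mul_assoc, mul_smul_comm, neg_mul,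
        mul_neg, smul_neg]
      abel
    filter_upwards [eventually_eq_of_fderiv_zero h1] with z hz
    rw [hz, hG0]
    simp
  refine ⟨fun z => (G z).adjugate * K, ?_⟩
  filter_upwards [h, hG, hR, eventually_eventually_nhds.2 h] with z hz hGz hRz hev
  have hinv : (G z).adjugate * G z = 1 := by rw [Matrix.adjugate_mul, hGz.1, one_smul]
  refine ⟨?_, ?_, liftCoeff f z * ((G z).adjugate * K), ?_, ?_, ?_⟩
  · rw [Matrix.det_mul, hK, Matrix.det_adjugate, hGz.1]
    simp
  · rw [Matrix.conjTranspose_mul]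
    calc (G z).adjugate * K * e3 * (Kᴴ * (G z).adjugateᴴ)
        = (G z).adjugate * (K * e3 * Kᴴ) * (G z).adjugateᴴ := by simp only [mul_assoc]
      _ = ((G z).adjugate * G z) * herm (f z) * ((G z).adjugate * G z)ᴴ := by
          rw [hKx, ← hRz, Matrix.conjTranspose_mul]
          simp only [mul_assoc]
      _ = herm (f z) := by rw [hinv]; simp
  · intro h0
    have hK' : K * K.adjugate = 1 := by rw [Matrix.mul_adjugate, hK, one_smul]
    have h1 : liftCoeff f z = liftCoeff f z * ((G z).adjugate * K) * (K.adjugate * G z) := by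
      rw [mul_assoc, mul_assoc, ← mul_assoc K, hK', one_mul, hinv, mul_one]
    rw [h0, zero_mul] at h1
    exact hz.liftCoeff_ne_zero h1
  · rw [Matrix.det_mul, hz.det_liftCoeff, zero_mul]
  · intro i j
    have h1 := adjugateL.hasFDerivAt.comp_hasDerivAt z (hasDerivAt_matrix hGz.2)
    -- A traceless 2×2 matrix has adjugate equal to its negative.
    have h2 : (G z * -liftCoeff f z).adjugate = liftCoeff f z * (G z).adjugate := by
      have htr := trace_liftCoeff hev
      rw [Matrix.adjugate_mul_distrib]
      congr 1
      ext i j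
      fin_cases i <;> fin_cases j <;> simp [Matrix.adjugate_fin_two]
      · linear_combination -htr
      · linear_combination -htr
    have h3 := h1.mul_const K
    refine HasDerivAt.matrix_apply (h3.congr_deriv ?_) i j
    rw [← mul_assoc]
    exact congrArg (fun A => A * K) h2

end LocalLift

/-! ### Two facts of complex analysis -/

/-- A holomorphic local homeomorphism of the plane has nonvanishing derivative. -/
lemma deriv_ne_zero_of_openPartialHomeomorph (e : OpenPartialHomeomorph ℂ ℂ) {z : ℂ}
    (hz : z ∈ e.source) (he : AnalyticAt ℂ e z) : deriv e z ≠ 0 := by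
  have hinv : ∀ x ∈ e.source, AnalyticAt ℂ e x → deriv e x ≠ 0 →
      DifferentiableAt ℂ e.symm (e x) := by
    intro x hx hex h0
    have h1 : HasDerivAt e (deriv e x) (e.symm (e x)) := by
      rw [e.left_inv hx]
      exact hex.differentiableAt.hasDerivAt
    exact (e.hasDerivAt_symm (e.map_source hx) h0 h1).differentiableAt
  have hd : DifferentiableAt ℂ e.symm (e z) := by
    rcases he.deriv.eventually_eq_zero_or_eventually_ne_zero with h | h
    · exfalso
      have h1 : ∀ᶠ x in 𝓝 z, e x = e z := eventually_eq_of_hasDerivAt_zero <| by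
        filter_upwards [h, he.eventually_analyticAt] with x hx hex
        rw [← hx]
        exact hex.differentiableAt.hasDerivAt
      have h2 : ∀ᶠ x in 𝓝 z, x = z := by
        filter_upwards [h1, e.open_source.mem_nhds hz] with x hx hxs
        exact e.injOn hxs hz hx
      have h3 : ∀ᶠ x in 𝓝[≠] z, x = z := h2.filter_mono nhdsWithin_le_nhds
      obtain ⟨x, hx, hx'⟩ := (h3.and self_mem_nhdsWithin).exists
      exact hx' hx
    -- Zeros of the derivative are isolated, so the inverse is holomorphic off one point and
    -- continuous there. It extends holomorphically, and the chain rule excludes a zero.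
    · refine (Complex.analyticAt_of_differentiable_on_punctured_nhds_of_continuousAt ?_
        (e.symm.continuousAt (e.map_source hz))).differentiableAt
      have h1 : Filter.Tendsto e.symm (𝓝[≠] (e z)) (𝓝[≠] z) := by
        have h2 := e.symm.continuousAt (e.map_source hz)
        rw [ContinuousAt, e.left_inv hz] at h2
        refine tendsto_nhdsWithin_iff.2 ⟨h2.mono_left nhdsWithin_le_nhds, ?_⟩
        filter_upwards [self_mem_nhdsWithin,
          nhdsWithin_le_nhds (e.open_target.mem_nhds (e.map_source hz))] with y hy hyt h3
        have h4 : e.symm y = z := h3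
        exact hy (by rw [← h4, e.right_inv hyt]; rfl)
      filter_upwards [h1.eventually h, h1.eventually (he.eventually_analyticAt.filter_mono
        nhdsWithin_le_nhds), nhdsWithin_le_nhds (e.open_target.mem_nhds (e.map_source hz))]
        with y h2 h3 hy
      have h4 := hinv _ (e.map_target hy) h3 h2
      rwa [e.right_inv hy] at h4
  intro h0
  have h1 : HasDerivAt (e.symm ∘ e) (deriv e.symm (e z) * deriv e z) z :=
    hd.hasDerivAt.comp z he.differentiableAt.hasDerivAt
  have h2 : HasDerivAt (e.symm ∘ e) 1 z := (hasDerivAt_id z).congr_of_eventuallyEq <| by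
    filter_upwards [e.open_source.mem_nhds hz] with x hx
    exact e.left_inv hx
  have h3 := h1.unique h2
  rw [h0, mul_zero] at h3
  exact zero_ne_one h3

/-- A holomorphic function whose conjugate is holomorphic is locally constant. -/
lemma eventually_eq_of_analyticAt_conj {a : ℂ → ℂ} {z : ℂ} (h1 : AnalyticAt ℂ a z)
    (h2 : AnalyticAt ℂ (fun x => conj (a x)) z) : ∀ᶠ x in 𝓝 z, a x = a z := by
  refine eventually_eq_of_hasDerivAt_zero ?_
  filter_upwards [h1.eventually_analyticAt, h2.eventually_analyticAt] with x hx hx'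
  have h3 := hx.differentiableAt.hasDerivAt
  have h4 := hx'.differentiableAt.hasDerivAt
  have h5 := Complex.conjCLE.toContinuousLinearMap.hasFDerivAt.comp x
    (h3.hasFDerivAt.restrictScalars ℝ)
  -- The real derivative of the conjugate function is at once conjugate linear and complex linear;
  -- comparing its values at 1 and `i` gives zero.
  have h6 : ∀ v : ℂ, conj (v * deriv a x) = v * deriv (fun x => conj (a x)) x := fun v =>
    congrArg (fun L : ℂ →L[ℝ] ℂ => L v) (h5.unique (h4.hasFDerivAt.restrictScalars ℝ))
  have h7 := h6 1
  have h8 := h6 Complex.I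
  rw [one_mul, one_mul] at h7
  rw [← h7, map_mul, Complex.conj_I] at h8
  have h9 : conj (deriv a x) = 0 := by
    have h10 : (2 * Complex.I) * conj (deriv a x) = 0 := by linear_combination -h8
    exact (mul_eq_zero.1 h10).resolve_left (mul_ne_zero two_ne_zero Complex.I_ne_zero)
  rw [(map_eq_zero _).1 h9] at h3
  exact h3

/-! ### Local lifts on the surface -/

section Surface

variable {S : Type*} [TopologicalSpace S] [ChartedSpace ℂ S] [IsManifold 𝓘(ℂ) ω S]
  {f : S → L4} {p : S}

omit [TopologicalSpace S] [ChartedSpace ℂ S] [IsManifold 𝓘(ℂ) ω S] in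
lemma faceOf_eq_iff {F : S → Matrix.SpecialLinearGroup (Fin 2) ℂ} {x : L4} {q : S} :
    faceOf F q = x ↔ (F q).1 * e3 * (F q).1ᴴ = herm x := by
  rw [faceOf, Equiv.symm_apply_eq, Subtype.ext_iff]
  rfl

/-- `F` is, at `q`, a null holomorphic immersion over the surface `f`. -/
structure IsLiftAt (f : S → L4) (F : S → Matrix.SpecialLinearGroup (Fin 2) ℂ) (q : S) : Prop where
  hol : MatHolAt F q
  face : faceOf F q = f q
  ne_zero : ∀ v : ℂ, v ≠ 0 → matDiff F q v ≠ 0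
  det : ∀ v : ℂ, (matDiff F q v).det = 0

/-- Bryant's representation, locally. -/
theorem exists_isLiftAt (hf : IsCMC1Face f)
    (hconf : ∀ x, ¬ IsSingularPoint f x → IsConformalAt f x) (p : S) :
    ∃ F : S → Matrix.SpecialLinearGroup (Fin 2) ℂ, ∀ᶠ q in 𝓝 p, IsLiftAt f F q := by
  have h1 : ∀ᶠ z in 𝓝 (chartAt ℂ p p), IsFaceEquation (f ∘ (chartAt ℂ p).symm) z := by
    filter_upwards [eventually_mem_target p] with z hz
    have h2 := isFaceEquation_of_isCMC1Face hf hconf ((chartAt ℂ p).map_target hz)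
    rwa [(chartAt ℂ p).right_inv hz] at h2
  obtain ⟨F, hF⟩ := exists_local_lift h1
  refine ⟨ofChart p F, ?_⟩
  filter_upwards [eventually_chart (eventually_eventually_nhds.2 hF), eventually_mem_source p]
    with q hq hqs
  have h2 : MatHolAt (ofChart p F) q := matHolAt_ofChart hqs <| hq.mono fun z hz => by
    obtain ⟨hdet, -, D, -, -, hD⟩ := hz
    exact ⟨hdet, fun i j => (hD i j).differentiableAt⟩
  obtain ⟨hdet, hface, D, hD0, hD1, hD⟩ := hq.self_of_nhds
  have h3 := matDiff_eq hqs h2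
  rw [coordDeriv_ofChart hqs (hq.mono fun z hz => hz.1) hD] at h3
  refine ⟨h2, ?_, fun v hv => ?_, fun v => ?_⟩
  · rw [faceOf_eq_iff, ofChart_val hdet, hface, Function.comp_apply, (chartAt ℂ p).left_inv hqs]
  · rw [h3]
    exact smul_ne_zero (mul_ne_zero (chartDeriv_ne_zero hqs) hv) hD0
  · rw [h3, Matrix.det_smul, hD1, mul_zero]

end Surface

/-! ### Pulling back along a holomorphic local homeomorphism -/

section Covering

variable {M : Type*} [TopologicalSpace M] [ChartedSpace ℂ M] [IsManifold 𝓘(ℂ) ω M]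
  {M' : Type*} [TopologicalSpace M'] [ChartedSpace ℂ M'] [IsManifold 𝓘(ℂ) ω M']
  {ϱ : M' → M} {w : M'}

/-- A map of Riemann surfaces in the preferred coordinates. -/
def inCharts (ϱ : M' → M) (w : M') : ℂ → ℂ := chartAt ℂ (ϱ w) ∘ ϱ ∘ (chartAt ℂ w).symm

lemma analyticAt_inCharts (hϱ : MDifferentiable 𝓘(ℂ) 𝓘(ℂ) ϱ) (w : M') :
    AnalyticAt ℂ (inCharts ϱ w) (chartAt ℂ w w) := by
  refine (holAt_iff_analyticAt (h := chartAt ℂ (ϱ w) ∘ ϱ) (mem_chart_source ℂ w)).1 ?_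
  filter_upwards [hϱ.continuous.continuousAt.eventually (eventually_mem_source (ϱ w))] with q hq
  exact (mdifferentiableAt_chart hq).comp q (hϱ q)

lemma deriv_inCharts_ne_zero (hϱ : MDifferentiable 𝓘(ℂ) 𝓘(ℂ) ϱ) (hcov : IsLocalHomeomorph ϱ)
    (w : M') : deriv (inCharts ϱ w) (chartAt ℂ w w) ≠ 0 := by
  obtain ⟨e, he, heq⟩ := hcov w
  have h1 : inCharts ϱ w = ((chartAt ℂ w).symm.trans (e.trans (chartAt ℂ (ϱ w)))) := by
    rw [inCharts, heq]
    rfl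
  have h2 := analyticAt_inCharts hϱ w
  rw [h1] at h2 ⊢
  refine deriv_ne_zero_of_openPartialHomeomorph _ ?_ h2
  have h3 : e w = ϱ w := by rw [heq]
  simp [he, h3]

omit [IsManifold 𝓘(ℂ) ω M] [IsManifold 𝓘(ℂ) ω M'] in
lemma comp_symm_eventuallyEq {E : Type*} (hϱ : ContinuousAt ϱ w) (h : M → E) :
    (h ∘ ϱ) ∘ (chartAt ℂ w).symm =ᶠ[𝓝 (chartAt ℂ w w)]
      (h ∘ (chartAt ℂ (ϱ w)).symm) ∘ inCharts ϱ w := by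
  filter_upwards [eventually_chart_symm (hϱ.eventually (eventually_mem_source (ϱ w)))] with z hz
  simp [inCharts, (chartAt ℂ (ϱ w)).left_inv hz]

omit [IsManifold 𝓘(ℂ) ω M] [IsManifold 𝓘(ℂ) ω M'] in
lemma inCharts_self (ϱ : M' → M) (w : M') :
    inCharts ϱ w (chartAt ℂ w w) = chartAt ℂ (ϱ w) (ϱ w) := by
  simp [inCharts, (chartAt ℂ w).left_inv (mem_chart_source ℂ w)]

lemma holAt_comp (hϱ : MDifferentiable 𝓘(ℂ) 𝓘(ℂ) ϱ) {h : M → ℂ} (hh : HolAt h (ϱ w)) :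
    HolAt (h ∘ ϱ) w ∧ ∀ v : ℂ, complexDiff (h ∘ ϱ) w v =
      complexDiff h (ϱ w) (deriv (inCharts ϱ w) (chartAt ℂ w w) * v : ℂ) := by
  have h1 : HolAt (h ∘ ϱ) w := by
    filter_upwards [hϱ.continuous.continuousAt.eventually hh] with q hq
    exact hq.comp q (hϱ q)
  refine ⟨h1, fun v => ?_⟩
  have h2 := ((holAt_iff_analyticAt (mem_chart_source ℂ (ϱ w))).1 hh).differentiableAt.hasDerivAt
  rw [← inCharts_self] at h2
  have h3 := (h2.comp _ (analyticAt_inCharts hϱ w).differentiableAt.hasDerivAt).congr_of_eventuallyEq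
    (comp_symm_eventuallyEq hϱ.continuous.continuousAt h)
  rw [complexDiff_eq_deriv_self h1.mdifferentiableAt, complexDiff_eq_deriv_self hh.mdifferentiableAt,
    h3.deriv, inCharts_self, mul_assoc]

lemma diff_comp (hϱ : MDifferentiable 𝓘(ℂ) 𝓘(ℂ) ϱ) {f : M → L4}
    (hf : MDifferentiableAt 𝓘(ℝ, ℂ) 𝓘(ℝ, L4) f (ϱ w)) (v : ℂ) : diff (f ∘ ϱ) w v =
      diff f (ϱ w) (deriv (inCharts ϱ w) (chartAt ℂ w w) * v : ℂ) := by
  have h2 := ((mdifferentiableAt_iff_chart (mem_chart_source ℂ (ϱ w))).1 hf).hasFDerivAt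
  have h4 := tderiv_eq_of_hasFDerivAt h2
  rw [← inCharts_self] at h2
  have h3 := (h2.comp _ ((analyticAt_inCharts hϱ w).differentiableAt.hasDerivAt.hasFDerivAt
    |>.restrictScalars ℝ)).congr_of_eventuallyEq
    (comp_symm_eventuallyEq hϱ.continuous.continuousAt f)
  rw [diff_eq_tderiv, diff_eq_tderiv, h4, tderiv_eq_of_hasFDerivAt h3, inCharts_self, mul_comm]
  rfl

lemma IsLiftAt.comp (hϱ : MDifferentiable 𝓘(ℂ) 𝓘(ℂ) ϱ) (hcov : IsLocalHomeomorph ϱ) {f : M → L4}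
    {F : M → Matrix.SpecialLinearGroup (Fin 2) ℂ} (hF : IsLiftAt f F (ϱ w)) :
    IsLiftAt (f ∘ ϱ) (F ∘ ϱ) w := by
  have h1 : ∀ v : ℂ, matDiff (F ∘ ϱ) w v =
      matDiff F (ϱ w) (deriv (inCharts ϱ w) (chartAt ℂ w w) * v : ℂ) := by
    intro v
    ext i j
    exact (holAt_comp hϱ (hF.hol i j)).2 v
  refine ⟨fun i j => (holAt_comp hϱ (hF.hol i j)).1, hF.face, fun v hv => ?_, fun v => ?_⟩
  · rw [h1]
    exact hF.ne_zero _ (mul_ne_zero (deriv_inCharts_ne_zero hϱ hcov w) hv)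
  · rw [h1]
    exact hF.det _

end Covering

/-! ### Uniqueness of lifts up to SU(1,1), and gluing -/

/-- The elements of `SL(2, ℂ)` preserving `e₃` form the group `SU(1, 1)`. -/
lemma entries_of_mul_e3_mul {V : Matrix.SpecialLinearGroup (Fin 2) ℂ}
    (h : V.1 * e3 * V.1ᴴ = e3) : V 1 1 = conj (V 0 0) ∧ V 1 0 = conj (V 0 1) := by
  have hdet := V.det_coe
  rw [Matrix.det_fin_two] at hdet
  have h00 := congrFun (congrFun h 0) 0
  have h01 := congrFun (congrFun h 0) 1
  have h10 := congrFun (congrFun h 1) 0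
  have h11 := congrFun (congrFun h 1) 1
  simp [e3, Matrix.mul_apply, Fin.sum_univ_two] at h00 h01 h10 h11
  change V 0 0 * V 1 1 - V 0 1 * V 1 0 = 1 at hdet
  constructor
  · linear_combination (-V 1 1) * h00 + conj (V 0 0) * hdet + V 0 1 * h10
  · have hdet' := congrArg conj hdet
    simp only [map_sub, map_mul, map_one] at hdet'
    linear_combination (-V 1 0) * hdet' + conj (V 1 1) * h10 - conj (V 0 1) * h11

lemma mul_e3_mul_congr {A B K : Matrix.SpecialLinearGroup (Fin 2) ℂ} (h : A = B * K) :
    A.1 * e3 * A.1ᴴ = B.1 * e3 * B.1ᴴ ↔ K.1 * e3 * K.1ᴴ = e3 := by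
  have h3 : (B⁻¹).1 * B.1 = 1 := congrArg Subtype.val (inv_mul_cancel B)
  have h4 : A.1 * e3 * A.1ᴴ = B.1 * (K.1 * e3 * K.1ᴴ) * B.1ᴴ := by
    rw [h, show (B * K).1 = B.1 * K.1 from rfl, Matrix.conjTranspose_mul]
    simp only [mul_assoc]
  rw [h4]
  constructor
  · intro h5
    have h6 := congrArg (fun X => (B⁻¹).1 * X * ((B⁻¹).1)ᴴ) h5
    calc K.1 * e3 * K.1ᴴ = ((B⁻¹).1 * B.1) * (K.1 * e3 * K.1ᴴ) * ((B⁻¹).1 * B.1)ᴴ := by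
          rw [h3]; simp
      _ = ((B⁻¹).1 * B.1) * e3 * ((B⁻¹).1 * B.1)ᴴ := by
          rw [Matrix.conjTranspose_mul]
          simpa only [mul_assoc] using h6
      _ = e3 := by rw [h3]; simp
  · intro h5
    rw [h5]

section Surface

variable {S : Type*} [TopologicalSpace S] [ChartedSpace ℂ S] [IsManifold 𝓘(ℂ) ω S]
  {f : S → L4} {F G : S → Matrix.SpecialLinearGroup (Fin 2) ℂ} {p : S}

lemma HolAt.fun_mul {a b : S → ℂ} (ha : HolAt a p) (hb : HolAt b p) :
    HolAt (fun q => a q * b q) p := by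
  rw [holAt_iff_analyticAt (mem_chart_source ℂ p)] at *
  exact ha.mul hb

lemma HolAt.fun_sub {a b : S → ℂ} (ha : HolAt a p) (hb : HolAt b p) :
    HolAt (fun q => a q - b q) p := by
  rw [holAt_iff_analyticAt (mem_chart_source ℂ p)] at *
  exact ha.sub hb

lemma HolAt.fun_neg {a : S → ℂ} (ha : HolAt a p) : HolAt (fun q => -a q) p := by
  rw [holAt_iff_analyticAt (mem_chart_source ℂ p)] at *
  exact ha.neg

lemma HolAt.fun_div {a b : S → ℂ} (ha : HolAt a p) (hb : HolAt b p) (h0 : b p ≠ 0) :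
    HolAt (fun q => a q / b q) p := by
  rw [holAt_iff_analyticAt (mem_chart_source ℂ p)] at *
  refine ha.div hb ?_
  simpa [(chartAt ℂ p).left_inv (mem_chart_source ℂ p)] using h0

lemma eventually_eq_of_holAt_conj {a : S → ℂ} (h1 : HolAt a p) (h2 : HolAt (fun q => conj (a q)) p) :
    ∀ᶠ q in 𝓝 p, a q = a p := by
  have hp := mem_chart_source ℂ p
  rw [holAt_iff_analyticAt hp] at h1 h2
  rw [eventually_nhds_iff_chart hp]
  refine (eventually_eq_of_analyticAt_conj h1 h2).mono fun z hz => ?_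
  simpa [(chartAt ℂ p).left_inv hp] using hz

lemma MatHolAt.inv_mul (hF : MatHolAt F p) (hG : MatHolAt G p) :
    MatHolAt (fun q => (F q)⁻¹ * G q) p := by
  have h : ∀ q i j, ((F q)⁻¹ * G q) i j =
      ![F q 1 1 * G q 0 j - F q 0 1 * G q 1 j, F q 0 0 * G q 1 j - F q 1 0 * G q 0 j] i := by
    intro q i j
    rw [Matrix.SpecialLinearGroup.coe_mul, Matrix.SpecialLinearGroup.coe_inv,
      Matrix.adjugate_fin_two]
    fin_cases i <;> simp [Matrix.mul_apply, Fin.sum_univ_two] <;> ring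
  intro i j
  simp only [h]
  fin_cases i
  · exact ((hF 1 1).fun_mul (hG 0 j)).fun_sub ((hF 0 1).fun_mul (hG 1 j))
  · exact ((hF 0 0).fun_mul (hG 1 j)).fun_sub ((hF 1 0).fun_mul (hG 0 j))

omit [TopologicalSpace S] [ChartedSpace ℂ S] [IsManifold 𝓘(ℂ) ω S] in
lemma herm_faceOf (F : S → Matrix.SpecialLinearGroup (Fin 2) ℂ) (q : S) :
    herm (faceOf F q) = (F q).1 * e3 * (F q).1ᴴ := (faceOf_eq_iff.1 rfl).symm

/-- Two holomorphic lifts of the same surface differ by a constant. -/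
lemma eventually_inv_mul_eq (hF : ∀ᶠ q in 𝓝 p, IsLiftAt f F q)
    (hG : ∀ᶠ q in 𝓝 p, IsLiftAt f G q) :
    ∀ᶠ q in 𝓝 p, (F q)⁻¹ * G q = (F p)⁻¹ * G p := by
  have hV := hF.self_of_nhds.hol.inv_mul hG.self_of_nhds.hol
  have h1 : ∀ᶠ q in 𝓝 p, ((F q)⁻¹ * G q) 1 1 = conj (((F q)⁻¹ * G q) 0 0) ∧
      ((F q)⁻¹ * G q) 1 0 = conj (((F q)⁻¹ * G q) 0 1) := by
    filter_upwards [hF, hG] with q hFq hGq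
    refine entries_of_mul_e3_mul ?_
    have h2 : (G q).1 * e3 * (G q).1ᴴ = (F q).1 * e3 * (F q).1ᴴ := by
      rw [← herm_faceOf, ← herm_faceOf, hFq.face, hGq.face]
    have h3 : ((F q)⁻¹).1 * (F q).1 = 1 := congrArg Subtype.val (inv_mul_cancel (F q))
    calc ((F q)⁻¹ * G q).1 * e3 * (((F q)⁻¹ * G q).1)ᴴ
        = ((F q)⁻¹).1 * ((G q).1 * e3 * (G q).1ᴴ) * (((F q)⁻¹).1)ᴴ := by
          rw [show ((F q)⁻¹ * G q).1 = ((F q)⁻¹).1 * (G q).1 from rfl, Matrix.conjTranspose_mul]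
          simp only [mul_assoc]
      _ = (((F q)⁻¹).1 * (F q).1) * e3 * (((F q)⁻¹).1 * (F q).1)ᴴ := by
          rw [h2, Matrix.conjTranspose_mul]
          simp only [mul_assoc]
      _ = e3 := by rw [h3]; simp
  -- Entries of an SU(1,1)-valued map are conjugate in pairs. Here both members of each pair are
  -- holomorphic, so both are constant.
  have hc : ∀ i j i' j', (∀ᶠ q in 𝓝 p, ((F q)⁻¹ * G q) i' j' = conj (((F q)⁻¹ * G q) i j)) →
      ∀ᶠ q in 𝓝 p, ((F q)⁻¹ * G q) i j = ((F p)⁻¹ * G p) i j ∧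
        ((F q)⁻¹ * G q) i' j' = ((F p)⁻¹ * G p) i' j' := by
    intro i j i' j' h
    have h2 : HolAt (fun q => conj (((F q)⁻¹ * G q) i j)) p := by
      filter_upwards [hV i' j', eventually_eventually_nhds.2 h] with q hq hq'
      exact hq.congr_of_eventuallyEq (hq'.mono fun x hx => hx.symm)
    filter_upwards [eventually_eq_of_holAt_conj (hV i j) h2, h] with q h3 h4
    exact ⟨h3, by rw [h4, h3, h.self_of_nhds]⟩
  filter_upwards [hc 0 0 1 1 (h1.mono fun q hq => hq.1), hc 0 1 1 0 (h1.mono fun q hq => hq.2)]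
    with q h2 h3
  ext i j
  fin_cases i <;> fin_cases j
  exacts [h2.1, h3.1, h3.2, h2.2]

lemma matDiff_mul_const {K : Matrix.SpecialLinearGroup (Fin 2) ℂ}
    (h : ∀ᶠ x in 𝓝 p, F x = G x * K) (hG : MatHolAt G p) :
    MatHolAt F p ∧ ∀ v : ℂ, matDiff F p v = matDiff G p v * K.1 := by
  have hp := mem_chart_source ℂ p
  have h1 : ∀ i j, ((fun q => F q i j) ∘ (chartAt ℂ p).symm) =ᶠ[𝓝 (chartAt ℂ p p)]
      fun z => G ((chartAt ℂ p).symm z) i 0 * K 0 j + G ((chartAt ℂ p).symm z) i 1 * K 1 j := by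
    intro i j
    filter_upwards [eventually_chart_symm h] with z hz
    simp [hz, Matrix.mul_apply, Fin.sum_univ_two]
  have h2 := fun i j => (holAt_iff_analyticAt hp).1 (hG i j)
  have hF : MatHolAt F p := fun i j => (holAt_iff_analyticAt hp).2
    ((((h2 i 0).mul analyticAt_const).add ((h2 i 1).mul analyticAt_const)).congr (h1 i j).symm)
  refine ⟨hF, fun v => ?_⟩
  rw [matDiff_self hF, matDiff_self hG, smul_mul_assoc]
  congr 1
  ext i j
  simp only [coordDeriv, Matrix.of_apply, Matrix.mul_apply, Fin.sum_univ_two]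
  have h3 := hasDerivAt_coordDeriv hp hG
  exact (((h3 i 0).mul_const _).add ((h3 i 1).mul_const _) |>.congr_of_eventuallyEq (h1 i j)).deriv

lemma IsLiftAt.mul_const {K : Matrix.SpecialLinearGroup (Fin 2) ℂ} (hK : K.1 * e3 * K.1ᴴ = e3)
    (h : ∀ᶠ x in 𝓝 p, F x = G x * K) (hG : IsLiftAt f G p) : IsLiftAt f F p := by
  obtain ⟨h1, h2⟩ := matDiff_mul_const h hG.hol
  have hKinv : K.1 * (K⁻¹).1 = 1 := congrArg Subtype.val (mul_inv_cancel K)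
  refine ⟨h1, ?_, fun v hv h0 => hG.ne_zero v hv ?_, fun v => ?_⟩
  · rw [faceOf_eq_iff, (mul_e3_mul_congr h.self_of_nhds).2 hK, ← herm_faceOf, hG.face]
  · rw [h2] at h0
    have h3 := congrArg (fun A => A * (K⁻¹).1) h0
    simpa only [mul_assoc, hKinv, mul_one, zero_mul] using h3
  · rw [h2, Matrix.det_mul, hG.det, zero_mul]

/-- The local lifts of a surface over a simply connected Riemann surface fit together. -/
theorem exists_forall_isLiftAt [SimplyConnectedSpace S]
    (h : ∀ p, ∃ F : S → Matrix.SpecialLinearGroup (Fin 2) ℂ, ∀ᶠ q in 𝓝 p, IsLiftAt f F q)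
    (w₀ : S) : ∃ F : S → Matrix.SpecialLinearGroup (Fin 2) ℂ, ∀ p, IsLiftAt f F p := by
  have : LocallyPathConnectedSpace S := ChartedSpace.locallyPathConnectedSpace ℂ S
  choose H hH using h
  -- Lifts differ by constant right factors while the gluing theorem handles left factors, so it is
  -- applied to the inverses.
  obtain ⟨φ, hφ0, hφ⟩ := exists_glued_function (fun p => {q | ∀ᶠ x in 𝓝 q, IsLiftAt f (H p) x})
    (fun p => isOpen_setOfPred_eventually_nhds) hH (fun p q => (H p q)⁻¹)
    (fun p p' q hq hq' => by
      simp only [inv_inv]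
      exact eventually_inv_mul_eq hq hq') w₀ (H w₀ w₀)⁻¹
  simp only [inv_inv, Set.mem_ofPred_eq] at hφ
  have hF : ∀ p, ∀ᶠ x in 𝓝 p, (φ x)⁻¹ = H p x * (φ p * H p p)⁻¹ := fun p => by
    filter_upwards [hφ p p (hH p)] with x hx
    rw [← hx]
    group
  have hloc : ∀ p, ∀ᶠ x in 𝓝 p, (faceOf (fun x => (φ x)⁻¹) x = f x ↔
      ((φ p * H p p)⁻¹).1 * e3 * ((φ p * H p p)⁻¹).1ᴴ = e3) := fun p => by
    filter_upwards [hF p, hH p] with x hx hHx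
    rw [← mul_e3_mul_congr hx, faceOf_eq_iff, ← hHx.face, herm_faceOf]
  -- The glued map differs from each local lift by a constant of SL(2,ℂ), not known in advance to
  -- lie in SU(1,1). Whether it does is a locally constant condition, and it holds at `w₀` by the
  -- choice of initial value.
  have hconst : IsLocallyConstant fun x => faceOf (fun x => (φ x)⁻¹) x = f x := by
    rw [IsLocallyConstant.iff_eventually_eq]
    intro p
    filter_upwards [hloc p] with x hx
    rw [hx, (hloc p).self_of_nhds]
  have hall : ∀ p, faceOf (fun x => (φ x)⁻¹) p = f p := by
    intro p
    have h0 : faceOf (fun x => (φ x)⁻¹) w₀ = f w₀ := by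
      rw [(hloc w₀).self_of_nhds, hφ0]
      simp
    exact (hconst.apply_eq_of_isPreconnected isPreconnected_univ (Set.mem_univ w₀)
      (Set.mem_univ p)).mp h0
  exact ⟨fun x => (φ x)⁻¹, fun p =>
    (hH p).self_of_nhds.mul_const (((hloc p).self_of_nhds).1 (hall p)) (hF p)⟩

end Surface

/-! ### Recovering the Weierstrass data from a lift -/

section Surface

variable {S : Type*} [TopologicalSpace S] [ChartedSpace ℂ S] [IsManifold 𝓘(ℂ) ω S]
  {f : S → L4} {F : S → Matrix.SpecialLinearGroup (Fin 2) ℂ} {p q : S}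

/-- The coefficient of `F⁻¹ dF` in the coordinate at `p`. -/
def logDeriv (F : S → Matrix.SpecialLinearGroup (Fin 2) ℂ) (p q : S) :
    Matrix (Fin 2) (Fin 2) ℂ := ((F q)⁻¹).1 * coordDeriv F p (chartAt ℂ p q)

lemma logDeriv_eq_smul (hq : q ∈ (chartAt ℂ p).source) (hF : MatHolAt F q) :
    logDeriv F q q = chartDeriv p q • logDeriv F p q := by
  have h1 := matDiff_self hF 1
  have h2 := matDiff_eq hq hF 1
  rw [one_smul] at h1
  rw [logDeriv, logDeriv, ← h1, h2, mul_one, mul_smul_comm]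

lemma inv_mul_matDiff (hF : MatHolAt F p) (v : ℂ) :
    ((F p)⁻¹).1 * matDiff F p v = v • logDeriv F p p := by
  rw [matDiff_self hF, mul_smul_comm, logDeriv]

lemma holAt_logDeriv (hF : ∀ᶠ q in 𝓝 p, MatHolAt F q) (i j : Fin 2) :
    HolAt (fun q => logDeriv F p q i j) p := by
  have hD : ∀ i j, HolAt (fun q => coordDeriv F p (chartAt ℂ p q) i j) p := fun i j =>
    holAt_comp_chart (k := fun z => coordDeriv F p z i j) (mem_chart_source ℂ p)
      ((holAt_iff_analyticAt (mem_chart_source ℂ p)).1 (hF.self_of_nhds i j)).deriv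
  have h : ∀ q i j, logDeriv F p q i j =
      ![F q 1 1 * coordDeriv F p (chartAt ℂ p q) 0 j - F q 0 1 * coordDeriv F p (chartAt ℂ p q) 1 j,
        F q 0 0 * coordDeriv F p (chartAt ℂ p q) 1 j -
          F q 1 0 * coordDeriv F p (chartAt ℂ p q) 0 j] i := by
    intro q i j
    rw [logDeriv, Matrix.SpecialLinearGroup.coe_inv, Matrix.adjugate_fin_two]
    fin_cases i <;> simp [Matrix.mul_apply, Fin.sum_univ_two] <;> ring
  have hF' := hF.self_of_nhds
  simp only [h]
  fin_cases i
  · exact ((hF' 1 1).fun_mul (hD 0 j)).fun_sub ((hF' 0 1).fun_mul (hD 1 j))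
  · exact ((hF' 0 0).fun_mul (hD 1 j)).fun_sub ((hF' 1 0).fun_mul (hD 0 j))

/-- `F⁻¹ dF` is nilpotent. -/
lemma IsLiftAt.logDeriv_nilpotent (hF : IsLiftAt f F q) (hq : q ∈ (chartAt ℂ p).source) :
    logDeriv F p q 1 1 = -logDeriv F p q 0 0 ∧
    logDeriv F p q 0 0 ^ 2 = -(logDeriv F p q 0 1 * logDeriv F p q 1 0) ∧ logDeriv F p q ≠ 0 := by
  have h0 : ((F q)⁻¹).1.det = 1 := ((F q)⁻¹).det_coe
  have hinv : (F q).1 * ((F q)⁻¹).1 = 1 := congrArg Subtype.val (mul_inv_cancel (F q))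
  have hc := chartDeriv_ne_zero hq
  have h1 := fun v => matDiff_eq hq hF.hol v
  have h11 : logDeriv F p q 1 1 = -logDeriv F p q 0 0 := by
    have h := trace_coordDeriv hq hF.hol
    rw [logDeriv, Matrix.SpecialLinearGroup.coe_inv, Matrix.adjugate_fin_two]
    simp [Matrix.mul_apply, Fin.sum_univ_two]
    linear_combination h
  refine ⟨h11, ?_, ?_⟩
  · have h2 := hF.det 1
    rw [h1, mul_one, Matrix.det_smul] at h2
    have h3 : (coordDeriv F p (chartAt ℂ p q)).det = 0 :=
      (mul_eq_zero.1 h2).resolve_left (pow_ne_zero _ hc)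
    have h4 : (logDeriv F p q).det = 0 := by rw [logDeriv, Matrix.det_mul, h3, mul_zero]
    rw [Matrix.det_fin_two, h11] at h4
    linear_combination -h4
  · intro h2
    refine hF.ne_zero 1 one_ne_zero ?_
    have h3 : coordDeriv F p (chartAt ℂ p q) = (F q).1 * logDeriv F p q := by
      rw [logDeriv, ← mul_assoc, hinv, one_mul]
    rw [h1, h3, h2, mul_zero, smul_zero]

/-- A nonzero nilpotent matrix whose lower left entry vanishes is strictly upper triangular. This is
the situation at a pole of `g`, where the upper right entry serves as denominator. -/
lemma IsLiftAt.logDeriv_of_eq_zero (hF : IsLiftAt f F q) (hC : logDeriv F q q 1 0 = 0) :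
    logDeriv F q q 0 0 = 0 ∧ logDeriv F q q 0 1 ≠ 0 := by
  obtain ⟨h1, h2, h3⟩ := hF.logDeriv_nilpotent (mem_chart_source ℂ q)
  rw [hC, mul_zero, neg_zero] at h2
  have hA := pow_eq_zero_iff two_ne_zero |>.1 h2
  refine ⟨hA, fun hB => h3 ?_⟩
  ext i j
  fin_cases i <;> fin_cases j
  exacts [hA, hB, hC, by simp [h1, hA]]

/-- The secondary Gauss map of a lift. -/
def gaussMap (F : S → Matrix.SpecialLinearGroup (Fin 2) ℂ) (q : S) : OnePoint ℂ :=
  ratio (logDeriv F q q 0 0) (logDeriv F q q 1 0)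

lemma IsLiftAt.logDeriv_of_gaussMap_eq (hF : IsLiftAt f F q) {c : ℂ}
    (hc : gaussMap F q = (c : OnePoint ℂ)) : logDeriv F q q 0 0 = c * logDeriv F q q 1 0 ∧
      logDeriv F q q 0 1 = -c ^ 2 * logDeriv F q q 1 0 := by
  obtain ⟨-, h2, -⟩ := hF.logDeriv_nilpotent (mem_chart_source ℂ q)
  obtain ⟨hC, hA⟩ := ratio_eq_coe hc
  rw [hA] at h2
  have h4 : (logDeriv F q q 0 1 + c ^ 2 * logDeriv F q q 1 0) * logDeriv F q q 1 0 = 0 := by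
    linear_combination h2
  exact ⟨hA, by linear_combination (mul_eq_zero.1 h4).resolve_right hC⟩

/-- The holomorphic form `ω` of a lift. -/
def weierstrassForm (F : S → Matrix.SpecialLinearGroup (Fin 2) ℂ) (q : S) :
    TangentSpace 𝓘(ℂ) q →L[ℂ] ℂ :=
  (logDeriv F q q 1 0 • ContinuousLinearMap.id ℂ ℂ : ℂ →L[ℂ] ℂ)

omit [IsManifold 𝓘(ℂ) ω S] in
lemma weierstrassForm_apply (q : S) (v : ℂ) :
    (weierstrassForm F q v : ℂ) = logDeriv F q q 1 0 * v := rfl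

lemma gaussMap_eq (hq : q ∈ (chartAt ℂ p).source) (hF : MatHolAt F q) :
    gaussMap F q = ratio (logDeriv F p q 0 0) (logDeriv F p q 1 0) := by
  rw [gaussMap, logDeriv_eq_smul hq hF]
  exact ratio_mul_left (chartDeriv_ne_zero hq) _ _

lemma isHolomorphicForm_weierstrassForm (hF : ∀ q, MatHolAt F q) :
    IsHolomorphicForm (weierstrassForm F) := by
  intro p
  refine ⟨fun q => logDeriv F p q 1 0,
    holAt_logDeriv (Filter.Eventually.of_forall hF) 1 0, ?_⟩
  filter_upwards [eventually_mem_source p] with q hq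
  have key : ∀ v : ℂ, (weierstrassForm F q v : ℂ) =
      logDeriv F p q 1 0 * complexDiff (chartAt ℂ p) q v := by
    intro v
    rw [weierstrassForm_apply, complexDiff_chart, logDeriv_eq_smul hq (hF q), Matrix.smul_apply,
      smul_eq_mul]
    ring
  exact key

/-- Name the entries of the first row `A`, `B` and the lower left one `C`, so that `g = A / C` and
`A² = -B C`. Where `C` vanishes `B` does not, and `1 / g = -A / B` is holomorphic. -/
lemma isMeromorphicFunction_gaussMap [PreconnectedSpace S] (hF : ∀ q, IsLiftAt f F q) {w₀ : S}
    (h0 : logDeriv F w₀ w₀ 1 0 ≠ 0) : IsMeromorphicFunction (gaussMap F) := by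
  intro p
  have hF' : ∀ q, MatHolAt F q := fun q => (hF q).hol
  have hL := holAt_logDeriv (p := p) (Filter.Eventually.of_forall hF')
  by_cases hC : logDeriv F p p 1 0 = 0
  · have hB := ((hF p).logDeriv_of_eq_zero hC).2
    have hBev : ∀ᶠ q in 𝓝 p, logDeriv F p q 0 1 ≠ 0 :=
      (hL 0 1).mdifferentiableAt.continuousAt.eventually_ne hB
    have hCA : ∀ q ∈ (chartAt ℂ p).source, logDeriv F p q 0 1 ≠ 0 → logDeriv F p q 1 0 =
        logDeriv F p q 0 0 * (-logDeriv F p q 0 0 / logDeriv F p q 0 1) := by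
      intro q hq hBq
      obtain ⟨-, h4, -⟩ := (hF q).logDeriv_nilpotent hq
      field_simp
      linear_combination h4
    refine ⟨fun q => -logDeriv F p q 0 0 / logDeriv F p q 0 1,
      ((hL 0 0).fun_neg).fun_div (hL 0 1) hB, Or.inr ⟨fun hev => ?_, ?_⟩⟩
    -- If `1 / g` vanished near `p`, then `C = -A² / B` would too, hence everywhere by unique
    -- continuation, against its value at `w₀`. The vanishing of `C` does not depend on the chart
    -- used.
    · refine h0 (forall_of_eventually (T := fun z => z = 0)
        (R := fun q => logDeriv F q q 1 0 = 0)
        (fun k z _ hk => hk.mono fun x hx => by rw [hx, hk.self_of_nhds]) (fun q => ?_) (p₀ := p)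
        ?_ w₀)
      · have hLq := holAt_logDeriv (p := q) (Filter.Eventually.of_forall hF') 1 0
        refine ⟨_, (holAt_iff_analyticAt (mem_chart_source ℂ q)).1 hLq, ?_⟩
        filter_upwards [eventually_mem_source q] with x hx
        rw [Function.comp_apply, (chartAt ℂ q).left_inv hx, logDeriv_eq_smul hx (hF' x),
          Matrix.smul_apply, smul_eq_mul, mul_eq_zero, or_iff_right (chartDeriv_ne_zero hx)]
      · filter_upwards [hev, hBev, eventually_mem_source p] with x hx hBx hxs
        rw [logDeriv_eq_smul hxs (hF' x), Matrix.smul_apply, hCA x hxs hBx, not_not.1 hx, mul_zero,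
          smul_zero]
    · filter_upwards [hBev, eventually_mem_source p] with q hBq hq
      rw [gaussMap_eq hq (hF' q), hCA q hq hBq]
      by_cases hAq : logDeriv F p q 0 0 = 0
      · simp [hAq, ratio]
      · conv_lhs => rw [← mul_one (logDeriv F p q 0 0)]
        rw [mul_one]
        nth_rewrite 1 [← mul_one (logDeriv F p q 0 0)]
        exact ratio_mul_left hAq _ _
  · refine ⟨fun q => logDeriv F p q 0 0 / logDeriv F p q 1 0, (hL 0 0).fun_div (hL 1 0) hC,
      Or.inl ?_⟩
    filter_upwards [(hL 1 0).mdifferentiableAt.continuousAt.eventually_ne hC,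
      eventually_mem_source p] with q hCq hq
    rw [gaussMap_eq hq (hF' q), ratio, if_neg hCq]

/-- The square of the norm of `F⁻¹ dF`. -/
def logNorm (A : Matrix (Fin 2) (Fin 2) ℂ) : ℝ := 2 * ‖A 0 0‖ ^ 2 + ‖A 0 1‖ ^ 2 + ‖A 1 0‖ ^ 2

lemma logNorm_smul (c : ℂ) (A : Matrix (Fin 2) (Fin 2) ℂ) :
    logNorm (c • A) = ‖c‖ ^ 2 * logNorm A := by
  simp [logNorm, mul_pow]
  ring

/-- The extension over the poles is the squared norm of `F⁻¹ dF`, positive because this form has no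
zeros. Where `g` is finite its entries are `g, -g², 1, -g` times `ω`, and the squares add up to `(1
+ |g|²)² |ω|²`. -/
lemma hatMetricIsRiemannian_gaussMap (hF : ∀ q, IsLiftAt f F q) :
    HatMetricIsRiemannian (gaussMap F) (weierstrassForm F) := by
  have hF' : ∀ q, MatHolAt F q := fun q => (hF q).hol
  refine ⟨fun q (v w : ℂ) => logNorm (logDeriv F q q) * (v * conj w).re, ⟨?_, ?_⟩, ?_⟩
  · rintro q -
    have key : ∀ v : ℂ, v ≠ 0 → 0 < logNorm (logDeriv F q q) * (v * conj v).re := by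
      intro v hv
      obtain ⟨h1, h2, h3⟩ := (hF q).logDeriv_nilpotent (mem_chart_source ℂ q)
      rw [Complex.mul_conj, Complex.ofReal_re]
      refine mul_pos ?_ (Complex.normSq_pos.2 hv)
      have h4 : 0 ≤ logNorm (logDeriv F q q) := by unfold logNorm; positivity
      refine lt_of_le_of_ne h4 fun h5 => h3 ?_
      unfold logNorm at h5
      have e00 : ‖logDeriv F q q 0 0‖ ^ 2 = 0 := by
        nlinarith [sq_nonneg ‖logDeriv F q q 0 0‖, sq_nonneg ‖logDeriv F q q 0 1‖,
          sq_nonneg ‖logDeriv F q q 1 0‖]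
      have e01 : ‖logDeriv F q q 0 1‖ ^ 2 = 0 := by
        nlinarith [sq_nonneg ‖logDeriv F q q 0 0‖, sq_nonneg ‖logDeriv F q q 0 1‖,
          sq_nonneg ‖logDeriv F q q 1 0‖]
      have e10 : ‖logDeriv F q q 1 0‖ ^ 2 = 0 := by
        nlinarith [sq_nonneg ‖logDeriv F q q 0 0‖, sq_nonneg ‖logDeriv F q q 0 1‖,
          sq_nonneg ‖logDeriv F q q 1 0‖]
      simp at e00 e01 e10
      ext i j
      fin_cases i <;> fin_cases j
      exacts [e00, e01, e10, by simp [h1, e00]]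
    exact key
  · rintro p -
    have hE : ContMDiffAt 𝓘(ℝ, ℂ) 𝓘(ℝ) ∞ (fun q => logNorm (logDeriv F p q)) p := by
      have hL := fun i j => (holAt_logDeriv (p := p) (Filter.Eventually.of_forall hF') i j).contMDiffAt ∞
      have h1 : ∀ i j, ContMDiffAt 𝓘(ℝ, ℂ) 𝓘(ℝ) ∞ (fun q => ‖logDeriv F p q i j‖ ^ 2) p :=
        fun i j => ContDiffAt.comp_contMDiffAt (g := fun x : ℂ => ‖x‖ ^ 2)
          (f := fun q => logDeriv F p q i j) (contDiff_id.norm_sq ℝ).contDiffAt (hL i j)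
      exact ((contMDiffAt_const.mul (h1 0 0)).add (h1 0 1)).add (h1 1 0)
    refine ⟨_, fun _ => 0, _, hE, contMDiffAt_const, hE, ?_⟩
    filter_upwards [eventually_mem_source p] with q hq
    have key : ∀ v w : ℂ, logNorm (logDeriv F q q) * (v * conj w).re =
        logNorm (logDeriv F p q) *
          ((tderiv ℝ (chartAt ℂ p) q v).re * (tderiv ℝ (chartAt ℂ p) q w).re) +
        0 * ((tderiv ℝ (chartAt ℂ p) q v).re * (tderiv ℝ (chartAt ℂ p) q w).im +
            (tderiv ℝ (chartAt ℂ p) q v).im * (tderiv ℝ (chartAt ℂ p) q w).re) +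
        logNorm (logDeriv F p q) *
          ((tderiv ℝ (chartAt ℂ p) q v).im * (tderiv ℝ (chartAt ℂ p) q w).im) := by
      intro v w
      rw [tderiv_real_chart hq, tderiv_real_chart hq, logDeriv_eq_smul hq (hF' q), logNorm_smul,
        ← Complex.normSq_eq_norm_sq, Complex.normSq_apply]
      generalize chartDeriv p q = c
      simp
      ring
    exact key
  · intro q c hc
    obtain ⟨hA, hB⟩ := (hF q).logDeriv_of_gaussMap_eq hc
    have key : ∀ v w : ℂ, logNorm (logDeriv F q q) * (v * conj w).re =
        (1 + ‖c‖ ^ 2) ^ 2 * ((weierstrassForm F q v : ℂ) * conj (weierstrassForm F q w : ℂ)).re := by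
      intro v w
      rw [weierstrassForm_apply, weierstrassForm_apply, logNorm, hA, hB]
      have h5 : logDeriv F q q 1 0 * v * conj (logDeriv F q q 1 0 * w) =
          ((‖logDeriv F q q 1 0‖ ^ 2 : ℝ) : ℂ) * (v * conj w) := by
        rw [← Complex.normSq_eq_norm_sq, ← Complex.mul_conj, map_mul]
        ring
      rw [h5, Complex.re_ofReal_mul]
      simp only [norm_mul, norm_neg, norm_pow]
      ring
    exact key

lemma solvesWeierstrass_gaussMap (hF : ∀ q, IsLiftAt f F q) :
    SolvesWeierstrass (gaussMap F) (weierstrassForm F) F := by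
  intro q c hc
  obtain ⟨hA, hB⟩ := (hF q).logDeriv_of_gaussMap_eq hc
  have h1 := ((hF q).logDeriv_nilpotent (mem_chart_source ℂ q)).1
  have key : ∀ v : ℂ, ((F q)⁻¹).1 * matDiff F q v =
      (weierstrassForm F q v : ℂ) • !![c, -c ^ 2; 1, -c] := by
    intro v
    rw [inv_mul_matDiff (hF q).hol, weierstrassForm_apply]
    ext i j
    fin_cases i <;> fin_cases j <;> simp [h1, hA, hB] <;> ring
  exact key

omit [IsManifold 𝓘(ℂ) ω S] in
lemma isHolomorphicImmersion_of_isLiftAt (hF : ∀ q, IsLiftAt f F q) : IsHolomorphicImmersion F :=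
  ⟨fun i j q => ((hF q).hol i j).mdifferentiableAt, fun q v hv => (hF q).ne_zero v hv⟩

/-- A lift with `ω ≠ 0` at a given point. -/
lemma exists_isLiftAt_logDeriv_ne_zero (hF : ∀ q, IsLiftAt f F q) (w₀ : S) :
    ∃ G : S → Matrix.SpecialLinearGroup (Fin 2) ℂ, (∀ q, IsLiftAt f G q) ∧
      logDeriv G w₀ w₀ 1 0 ≠ 0 := by
  by_cases hC : logDeriv F w₀ w₀ 1 0 = 0
  · have h1 := ((hF w₀).logDeriv_nilpotent (mem_chart_source ℂ w₀)).1
    obtain ⟨hA, hB⟩ := (hF w₀).logDeriv_of_eq_zero hC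
    -- A rational point of SU(1,1), from 5² - 3² = 4². Conjugating a strictly upper triangular
    -- matrix with entry `B` by it produces the lower left entry `-9 B / 16`.
    let K : Matrix.SpecialLinearGroup (Fin 2) ℂ :=
      ⟨!![5 / 4, 3 / 4; 3 / 4, 5 / 4], by rw [Matrix.det_fin_two]; norm_num⟩
    have h3' : conj (3 : ℂ) = 3 := Complex.conj_eq_iff_real.2 ⟨3, by norm_num⟩
    have h4' : conj (4 : ℂ) = 4 := Complex.conj_eq_iff_real.2 ⟨4, by norm_num⟩
    have h5' : conj (5 : ℂ) = 5 := Complex.conj_eq_iff_real.2 ⟨5, by norm_num⟩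
    have hK : K.1 * e3 * K.1ᴴ = e3 := by
      ext i j
      fin_cases i <;> fin_cases j <;>
        simp [K, e3, Matrix.mul_apply, Fin.sum_univ_two, h3', h4', h5'] <;> norm_num
    have hG : ∀ q, ∀ᶠ x in 𝓝 q, (fun x => F x * K) x = F x * K := fun q =>
      Filter.Eventually.of_forall fun x => rfl
    refine ⟨fun x => F x * K, fun q => (hF q).mul_const hK (hG q), ?_⟩
    have h4 := matDiff_mul_const (hG w₀) (hF w₀).hol
    have h5 : logDeriv (fun x => F x * K) w₀ w₀ = (K⁻¹).1 * logDeriv F w₀ w₀ * K.1 := by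
      have h6 := inv_mul_matDiff h4.1 1
      have h7 := inv_mul_matDiff (hF w₀).hol 1
      rw [one_smul] at h6 h7
      rw [← h6, ← h7, h4.2, mul_inv_rev]
      simp only [Matrix.SpecialLinearGroup.coe_mul, mul_assoc]
    rw [h5, Matrix.SpecialLinearGroup.coe_inv, Matrix.adjugate_fin_two]
    simp [K, Matrix.mul_apply, Matrix.vecMul, dotProduct, Fin.sum_univ_two, hA, hC, h1, hB]
  · exact ⟨F, hF, hC⟩

end Surface

/-! ### Assembling the converse -/

/-- The holomorphic representation of a CMC 1 face, on a simply connected covering surface. -/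
theorem exists_weierstrassData {M : Type*} [TopologicalSpace M] [ChartedSpace ℂ M]
    [IsManifold 𝓘(ℂ) ω M] {M' : Type*} [TopologicalSpace M'] [SimplyConnectedSpace M']
    [ChartedSpace ℂ M'] [IsManifold 𝓘(ℂ) ω M'] {ϱ : M' → M} (hcov : IsLocalHomeomorph ϱ)
    (hϱ : MDifferentiable 𝓘(ℂ) 𝓘(ℂ) ϱ) (w₀ : M') {f : M → L4} (hf : IsCMC1Face f)
    (hconf : ∀ p, ¬ IsSingularPoint f p → IsConformalAt f p) :
    ∃ (g : M' → OnePoint ℂ) (η : ∀ p : M', TangentSpace 𝓘(ℂ) p →L[ℂ] ℂ)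
      (F : M' → Matrix.SpecialLinearGroup (Fin 2) ℂ),
      IsWeierstrassData g η ∧ IsHolomorphicImmersion F ∧ SolvesWeierstrass g η F ∧
        ∀ p, f (ϱ p) = faceOf F p := by
  have hloc : ∀ w, ∃ F : M' → Matrix.SpecialLinearGroup (Fin 2) ℂ,
      ∀ᶠ q in 𝓝 w, IsLiftAt (f ∘ ϱ) F q := by
    intro w
    obtain ⟨F, hF⟩ := exists_isLiftAt hf hconf (ϱ w)
    refine ⟨F ∘ ϱ, ?_⟩
    filter_upwards [hϱ.continuous.continuousAt.eventually hF] with q hq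
    exact hq.comp hϱ hcov
  obtain ⟨F₀, hF₀⟩ := exists_forall_isLiftAt hloc w₀
  obtain ⟨F, hF, hFw⟩ := exists_isLiftAt_logDeriv_ne_zero hF₀ w₀
  have hg := isMeromorphicFunction_gaussMap hF hFw
  have hη := isHolomorphicForm_weierstrassForm fun q => (hF q).hol
  have hρ := hatMetricIsRiemannian_gaussMap hF
  have hs := solvesWeierstrass_gaussMap hF
  have hface : f ∘ ϱ = faceOf F := funext fun p => (hF p).face.symm
  refine ⟨gaussMap F, weierstrassForm F, F, ⟨hg, hη, hρ, fun hall => ?_⟩,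
    isHolomorphicImmersion_of_isLiftAt hF, hs, fun p => congrFun hface p⟩
  obtain ⟨hsm, -, W, hW, hWd, ⟨hpos, -⟩, -⟩ := hf
  -- If `|g|` were identically 1, every point of `f ∘ ϱ` would be singular. But the open image of
  -- `ϱ` meets the dense set `W`, over which the pulled-back metric is positive definite.
  obtain ⟨w, hw⟩ : ∃ w, ϱ w ∈ W := by
    obtain ⟨x, ⟨w, rfl⟩, hxW⟩ := (hWd.inter_open_nonempty _ hcov.isOpenMap.isOpen_range
      ⟨ϱ w₀, w₀, rfl⟩)
    exact ⟨w, hxW⟩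
  obtain ⟨t, ht, hdt, -⟩ := exists_matDiff_eq hg hη hρ (fun q => (hF q).hol) hs.solvesAt w
  have h1 : IsSingularPoint (f ∘ ϱ) w := by
    rw [hface]
    exact (isSingularPoint_faceOf_iff (hF w).hol ht hdt).2 (hall w)
  refine not_isSingularPoint_of_pos ?_ h1
  have key : ∀ v : ℂ, v ≠ 0 → 0 < inducedMetric (f ∘ ϱ) w v v := by
    intro v hv
    unfold inducedMetric
    rw [diff_comp hϱ ((hsm _).mdifferentiableAt (by simp))]
    have hv' : deriv (inCharts ϱ w) (chartAt ℂ w w) * v ≠ 0 :=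
      mul_ne_zero (deriv_inCharts_ne_zero hϱ hcov w) hv
    exact hpos _ hw _ hv'
  exact key

end DeSitter

end

theorem mainTheorem4
    {M : Type*} [TopologicalSpace M] [T2Space M] [ConnectedSpace M]
    [ChartedSpace ℂ M] [IsManifold 𝓘(ℂ) ω M]
    {M' : Type*} [TopologicalSpace M'] [SimplyConnectedSpace M']
    [ChartedSpace ℂ M'] [IsManifold 𝓘(ℂ) ω M']
    (ϱ : M' → M) (hϱ : IsCoveringMap ϱ) (hϱ_hol : MDifferentiable 𝓘(ℂ) 𝓘(ℂ) ϱ)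
    (z₀ : M) (w₀ : M') (hw₀ : ϱ w₀ = z₀) :
    (∀ (g : M' → OnePoint ℂ) (η : ∀ p : M', TangentSpace 𝓘(ℂ) p →L[ℂ] ℂ),
      IsWeierstrassData g η →
      (∃! F : M' → Matrix.SpecialLinearGroup (Fin 2) ℂ,
        IsHolomorphicImmersion F ∧ F w₀ = 1 ∧ SolvesWeierstrass g η F) ∧
      ∀ F : M' → Matrix.SpecialLinearGroup (Fin 2) ℂ,
        IsHolomorphicImmersion F → F w₀ = 1 → SolvesWeierstrass g η F →
        IsCMC1Face (faceOf F) ∧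
        (∀ p, ¬ IsSingularPoint (faceOf F) p → IsConformalAt (faceOf F) p) ∧
        (∀ (p : M') (c : ℂ), g p = (c : OnePoint ℂ) → ∀ v w : TangentSpace 𝓘(ℝ, ℂ) p,
          inducedMetric (faceOf F) p v w
            = (1 - ‖c‖ ^ 2) ^ 2 * (η p v * conj (η p w)).re) ∧
        (∃ N : M' → L4,
          (∀ p, ¬ IsSingularPoint (faceOf F) p → IsOrientedUnitNormal (faceOf F) p (N p)) ∧
          (∀ (p : M') (c : ℂ), ¬ IsSingularPoint (faceOf F) p → g p = (c : OnePoint ℂ) →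
            ∀ v w : TangentSpace 𝓘(ℝ, ℂ) p,
              let Q : ℂ := η p v * complexDiff (fun q => finiteValue (g q)) p w
              ((secondForm (faceOf F) N p v w : ℝ) : ℂ)
                = Q + conj Q + ((inducedMetric (faceOf F) p v w : ℝ) : ℂ)) ∧
          (∀ p, ¬ IsSingularPoint (faceOf F) p → ∀ (j : Fin 2) (v : TangentSpace 𝓘(ℂ) p),
            (matDiff F p v 0 j ≠ 0 ∨ matDiff F p v 1 j ≠ 0) →
              hyperbolicGaussMap (faceOf F) N p
                = ratio (matDiff F p v 0 j) (matDiff F p v 1 j))) ∧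
        (∀ p, IsSingularPoint (faceOf F) p ↔ UnitModulus (g p))) ∧
    (∀ f : M → L4, IsCMC1Face f → (∀ p, ¬ IsSingularPoint f p → IsConformalAt f p) →
      ∃ (g : M' → OnePoint ℂ) (η : ∀ p : M', TangentSpace 𝓘(ℂ) p →L[ℂ] ℂ)
        (F : M' → Matrix.SpecialLinearGroup (Fin 2) ℂ),
        IsWeierstrassData g η ∧ IsHolomorphicImmersion F ∧ SolvesWeierstrass g η F ∧
          ∀ p, f (ϱ p) = faceOf F p) := by
  exact ⟨fun g η hW => ⟨existsUnique_solvesWeierstrass hW.1 hW.2.1 hW.2.2.1 w₀,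
    fun F hFi _ hFs => isCMC1Face_faceOf hW hFi hFs⟩, fun f hf hconf =>
    exists_weierstrassData hϱ.isLocalHomeomorph hϱ_hol w₀ hf hconf⟩
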